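/- Let $k$ be a field of characteristic $0$, let $\mathbf{V}=\bigcup_{n} k^n$ with basis indexed by the natural numbers, and let $\mathrm{GL}=\bigcup_{n\ge 1}\mathrm{GL}_n(k)$, regarded as a discrete group acting on $\mathbf{V}$. A $k$-linear representation of $\mathrm{GL}$ is *polynomial* if it is a subquotient of a (possibly infinite) direct sum of tensor powers of $\mathbf{V}$; for a representation $W$, let $W^{\mathrm{pol}}$ be the set of elements of $W$ that generate a polynomial subrepresentation. For a tuple of partitions $\underline{\lambda}=[\lambda_1,\dots,\lambda_r]$ (with $r\ge 0$) put $k^{\oplus\underline{\lambda}}=\bigoplus_{i=1}^r \mathbf{S}_{\lambda_i}(\mathbf{V})$, where $\mathbf{S}_{\lambda}$ is the Schur functor of $\lambda$, and for a $k$-algebra $A$ with an action of $\mathrm{GL}$ put $A^{\oplus\underline{\lambda}}=A\otimes_k k^{\oplus\underline{\lambda}}$ with the diagonal action. For an object $X$ with an action of $\mathrm{GL}$, its shift $\mathrm{Sh}_n(X)$ is the same object with $\mathrm{GL}$ acting through the self-embedding $A\mapsto \begin{pmatrix}1_n&0\\0&A\end{pmatrix}$ of $\mathrm{GL}$. A *$\mathrm{GL}$-algebra*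 is a commutative $k$-algebra $R$ with an action of $\mathrm{GL}$ by $k$-algebra automorphisms under which $R$ is a polynomial representation; it is *integral* if $R$ is a domain. An *$R$-module* is an ordinary $R$-module $M$ with a $k$-linear action of $\mathrm{GL}$ such that $g(am)=(ga)(gm)$ and such that $M$ is a polynomial representation. A *$\mathrm{GL}$-field* is a field extension $K/k$ with an action of $\mathrm{GL}$ by $k$-automorphisms such that every element of $K$ has the form $a/b$ with $a,b\in K^{\mathrm{pol}}$, $b\neq 0$. A *$K$-module* is a $K$-vector space $M$ with an additive action of $\mathrm{GL}$ satisfying $g(am)=(ga)(gm)$, such that every element of $M$ has the form $ax$ with $a\in K$ and $x\in M^{\mathrm{pol}}$. In both cases, $M$ is *finitely generated* if it is generated, as an ordinary module, by the $\mathrm{GL}$-orbits of finitely many elements. Isomorphisms of modules are linear and $\mathrm{GL}$-equivariant. **Theorem (Shift theorem).** (a) Let $R$ be an integral $\mathrm{GL}$-algebra and let $M$ be a finitely generated $R$-module. Then there exist $n\ge 0$, a tuple of partitions $\underline{\lambda}$, a non-zero $\mathrm{GL}$-invariant element $f\in \mathrm{Sh}_n(R)$, and an isomorphism $\mathrm{Sh}_n(M)[1/f]\cong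 \mathrm{Sh}_n(R)[1/f]^{\oplus\underline{\lambda}}$ of $\mathrm{Sh}_n(R)[1/f]$-modules. (b) Let $K$ be a $\mathrm{GL}$-field and let $M$ be a finitely generated $K$-module. Then there exist $n\ge 0$, a tuple of partitions $\underline{\lambda}$, and an isomorphism $\mathrm{Sh}_n(M)\cong \mathrm{Sh}_n(K)^{\oplus\underline{\lambda}}$ of $\mathrm{Sh}_n(K)$-modules. -/

import Mathlib

open scoped TensorProduct DirectSum

noncomputable section

namespace PolyGL

universe u v

section InfiniteGeneralLinearGroup

variable (k : Type*) [Field k]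

/-- The standard representation space `V = ⋃ₙ kⁿ`, with basis `e₀, e₁, e₂, …`. -/
abbrev Std : Type _ := ℕ →₀ k

/-- The group `GL = ⋃ₙ GLₙ(k)`: the automorphisms `g` of `V = ⋃ₙ kⁿ` whose matrix has the form
`diag(A, 1, 1, …)` with `A` of size `n × n`, for some `n`. The first condition describes the
columns of index `≥ n`, the second one the rows of index `≥ n`. -/
def GLInf : Subgroup (Std k ≃ₗ[k] Std k) where
  carrier := {g | ∃ n : ℕ, (∀ i, n ≤ i → g (Finsupp.single i 1) = Finsupp.single i 1) ∧
    ∀ (v : Std k) (j : ℕ), n ≤ j → g v j = v j}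
  one_mem' := ⟨0, fun _ _ => rfl, fun _ _ _ => rfl⟩
  mul_mem' := by
    rintro g h ⟨m, hg₁, hg₂⟩ ⟨n, hh₁, hh₂⟩
    refine ⟨max m n, fun i hi => ?_, fun v j hj => ?_⟩
    · rw [LinearEquiv.mul_apply, hh₁ i (le_trans (le_max_right _ _) hi),
        hg₁ i (le_trans (le_max_left _ _) hi)]
    · rw [LinearEquiv.mul_apply, hg₂ _ j (le_trans (le_max_left _ _) hj),
        hh₂ v j (le_trans (le_max_right _ _) hj)]
  inv_mem' := by
    rintro g ⟨n, h₁, h₂⟩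
    have hinv : ∀ v, g (g⁻¹ v) = v := fun v => g.apply_symm_apply v
    refine ⟨n, fun i hi => g.injective ?_, fun v j hj => ?_⟩
    · rw [hinv, h₁ i hi]
    · rw [← h₂ (g⁻¹ v) j hj, hinv]

/-- The standard representation of `GL` on `V`. -/
def stdRep : Representation k (GLInf k) (Std k) where
  toFun g := (g : Std k ≃ₗ[k] Std k).toLinearMap
  map_one' := rfl
  map_mul' _ _ := rfl

variable {k}

/-- The inclusion `V → V` with `e_i ↦ e_{n+i}`. -/
def shiftIn (n : ℕ) : Std k →ₗ[k] Std k := Finsupp.lmapDomain k k (fun i => n + i)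

/-- The projection `V → V` with `e_{n+i} ↦ e_i`, and `e_i ↦ 0` for `i < n`. -/
def shiftOut (n : ℕ) : Std k →ₗ[k] Std k :=
  Finsupp.lcomapDomain (fun i => n + i) (add_right_injective n)

theorem shiftOut_shiftIn (n : ℕ) (v : Std k) : shiftOut n (shiftIn n v) = v :=
  Finsupp.comapDomain_mapDomain _ (add_right_injective n) v

theorem shiftOut_apply (n : ℕ) (v : Std k) (j : ℕ) : shiftOut n v j = v (n + j) := rfl

theorem shiftIn_apply_add (n : ℕ) (v : Std k) (j : ℕ) : shiftIn n v (n + j) = v j := by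
  rw [← shiftOut_apply, shiftOut_shiftIn]

theorem shiftOut_single_add (n i : ℕ) :
    shiftOut n (Finsupp.single (n + i) (1 : k)) = Finsupp.single i 1 := by
  have h : Finsupp.single (n + i) (1 : k) = shiftIn n (Finsupp.single i 1) :=
    (Finsupp.mapDomain_single).symm
  rw [h, shiftOut_shiftIn]

/-- The block matrix `diag(1, A)` with identity block of size `n × n`, as an endomorphism of `V`:
it is the identity on the span of `e_0, …, e_{n-1}`, and it is `A` on the span of
`e_n, e_{n+1}, …`, identified with `V` by shifting indices. -/
def blockMap (n : ℕ) (A : Std k →ₗ[k] Std k) : Std k →ₗ[k] Std k :=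
  LinearMap.id + shiftIn n ∘ₗ (A - LinearMap.id) ∘ₗ shiftOut n

theorem blockMap_apply (n : ℕ) (A : Std k →ₗ[k] Std k) (v : Std k) :
    blockMap n A v = v + shiftIn n (A (shiftOut n v) - shiftOut n v) := rfl

theorem blockMap_id (n : ℕ) : blockMap n (LinearMap.id : Std k →ₗ[k] Std k) = LinearMap.id := by
  refine LinearMap.ext fun v => ?_
  change v + shiftIn n (shiftOut n v - shiftOut n v) = v
  rw [sub_self, map_zero, add_zero]

theorem blockMap_comp (n : ℕ) (A B : Std k →ₗ[k] Std k) (v : Std k) :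
    blockMap n A (blockMap n B v) = blockMap n (A ∘ₗ B) v := by
  simp only [blockMap_apply, map_add, map_sub, shiftOut_shiftIn, LinearMap.comp_apply]
  abel

/-- `diag(1, A)` as an automorphism of `V`. -/
def blockEquiv (n : ℕ) (A : Std k ≃ₗ[k] Std k) : Std k ≃ₗ[k] Std k :=
  { blockMap n A.toLinearMap with
    invFun := blockMap n A.symm.toLinearMap
    left_inv := fun v => by
      change blockMap n A.symm.toLinearMap (blockMap n A.toLinearMap v) = v
      rw [blockMap_comp, LinearEquiv.symm_comp, blockMap_id, LinearMap.id_apply]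
    right_inv := fun v => by
      change blockMap n A.toLinearMap (blockMap n A.symm.toLinearMap v) = v
      rw [blockMap_comp, LinearEquiv.comp_symm, blockMap_id, LinearMap.id_apply] }

theorem blockEquiv_apply (n : ℕ) (A : Std k ≃ₗ[k] Std k) (v : Std k) :
    blockEquiv n A v = v + shiftIn n (A (shiftOut n v) - shiftOut n v) := rfl

theorem blockEquiv_mem (n : ℕ) {A : Std k ≃ₗ[k] Std k} (hA : A ∈ GLInf k) :
    blockEquiv n A ∈ GLInf k := by
  obtain ⟨m, h₁, h₂⟩ := hA
  refine ⟨n + m, fun i hi => ?_, fun v j hj => ?_⟩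
  · obtain ⟨i, rfl⟩ := Nat.exists_eq_add_of_le (le_trans (Nat.le_add_right n m) hi)
    rw [blockEquiv_apply, shiftOut_single_add, h₁ i (by omega), sub_self, map_zero, add_zero]
  · obtain ⟨j, rfl⟩ := Nat.exists_eq_add_of_le (le_trans (Nat.le_add_right n m) hj)
    rw [blockEquiv_apply, Finsupp.add_apply, shiftIn_apply_add, Finsupp.sub_apply,
      h₂ _ j (by omega), sub_self, add_zero]

/-- The self-embedding `GL ≅ G(n) ⊆ GL`, `A ↦ diag(1, A)` with identity block of size `n × n`. -/
def shiftEmb (n : ℕ) : GLInf k →* GLInf k where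
  toFun A := ⟨blockEquiv n A.1, blockEquiv_mem n A.2⟩
  map_one' := by
    ext1; ext1 v
    exact congrArg (fun φ : Std k →ₗ[k] Std k => φ v) (blockMap_id n)
  map_mul' A B := by
    ext1; ext1 v
    exact (blockMap_comp n A.1.toLinearMap B.1.toLinearMap v).symm

/-- The `n`-th shift of an action of `GL`: the same object, on which `GL` acts through
`GL ≅ G(n) ⊆ GL`. Here `H` is the monoid of endomorphisms or automorphisms of the object. -/
def shift (n : ℕ) {H : Type*} [Monoid H] (ρ : GLInf k →* H) : GLInf k →* H :=
  ρ.comp (shiftEmb n)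

end InfiniteGeneralLinearGroup

section PolynomialRepresentations

variable (k : Type*) [Field k]

/-- The tensor power of the standard representation with factors indexed by `ι`. -/
def tensorRep (ι : Type*) : Representation k (GLInf k) (⨂[k] _ : ι, Std k) where
  toFun g := PiTensorProduct.map fun _ => stdRep k g
  map_one' := by
    simp only [map_one]
    exact PiTensorProduct.map_one
  map_mul' g h := by
    simp only [map_mul]
    exact PiTensorProduct.map_mul _ _

variable {k}

/-- A representation of `GL` is polynomial if it is a subquotient (a quotient of a
subrepresentation) of a possibly infinite direct sum of tensor powers `V^{⊗ d}`. -/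
def IsPolynomial {k : Type u} [Field k] {M : Type v} [AddCommMonoid M] [Module k M]
    (ρ : Representation k (GLInf k) M) : Prop :=
  ∃ (ι : Type v) (d : ι → ℕ)
    (W : Subrepresentation (Representation.directSum fun i => tensorRep k (Fin (d i))))
    (φ : Representation.IntertwiningMap W.toRepresentation ρ), Function.Surjective φ

/-- The subrepresentation generated by an element. -/
def generatedBy {M : Type*} [AddCommMonoid M] [Module k M]
    (ρ : Representation k (GLInf k) M) (x : M) : Subrepresentation ρ where
  toSubmodule := Submodule.span k (Set.range fun g => ρ g x)
  apply_mem_toSubmodule g v hv := by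
    induction hv using Submodule.span_induction with
    | mem y hy =>
      obtain ⟨h, rfl⟩ := hy
      refine Submodule.subset_span ⟨g * h, ?_⟩
      simp only [map_mul, Module.End.mul_apply]
    | zero => simp
    | add y z _ _ hy hz => rw [map_add]; exact Submodule.add_mem _ hy hz
    | smul a y _ hy => rw [map_smul]; exact Submodule.smul_mem _ _ hy

/-- An element of a representation is polynomial if the subrepresentation that it generates is
polynomial; the set of these elements of `M` is `M^pol`. -/
def IsPolynomialElement {M : Type*} [AddCommMonoid M] [Module k M]
    (ρ : Representation k (GLInf k) M) (x : M) : Prop :=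
  IsPolynomial (generatedBy ρ x).toRepresentation

end PolynomialRepresentations

section SchurFunctors

variable (k : Type*) [Field k] (μ : YoungDiagram)

/-- The row group of a partition: the permutations of the cells that preserve each row. -/
def rowGroup : Finset (Equiv.Perm μ.cells) :=
  Finset.univ.filter fun p => ∀ c, (p c).1.1 = c.1.1

/-- The column group of a partition: the permutations of the cells that preserve each column. -/
def colGroup : Finset (Equiv.Perm μ.cells) :=
  Finset.univ.filter fun q => ∀ c, (q c).1.2 = c.1.2

/-- The action of a permutation of the cells on the tensor power of `V` indexed by the cells. -/
def permMap (p : Equiv.Perm μ.cells) :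
    (⨂[k] _ : μ.cells, Std k) →ₗ[k] (⨂[k] _ : μ.cells, Std k) :=
  (PiTensorProduct.reindex k (fun _ : μ.cells => Std k) p).toLinearMap

/-- The Young symmetrizer `∑_p ∑_q sgn(q) p q`, where `p` runs through the row group and `q`
through the column group, acting on the tensor power of `V` indexed by the cells. -/
def youngSymmetrizer : (⨂[k] _ : μ.cells, Std k) →ₗ[k] (⨂[k] _ : μ.cells, Std k) :=
  ∑ p ∈ rowGroup μ, ∑ q ∈ colGroup μ,
    ((Equiv.Perm.sign q : ℤ) : k) • (permMap k μ p ∘ₗ permMap k μ q)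

theorem tensorRep_permMap (g : GLInf k) (p : Equiv.Perm μ.cells)
    (x : ⨂[k] _ : μ.cells, Std k) :
    tensorRep k μ.cells g (permMap k μ p x) = permMap k μ p (tensorRep k μ.cells g x) :=
  PiTensorProduct.map_reindex (fun _ : μ.cells => stdRep k g) p x

theorem tensorRep_youngSymmetrizer (g : GLInf k) (x : ⨂[k] _ : μ.cells, Std k) :
    tensorRep k μ.cells g (youngSymmetrizer k μ x) =
      youngSymmetrizer k μ (tensorRep k μ.cells g x) := by
  simp only [youngSymmetrizer, LinearMap.sum_apply, LinearMap.smul_apply, LinearMap.comp_apply,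
    map_sum, map_smul, tensorRep_permMap]

/-- The Schur functor `S_μ` of a partition `μ` evaluated on `V`: the image of the Young
symmetrizer, as a subrepresentation of the tensor power of `V`. -/
def schur : Subrepresentation (tensorRep k μ.cells) where
  toSubmodule := LinearMap.range (youngSymmetrizer k μ)
  apply_mem_toSubmodule := by
    rintro g _ ⟨x, rfl⟩
    exact ⟨tensorRep k μ.cells g x, (tensorRep_youngSymmetrizer k μ g x).symm⟩

variable {r : ℕ} (lam : Fin r → YoungDiagram)

/-- The space `k^{⊕ λ} = ⨁_i S_{λ_i}(V)` for a tuple of partitions `λ = [λ_1, …, λ_r]`. -/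
abbrev TupleSpace : Type _ := ⨁ i, (schur k (lam i)).toSubmodule

/-- The representation of `GL` on `k^{⊕ λ}`. -/
def tupleRep : Representation k (GLInf k) (TupleSpace k lam) :=
  Representation.directSum fun i => (schur k (lam i)).toRepresentation

end SchurFunctors

section SemilinearActions

variable {k : Type*} [Field k] {G : Type*} [Group G]
  {R : Type*} [CommRing R] [Algebra k R]
  {M : Type*} [AddCommGroup M] [Module k M] [Module R M]

/-- The linear representation underlying an action by algebra automorphisms. -/
def algRep (ρ : G →* (R ≃ₐ[k] R)) : Representation k G R where
  toFun g := (ρ g).toLinearMap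
  map_one' := by ext; simp
  map_mul' g h := by ext; simp

/-- Compatibility of the actions on a ring and on a module: `g (a m) = (g a) (g m)`. -/
def IsSemilinear (ρ : G →* (R ≃ₐ[k] R)) (ρM : Representation k G M) : Prop :=
  ∀ (g : G) (a : R) (m : M), ρM g (a • m) = ρ g a • ρM g m

theorem IsSemilinear.shift {ρ : GLInf k →* (R ≃ₐ[k] R)} {ρM : Representation k (GLInf k) M}
    (h : IsSemilinear ρ ρM) (n : ℕ) : IsSemilinear (shift n ρ) (shift n ρM) :=
  fun g a m => h (shiftEmb n g) a m

/-- The free module `A^{⊕ λ} = A ⊗ k^{⊕ λ}` (here only its action of `GL`, which is the diagonal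
one; `A` acts on the left factor). -/
def freeRep (ρ : GLInf k →* (R ≃ₐ[k] R)) {r : ℕ} (lam : Fin r → YoungDiagram) :
    Representation k (GLInf k) (R ⊗[k] TupleSpace k lam) :=
  (algRep ρ).tprod (tupleRep k lam)

theorem map_powers (ρ : G →* (R ≃ₐ[k] R)) (f : R) (hf : ∀ g, ρ g f = f) (g : G) :
    (Submonoid.powers f).map (ρ g) = Submonoid.powers f := by
  ext x
  simp only [Submonoid.mem_map, Submonoid.mem_powers_iff]
  constructor
  · rintro ⟨_, ⟨n, rfl⟩, rfl⟩
    exact ⟨n, by rw [map_pow, hf]⟩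
  · rintro ⟨n, rfl⟩
    exact ⟨f ^ n, ⟨n, rfl⟩, by rw [map_pow, hf]⟩

/-- The action on `R[1/f]` induced by an action on `R` that fixes `f`. -/
def awayAction (ρ : G →* (R ≃ₐ[k] R)) (f : R) (hf : ∀ g, ρ g f = f) :
    G →* (Localization.Away f ≃ₐ[k] Localization.Away f) where
  toFun g := IsLocalization.algEquivOfAlgEquiv (Localization.Away f) (Localization.Away f)
    (ρ g) (map_powers ρ f hf g)
  map_one' := by
    ext x
    obtain ⟨a, s, rfl⟩ := IsLocalization.exists_mk'_eq (Submonoid.powers f) x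
    rw [IsLocalization.algEquivOfAlgEquiv_mk']
    simp
  map_mul' g h := by
    ext x
    obtain ⟨a, s, rfl⟩ := IsLocalization.exists_mk'_eq (Submonoid.powers f) x
    rw [AlgEquiv.mul_apply]
    simp only [IsLocalization.algEquivOfAlgEquiv_mk']
    simp

theorem smul_powers {ρ : G →* (R ≃ₐ[k] R)} {ρM : Representation k G M}
    (h : IsSemilinear ρ ρM) {f : R} (hf : ∀ g, ρ g f = f) (g : G)
    (s : Submonoid.powers f) (m : M) : ρM g (s • m) = s • ρM g m := by
  obtain ⟨_, n, rfl⟩ := s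
  change ρM g ((f ^ n) • m) = (f ^ n) • ρM g m
  rw [h, map_pow, hf]

/-- The action `m / s ↦ (g m) / s` on `M[1/f]` induced by an action on `M`, where `f` is an
invariant element of `R`. -/
def awayModuleAction {ρ : G →* (R ≃ₐ[k] R)} {ρM : Representation k G M}
    (h : IsSemilinear ρ ρM) (f : R) (hf : ∀ g, ρ g f = f) :
    G →* AddMonoid.End (LocalizedModule (Submonoid.powers f) M) where
  toFun g :=
    { toFun := fun x => x.liftOn (fun p => LocalizedModule.mk (ρM g p.1) p.2) (by
        rintro ⟨m, s⟩ ⟨m', s'⟩ ⟨u, hu⟩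
        refine LocalizedModule.mk_eq.2 ⟨u, ?_⟩
        have := congrArg (ρM g) hu
        simpa only [smul_powers h hf] using this)
      map_zero' := by
        rw [← LocalizedModule.zero_mk (1 : Submonoid.powers f), LocalizedModule.liftOn_mk,
          map_zero]
      map_add' := fun x y => by
        induction x using LocalizedModule.induction_on with | _ m s
        induction y using LocalizedModule.induction_on with | _ m' s'
        simp only [LocalizedModule.mk_add_mk, LocalizedModule.liftOn_mk, map_add,
          smul_powers h hf] }
  map_one' := by
    ext x
    induction x using LocalizedModule.induction_on with | _ m s
    change LocalizedModule.mk (ρM 1 m) s = LocalizedModule.mk m s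
    rw [map_one, Module.End.one_apply]
  map_mul' g g' := by
    ext x
    induction x using LocalizedModule.induction_on with | _ m s
    change LocalizedModule.mk (ρM (g * g') m) s = LocalizedModule.mk (ρM g (ρM g' m)) s
    rw [map_mul, Module.End.mul_apply]

theorem awayModuleAction_mk {ρ : G →* (R ≃ₐ[k] R)} {ρM : Representation k G M}
    (h : IsSemilinear ρ ρM) (f : R) (hf : ∀ g, ρ g f = f) (g : G) (m : M)
    (s : Submonoid.powers f) :
    awayModuleAction h f hf g (LocalizedModule.mk m s) = LocalizedModule.mk (ρM g m) s := rfl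

/-- Finite generation of an equivariant module: finitely many `G`-orbits span it. -/
def IsFinitelyGenerated (R : Type*) [CommRing R] {M : Type*} [AddCommGroup M] [Module k M]
    [Module R M] (ρM : Representation k G M) : Prop :=
  ∃ s : Finset M, Submodule.span R {y | ∃ g, ∃ x ∈ s, ρM g x = y} = ⊤

end SemilinearActions

section AlgebrasFieldsModules

variable {k : Type*} [Field k]

/-- A commutative `k`-algebra with an action of `GL` by algebra automorphisms is a `GL`-algebra
if it forms a polynomial representation. -/
def IsGLAlgebra {R : Type*} [CommRing R] [Algebra k R] (ρ : GLInf k →* (R ≃ₐ[k] R)) : Prop :=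
  IsPolynomial (algRep ρ)

/-- Modules over a `GL`-algebra `R`: `R`-modules with a compatible action of `GL` under which they
form a polynomial representation. -/
structure IsGLAlgebraModule {R : Type*} [CommRing R] [Algebra k R] (ρ : GLInf k →* (R ≃ₐ[k] R))
    {M : Type*} [AddCommGroup M] [Module k M] [Module R M]
    (ρM : Representation k (GLInf k) M) : Prop where
  semilinear : IsSemilinear ρ ρM
  polynomial : IsPolynomial ρM

/-- A field extension `K/k` with an action of `GL` by `k`-automorphisms is a `GL`-field if each of
its elements has the form `a / b` with `a, b ∈ K^pol`. -/
def IsGLField {K : Type*} [Field K] [Algebra k K] (ρ : GLInf k →* (K ≃ₐ[k] K)) : Prop :=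
  ∀ x : K, ∃ a b : K, IsPolynomialElement (algRep ρ) a ∧ IsPolynomialElement (algRep ρ) b ∧
    b ≠ 0 ∧ x = a / b

/-- Modules over a `GL`-field `K`: semi-linear representations of `GL` over `K` each of whose
elements has the form `a x` with `a ∈ K` and `x ∈ M^pol`. -/
structure IsGLFieldModule {K : Type*} [Field K] [Algebra k K] (ρ : GLInf k →* (K ≃ₐ[k] K))
    {M : Type*} [AddCommGroup M] [Module k M] [Module K M]
    (ρM : Representation k (GLInf k) M) : Prop where
  semilinear : IsSemilinear ρ ρM
  exists_smul : ∀ m : M, ∃ (a : K) (x : M), IsPolynomialElement ρM x ∧ m = a • x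

end AlgebrasFieldsModules

end PolyGL

end

/-!
The proof is an induction on the degrees of generators of the module, which runs at the same time
for modules over domains and over fields.

*Reduction.* Everything that is needed about the ring is that its elements are, up to a factor,
"good" (`IsTame`): fixed by some subgroup `G(n) = {diag(1_n, A)}` of `GL`, and carried by the
shears `1 + s D` to polynomial functions of `s`. Images of tensor powers of `V` consist of good
elements. Since tensor powers are completely reducible, a polynomial element of a representation is
a sum of elements of such images (`IsPolynomial.mem_tensorImages`). So a finitely generated module
is spanned by finitely many equivariant images of tensor powers, of degrees at most `d`
say (`IsTensorGen`), and those of degree `d` split into Schur functors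
(`IsSchurGen`).

*Representation theory.* In the group algebra of a symmetric group the Young symmetrizers generate
the unit ideal (`one_mem_span_youngElt`), because as many central elements as there are
conjugacy classes are obtained from them. This makes a tensor power a finite sum of images of
Schur functors (`exists_schur_cover`). A Schur functor is simple (`schur_le_of_mem`), with scalar
endomorphisms only (`schur_end_eq_smul`): every non-zero tensor is moved by the group algebra of
`GL` to a combination of the basis tensors whose letters are a permutation of a fixed set of
distinct letters, and on their span, a regular representation of the symmetric group, everything
follows from `c x c = s c` for a Young symmetrizer `c`. Consequently any representation that embeds
into a finite sum of images of Schur functors is a finite direct sum of Schur functors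
(`IsSchurGenerated.exists_equiv_tupleSpace`). This applies to the shift of a Schur functor, which
is the sum of its shifted copy (the letters `e_i`, `i ≥ n`) and of images of tensor powers of lower
degree, obtained by inserting letters `e_i` with `i < n` (`exists_low`).

*The induction step.* Let `N` be a submodule that is already treated and let `φ : S_μ → M` be
equivariant with `|μ| = d`. If the elements of `A ⊗ S_μ` stay independent modulo `N`, the free
module is enlarged by `S_μ` (`IsGenericallyFree.sup_free`). Otherwise there is a relation
`∑ a_i φ(w_i) ∈ N` with good coefficients. For `n` so large that `G(n)` fixes the `a_i` and only
the letters `e_i`, `i < n`, occur in the `w_i`, apply the shear with `e_i ↦ e_i + s e_{n+i}` for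
`i < n`. Modulo tensors that contain a small letter, it multiplies the shifts `ι w_i` by `s^d`; so
`∑ (u(s) a_i) φ(ι w_i)`, a polynomial function of `s`, lies in the submodule `L` generated by `N`
and by images of lower degree for all `s ≠ 0`, hence also for `s = 0`. As `G(n)` fixes the `a_i`,
Jacobson density for `S_μ` isolates one coefficient `f = a_i`, with `f φ(ι S_μ) ⊆ L`
(`exists_smul_mem`). After the shift by `n` the module is thus contained in `L` up to the invariant
factor `f`, and `L` has one Schur functor of degree `d` less.

The outcome `IsGenericallyFree` is an injective map from a free module whose image contains a
multiple of each element by a power of `f`; it becomes an isomorphism once `f` is inverted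
(`exists_localized_equiv`).
-/

set_option linter.unusedSectionVars false

noncomputable section

namespace PolyGL

universe u v

/-! ### Tableaux -/

section Tableaux

theorem sum_range_card_add_le (s : Finset ℕ) :
    ∑ i ∈ Finset.range s.card, i + (s \ Finset.range s.card).card ≤ ∑ i ∈ s, i := by
  set R := Finset.range s.card with hR
  have hc : (s \ R).card = (R \ s).card :=
    Finset.card_sdiff_comm (by rw [hR, Finset.card_range])
  have h1 : ∑ i ∈ s, i = ∑ i ∈ s ∩ R, i + ∑ i ∈ s \ R, i :=
    (Finset.sum_inter_add_sum_sdiff _ _ _).symm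
  have h2 : ∑ i ∈ R, i = ∑ i ∈ s ∩ R, i + ∑ i ∈ R \ s, i := by
    rw [Finset.inter_comm]
    exact (Finset.sum_inter_add_sum_sdiff _ _ _).symm
  have h3 : (s \ R).card * s.card ≤ ∑ i ∈ s \ R, i := by
    rw [← smul_eq_mul]
    refine Finset.card_nsmul_le_sum _ _ _ fun i hi => ?_
    simp only [hR, Finset.mem_sdiff, Finset.mem_range] at hi
    omega
  have h4 : ∑ i ∈ R \ s, i + (R \ s).card ≤ (R \ s).card * s.card := by
    have : ∑ i ∈ R \ s, (i + 1) ≤ (R \ s).card • s.card := by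
      refine Finset.sum_le_card_nsmul _ _ _ fun i hi => ?_
      simp only [hR, Finset.mem_sdiff, Finset.mem_range] at hi
      omega
    simpa [Finset.sum_add_distrib] using this
  rw [h1, h2]
  rw [hc] at *
  omega

variable {α : Type*} [Fintype α] [DecidableEq α]

/-- A filling of the Young diagram `μ` by the elements of `α`, encoded by the functions giving the
row and the column of each entry. -/
structure IsTableau (μ : YoungDiagram) (r c : α → ℕ) : Prop where
  inj : ∀ x y, r x = r y → c x = c y → x = y
  mem_iff : ∀ i j, (i, j) ∈ μ ↔ ∃ x, r x = i ∧ c x = j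

variable {μ ν : YoungDiagram} {r c r' c' : α → ℕ}

theorem IsTableau.card_row (h : IsTableau μ r c) (i : ℕ) :
    (Finset.univ.filter fun x => r x = i).card = μ.rowLen i := by
  rw [μ.rowLen_eq_card]
  refine Finset.card_bij (fun x _ => (r x, c x)) ?_ ?_ ?_
  · intro x hx
    simp only [Finset.mem_filter, Finset.mem_univ, true_and] at hx
    rw [YoungDiagram.mem_row_iff]
    exact ⟨(h.mem_iff _ _).2 ⟨x, rfl, rfl⟩, hx⟩
  · intro x _ y _ hxy
    exact h.inj x y (congrArg Prod.fst hxy) (congrArg Prod.snd hxy)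
  · rintro ⟨a, b⟩ hab
    rw [YoungDiagram.mem_row_iff] at hab
    obtain ⟨x, rfl, rfl⟩ := (h.mem_iff _ _).1 hab.1
    exact ⟨x, by simpa using hab.2, rfl⟩

theorem IsTableau.image_col (h : IsTableau μ r c) (j : ℕ) :
    (Finset.univ.filter fun x => c x = j).image r = Finset.range (μ.colLen j) := by
  ext i
  rw [Finset.mem_range, ← YoungDiagram.mem_iff_lt_colLen, h.mem_iff]
  simp [and_comm]

theorem IsTableau.eq_of_row (h : IsTableau μ r c) (h' : IsTableau ν r c') : μ = ν := by
  ext ⟨i, j⟩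
  rw [YoungDiagram.mem_cells, YoungDiagram.mem_cells, YoungDiagram.mem_iff_lt_rowLen,
    YoungDiagram.mem_iff_lt_rowLen, ← h.card_row, ← h'.card_row]

theorem IsTableau.card_eq (h : IsTableau μ r c) : μ.cells.card = Fintype.card α := by
  symm
  refine Finset.card_bij (fun x _ => (r x, c x)) ?_ ?_ ?_
  · intro x _
    exact (YoungDiagram.mem_cells _).2 ((h.mem_iff _ _).2 ⟨x, rfl, rfl⟩)
  · intro x _ y _ hxy
    exact h.inj x y (congrArg Prod.fst hxy) (congrArg Prod.snd hxy)
  · rintro ⟨a, b⟩ hab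
    obtain ⟨x, rfl, rfl⟩ := (h.mem_iff _ _).1 ((YoungDiagram.mem_cells _).1 hab)
    exact ⟨x, Finset.mem_univ _, rfl⟩

theorem IsTableau.comp (h : IsTableau μ r c) {β : Type*} (e : β ≃ α) :
    IsTableau μ (r ∘ e) (c ∘ e) where
  inj x y h1 h2 := e.injective (h.inj _ _ h1 h2)
  mem_iff i j := by
    rw [h.mem_iff]
    exact ⟨fun ⟨x, hx⟩ => ⟨e.symm x, by simpa using hx⟩, fun ⟨x, hx⟩ => ⟨e x, hx⟩⟩

theorem isTableau_cells (μ : YoungDiagram) :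
    IsTableau μ (fun x : μ.cells => x.1.1) (fun x : μ.cells => x.1.2) where
  inj x y h1 h2 := Subtype.ext (Prod.ext h1 h2)
  mem_iff i j := ⟨fun h => ⟨⟨(i, j), (YoungDiagram.mem_cells _).2 h⟩, rfl, rfl⟩, by
    rintro ⟨x, rfl, rfl⟩
    exact (YoungDiagram.mem_cells _).1 x.2⟩

/-- If a filling of rows is transversal to the columns of a tableau of shape `μ`, then its row sum
`∑ r` is at least `n(μ) = ∑ i μ_i`: in each column, the values of `r` are distinct. -/
theorem IsTableau.sum_add_le (h : IsTableau μ r' c')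
    (hr : ∀ x y, r x = r y → c' x = c' y → x = y) :
    ∑ x, r' x + ∑ j ∈ Finset.univ.image c',
      (((Finset.univ.filter fun x => c' x = j).image r) \ Finset.range (μ.colLen j)).card ≤
      ∑ x, r x := by
  have hf : ∀ f : α → ℕ, ∑ x, f x =
      ∑ j ∈ Finset.univ.image c', ∑ x ∈ Finset.univ.filter fun x => c' x = j, f x := fun f =>
    (Finset.sum_fiberwise_of_maps_to (fun x _ => Finset.mem_image_of_mem _ (Finset.mem_univ x))
      f).symm
  rw [hf r, hf r', ← Finset.sum_add_distrib]
  refine Finset.sum_le_sum fun j _ => ?_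
  have hinj' : Set.InjOn r' (Finset.univ.filter fun x => c' x = j : Finset α) := by
    intro x hx y hy hxy
    simp only [Finset.coe_filter, Finset.mem_univ, true_and, Set.mem_ofPred_eq] at hx hy
    exact h.inj _ _ hxy (hx.trans hy.symm)
  have hinj : Set.InjOn r (Finset.univ.filter fun x => c' x = j : Finset α) := by
    intro x hx y hy hxy
    simp only [Finset.coe_filter, Finset.mem_univ, true_and, Set.mem_ofPred_eq] at hx hy
    exact hr _ _ hxy (hx.trans hy.symm)
  have hcard : ((Finset.univ.filter fun x => c' x = j).image r).card = μ.colLen j := by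
    rw [Finset.card_image_of_injOn hinj, ← Finset.card_image_of_injOn hinj', h.image_col,
      Finset.card_range]
  have key := sum_range_card_add_le ((Finset.univ.filter fun x => c' x = j).image r)
  rw [hcard, Finset.sum_image hinj, ← h.image_col j, Finset.sum_image hinj'] at key
  rw [← h.image_col j]
  exact key

/-- In the extremal case, each column is filled with an initial segment, so that the rows of `r`
and the columns of `c'` form another tableau of shape `μ`. -/
theorem IsTableau.of_sum_le (h : IsTableau μ r' c')
    (hr : ∀ x y, r x = r y → c' x = c' y → x = y) (hs : ∑ x, r x ≤ ∑ x, r' x) :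
    IsTableau μ r c' := by
  have hz : ∑ j ∈ Finset.univ.image c', (((Finset.univ.filter fun x => c' x = j).image r) \
      Finset.range (μ.colLen j)).card = 0 := by
    have := h.sum_add_le hr
    omega
  have hmem : ∀ x, (r x, c' x) ∈ μ := by
    intro x
    have h0 := (Finset.sum_eq_zero_iff.1 hz) (c' x)
      (Finset.mem_image_of_mem _ (Finset.mem_univ x))
    rw [Finset.card_eq_zero, Finset.sdiff_eq_empty_iff_subset] at h0
    rw [YoungDiagram.mem_iff_lt_colLen]
    exact Finset.mem_range.1 (h0 (Finset.mem_image_of_mem _ (by simp)))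
  have himg : Finset.univ.image (fun x => (r x, c' x)) = μ.cells := by
    refine Finset.eq_of_subset_of_card_le ?_ ?_
    · intro p hp
      obtain ⟨x, -, rfl⟩ := Finset.mem_image.1 hp
      exact (YoungDiagram.mem_cells _).2 (hmem x)
    · rw [Finset.card_image_of_injective _ fun x y hxy =>
        hr x y (congrArg Prod.fst hxy) (congrArg Prod.snd hxy), h.card_eq]
      rfl
  refine ⟨hr, fun i j => ?_⟩
  rw [← YoungDiagram.mem_cells, ← himg]
  simp

end Tableaux

/-! ### Young symmetrizers in the group algebra of a symmetric group -/

section GroupAlgebra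

open MonoidAlgebra

variable {k : Type*} [Field k] {α : Type*} [Fintype α] [DecidableEq α]

/-- The permutations that preserve a labelling. -/
def labelStab (r : α → ℕ) : Finset (Equiv.Perm α) := Finset.univ.filter fun p => ∀ x, r (p x) = r x

theorem mem_labelStab {r : α → ℕ} {p : Equiv.Perm α} : p ∈ labelStab r ↔ ∀ x, r (p x) = r x := by
  simp [labelStab]

theorem mul_mem_labelStab {r : α → ℕ} {p q : Equiv.Perm α} (hp : p ∈ labelStab r)
    (hq : q ∈ labelStab r) : p * q ∈ labelStab r := by
  rw [mem_labelStab] at *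
  exact fun x => (hp _).trans (hq x)

theorem inv_mem_labelStab {r : α → ℕ} {p : Equiv.Perm α} (hp : p ∈ labelStab r) :
    p⁻¹ ∈ labelStab r := by
  rw [mem_labelStab] at *
  intro x
  rw [← hp]
  exact congrArg r (p.apply_symm_apply x)

theorem one_mem_labelStab (r : α → ℕ) : 1 ∈ labelStab r := mem_labelStab.2 fun _ => rfl

theorem swap_mem_labelStab {r : α → ℕ} {x y : α} (h : r x = r y) :
    Equiv.swap x y ∈ labelStab r := by
  refine mem_labelStab.2 fun z => ?_
  by_cases hx : z = x
  · subst hx; simp [h]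
  · by_cases hy : z = y
    · subst hy; simp [h]
    · rw [Equiv.swap_apply_of_ne_of_ne hx hy]

/-- The sum over `f p` is invariant under left translation by the stabilizer of a labelling. -/
theorem sum_labelStab_mul_left {A : Type*} [AddCommMonoid A] {r : α → ℕ} {p : Equiv.Perm α}
    (hp : p ∈ labelStab r) (f : Equiv.Perm α → A) :
    ∑ q ∈ labelStab r, f (p * q) = ∑ q ∈ labelStab r, f q :=
  Finset.sum_bij (fun q _ => p * q) (fun _ hq => mul_mem_labelStab hp hq)
    (fun _ _ _ _ h => mul_left_cancel h)
    (fun q hq => ⟨p⁻¹ * q, mul_mem_labelStab (inv_mem_labelStab hp) hq, mul_inv_cancel_left _ _⟩)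
    (fun _ _ => rfl)

theorem sum_labelStab_mul_right {A : Type*} [AddCommMonoid A] {r : α → ℕ} {p : Equiv.Perm α}
    (hp : p ∈ labelStab r) (f : Equiv.Perm α → A) :
    ∑ q ∈ labelStab r, f (q * p) = ∑ q ∈ labelStab r, f q :=
  Finset.sum_bij (fun q _ => q * p) (fun _ hq => mul_mem_labelStab hq hp)
    (fun _ _ _ _ h => mul_right_cancel h)
    (fun q hq => ⟨q * p⁻¹, mul_mem_labelStab hq (inv_mem_labelStab hp), inv_mul_cancel_right _ _⟩)
    (fun _ _ => rfl)

variable (k) in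
/-- The sign of a permutation as an element of the field. -/
def sgn (q : Equiv.Perm α) : k := ((Equiv.Perm.sign q : ℤ) : k)

theorem sgn_mul (p q : Equiv.Perm α) : sgn k (p * q) = sgn k p * sgn k q := by simp [sgn]

theorem sgn_mul_self (q : Equiv.Perm α) : sgn k q * sgn k q = 1 := by
  rw [← sgn_mul, sgn, Equiv.Perm.sign_mul, Int.units_mul_self, Units.val_one, Int.cast_one]

variable (k) in
/-- The Young symmetrizer of a filling with rows `r` and columns `c`. -/
def youngElt (r c : α → ℕ) : MonoidAlgebra k (Equiv.Perm α) :=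
  ∑ p ∈ labelStab r, ∑ q ∈ labelStab c, single (p * q) (sgn k q)

/-- The elements of the group algebra on which the row group acts trivially from the left and the
column group by the sign from the right. -/
structure IsYoungInvariant (r c : α → ℕ) (y : MonoidAlgebra k (Equiv.Perm α)) : Prop where
  left : ∀ p ∈ labelStab r, single p 1 * y = y
  right : ∀ q ∈ labelStab c, y * single q 1 = sgn k q • y

variable {r c r' c' : α → ℕ} {y : MonoidAlgebra k (Equiv.Perm α)}

theorem single_mul_youngElt {p : Equiv.Perm α} (hp : p ∈ labelStab r) :
    single p 1 * youngElt k r c = youngElt k r c := by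
  simp only [youngElt, Finset.mul_sum, single_mul_single, one_mul, ← mul_assoc]
  exact sum_labelStab_mul_left hp (fun p => ∑ q ∈ labelStab c, single (p * q) (sgn k q))

theorem youngElt_mul_single {q : Equiv.Perm α} (hq : q ∈ labelStab c) :
    youngElt k r c * single q 1 = sgn k q • youngElt k r c := by
  simp only [youngElt, Finset.sum_mul, single_mul_single, mul_one, mul_assoc, Finset.smul_sum,
    smul_single, smul_eq_mul]
  refine Finset.sum_congr rfl fun p _ => ?_
  rw [← sum_labelStab_mul_right hq fun t => single (p * t) (sgn k q * sgn k t)]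
  refine Finset.sum_congr rfl fun t _ => ?_
  rw [sgn_mul, mul_left_comm, sgn_mul_self, mul_one]

theorem isYoungInvariant_mul_mul (x : MonoidAlgebra k (Equiv.Perm α)) :
    IsYoungInvariant r c' (youngElt k r c * x * youngElt k r' c') where
  left p hp := by rw [← mul_assoc, ← mul_assoc, single_mul_youngElt hp]
  right q hq := by rw [mul_assoc, youngElt_mul_single hq, mul_smul_comm]

theorem IsYoungInvariant.coeff_left (h : IsYoungInvariant r c y) {p : Equiv.Perm α}
    (hp : p ∈ labelStab r) (σ : Equiv.Perm α) : y.coeff (p * σ) = y.coeff σ := by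
  conv_lhs => rw [← h.left p hp]
  rw [coeff_single_mul_apply, one_mul, inv_mul_cancel_left]

theorem IsYoungInvariant.coeff_right (h : IsYoungInvariant r c y) {q : Equiv.Perm α}
    (hq : q ∈ labelStab c) (σ : Equiv.Perm α) : y.coeff (σ * q) = sgn k q * y.coeff σ := by
  have h1 : (y * single q 1).coeff (σ * q) = sgn k q * y.coeff (σ * q) := by
    rw [h.right q hq, coeff_smul_apply, smul_eq_mul]
  rw [coeff_mul_single_apply, mul_one, mul_inv_cancel_right] at h1
  rw [h1, ← mul_assoc, sgn_mul_self, one_mul]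

/-- A coefficient of a Young invariant element vanishes at `σ` if a transposition of the row group
is carried to one of the column group by `σ`. -/
theorem IsYoungInvariant.transversal [CharZero k] (h : IsYoungInvariant r c y) {σ : Equiv.Perm α}
    (hσ : y.coeff σ ≠ 0) (x z : α) (h1 : r x = r z) (h2 : c (σ⁻¹ x) = c (σ⁻¹ z)) : x = z := by
  by_contra hne
  have e : σ * Equiv.swap (σ⁻¹ x) (σ⁻¹ z) = Equiv.swap x z * σ := by
    have := Equiv.swap_apply_apply σ (σ⁻¹ x) (σ⁻¹ z)
    rw [show σ (σ⁻¹ x) = x from σ.apply_symm_apply x,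
      show σ (σ⁻¹ z) = z from σ.apply_symm_apply z] at this
    rw [this, inv_mul_cancel_right]
  have h3 := h.coeff_left (swap_mem_labelStab h1) σ
  rw [← e, h.coeff_right (swap_mem_labelStab h2)] at h3
  have h4 : sgn k (Equiv.swap (σ⁻¹ x) (σ⁻¹ z)) = -1 := by
    rw [sgn, Equiv.Perm.sign_swap (fun hh => hne (σ⁻¹.injective hh))]
    simp
  rw [h4, neg_one_mul] at h3
  exact hσ (self_eq_neg.1 h3.symm)

theorem coeff_youngElt_one (h : ∀ x y, r x = r y → c x = c y → x = y) :
    (youngElt k r c).coeff 1 = 1 := by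
  classical
  simp only [youngElt, coeff_sum, Finsupp.finsetSum_apply, coeff_single, Finsupp.single_apply]
  rw [Finset.sum_eq_single 1, Finset.sum_eq_single 1]
  · simp [sgn]
  · intro q _ hq
    rw [one_mul, if_neg hq]
  · exact fun hh => absurd (one_mem_labelStab c) hh
  · intro p hp hp1
    refine Finset.sum_eq_zero fun q hq => if_neg fun hpq => hp1 ?_
    have hq' : q = p⁻¹ := eq_inv_of_mul_eq_one_right hpq
    have hpc : p ∈ labelStab c := by
      rw [← inv_inv p]
      exact inv_mem_labelStab (hq' ▸ hq)
    rw [mem_labelStab] at hp hpc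
    ext x
    exact h _ _ (hp x) (hpc x)
  · exact fun hh => absurd (one_mem_labelStab r) hh

/-- The Young invariant elements are the multiples of the Young symmetrizer. -/
theorem IsYoungInvariant.eq_smul [CharZero k] {μ : YoungDiagram} (ht : IsTableau μ r c)
    (h : IsYoungInvariant r c y) : y = y.coeff 1 • youngElt k r c := by
  have key : ∀ {w : MonoidAlgebra k (Equiv.Perm α)}, IsYoungInvariant r c w → w.coeff 1 = 0 →
      w = 0 := by
    intro w hw h1
    refine MonoidAlgebra.ext (Finsupp.ext fun σ => ?_)
    by_contra hσ
    have htr := hw.transversal hσ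
    have ht' : IsTableau μ (r ∘ (σ⁻¹ : Equiv.Perm α)) (c ∘ (σ⁻¹ : Equiv.Perm α)) :=
      ht.comp (σ⁻¹ : Equiv.Perm α)
    have hrc := ht'.of_sum_le (r := r) htr (le_of_eq (Equiv.sum_comp (σ⁻¹ : Equiv.Perm α) r).symm)
    have hp : ∀ x, ∃ z, r z = r x ∧ c z = c (σ⁻¹ x) := fun x =>
      (ht.mem_iff _ _).1 ((hrc.mem_iff _ _).2 ⟨x, rfl, rfl⟩)
    choose p hp1 hp2 using hp
    have pinj : Function.Injective p := fun x z hxz =>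
      htr x z (by rw [← hp1 x, ← hp1 z, hxz]) (by rw [← hp2 x, ← hp2 z, hxz])
    let P : Equiv.Perm α := Equiv.ofBijective p (Finite.injective_iff_bijective.1 pinj)
    have hP : P ∈ labelStab r := mem_labelStab.2 hp1
    have hQ : P * σ ∈ labelStab c := mem_labelStab.2 fun x => by
      change c (p (σ x)) = c x
      rw [hp2]
      exact congrArg c (σ.symm_apply_apply x)
    have h2 := hw.coeff_left hP σ
    rw [← one_mul (P * σ), hw.coeff_right hQ, h1, mul_zero] at h2
    exact hσ h2.symm
  rw [← sub_eq_zero]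
  refine key ⟨fun p hp => ?_, fun q hq => ?_⟩ ?_
  · rw [mul_sub, h.left p hp, mul_smul_comm, single_mul_youngElt hp]
  · rw [sub_mul, h.right q hq, smul_mul_assoc, youngElt_mul_single hq, smul_sub, smul_comm]
  · rw [coeff_sub, Finsupp.sub_apply, coeff_smul_apply, coeff_youngElt_one ht.inj, smul_eq_mul,
      mul_one, sub_self]

/-- The coefficient at `1` is a multiple of the trace of the regular representation, so it vanishes
on nilpotent elements. -/
theorem coeff_one_eq_zero_of_mul_self [CharZero k] (h : y * y = 0) : y.coeff 1 = 0 := by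
  let b : Module.Basis (Equiv.Perm α) k (MonoidAlgebra k (Equiv.Perm α)) :=
    .ofRepr (MonoidAlgebra.coeffLinearEquiv k)
  have hb : ∀ σ, b σ = single σ 1 := fun σ => rfl
  have htr : LinearMap.trace k _ (LinearMap.mulLeft k y) =
      Fintype.card (Equiv.Perm α) * y.coeff 1 := by
    rw [LinearMap.trace_eq_matrix_trace k b, Matrix.trace]
    have : ∀ σ, Matrix.diag (LinearMap.toMatrix b b (LinearMap.mulLeft k y)) σ = y.coeff 1 := by
      intro σ
      rw [Matrix.diag_apply, LinearMap.toMatrix_apply, hb, LinearMap.mulLeft_apply]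
      change (y * single σ 1).coeff σ = _
      rw [coeff_mul_single_apply, mul_one, mul_inv_cancel]
    rw [Finset.sum_congr rfl fun σ _ => this σ, Finset.sum_const, Finset.card_univ, nsmul_eq_mul]
  have hnil : IsNilpotent (LinearMap.mulLeft k y) := ⟨2, by
    rw [pow_two]
    refine LinearMap.ext fun z => ?_
    rw [Module.End.mul_apply, LinearMap.mulLeft_apply, LinearMap.mulLeft_apply, ← mul_assoc, h,
      zero_mul, LinearMap.zero_apply]⟩
  rw [(LinearMap.isNilpotent_trace_of_isNilpotent hnil).eq_zero] at htr
  have hc : (Fintype.card (Equiv.Perm α) : k) ≠ 0 := Nat.cast_ne_zero.2 Fintype.card_ne_zero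
  exact (mul_eq_zero.1 htr.symm).resolve_left hc

/-- The group algebra is semiprime. -/
theorem eq_zero_of_forall_mul_mul_self [CharZero k]
    (h : ∀ x : MonoidAlgebra k (Equiv.Perm α), y * x * y = 0) : y = 0 := by
  refine MonoidAlgebra.ext (Finsupp.ext fun σ => ?_)
  have h1 := coeff_one_eq_zero_of_mul_self (y := y * single σ⁻¹ 1) (by
    rw [← mul_assoc, h, zero_mul])
  rw [coeff_mul_single_apply, mul_one, inv_inv, one_mul] at h1
  exact h1

theorem youngElt_mul_mul [CharZero k] {μ : YoungDiagram} (ht : IsTableau μ r c)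
    (x : MonoidAlgebra k (Equiv.Perm α)) :
    ∃ s : k, youngElt k r c * x * youngElt k r c = s • youngElt k r c :=
  ⟨_, (isYoungInvariant_mul_mul x).eq_smul ht⟩

theorem youngElt_mul_self [CharZero k] {μ : YoungDiagram} (ht : IsTableau μ r c) :
    ∃ s : k, s ≠ 0 ∧ youngElt k r c * youngElt k r c = s • youngElt k r c := by
  obtain ⟨s, hs⟩ := youngElt_mul_mul (k := k) ht 1
  rw [mul_one] at hs
  refine ⟨s, ?_, hs⟩
  rintro rfl
  rw [zero_smul] at hs
  have := coeff_one_eq_zero_of_mul_self hs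
  rw [coeff_youngElt_one ht.inj] at this
  exact one_ne_zero this

theorem youngElt_mul_mul_of_ne [CharZero k] {μ ν : YoungDiagram} (h : IsTableau μ r c)
    (h' : IsTableau ν r' c') (hne : μ ≠ ν) (x : MonoidAlgebra k (Equiv.Perm α)) :
    youngElt k r c * x * youngElt k r' c' = 0 := by
  have key : ∀ {μ ν : YoungDiagram} {r c r' c' : α → ℕ}, IsTableau μ r c → IsTableau ν r' c' →
      μ ≠ ν → ∑ x, r x ≤ ∑ x, r' x → ∀ x : MonoidAlgebra k (Equiv.Perm α),
      youngElt k r c * x * youngElt k r' c' = 0 := by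
    intro μ ν r c r' c' h h' hne hs x
    refine MonoidAlgebra.ext (Finsupp.ext fun σ => ?_)
    by_contra hσ
    have htr := (isYoungInvariant_mul_mul x).transversal hσ
    have hs' : ∑ x, r x ≤ ∑ x, (r' ∘ (σ⁻¹ : Equiv.Perm α)) x :=
      hs.trans (le_of_eq (Equiv.sum_comp (σ⁻¹ : Equiv.Perm α) r').symm)
    exact hne (h.eq_of_row ((h'.comp (σ⁻¹ : Equiv.Perm α)).of_sum_le (r := r) htr hs'))
  rcases le_total (∑ x, r x) (∑ x, r' x) with hs | hs
  · exact key h h' hne hs x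
  · refine eq_zero_of_forall_mul_mul_self fun z => ?_
    have := key h' h hne.symm hs z
    calc _ = youngElt k r c * x * (youngElt k r' c' * z * youngElt k r c) * x *
          youngElt k r' c' := by simp only [mul_assoc]
      _ = 0 := by rw [this, mul_zero, zero_mul, zero_mul]

end GroupAlgebra

/-! ### The Young symmetrizers generate the group algebra -/

section Partitions

theorem card_cells_eq_sum_rowLens (μ : YoungDiagram) : μ.cells.card = μ.rowLens.sum := by
  rw [Finset.card_eq_sum_card_fiberwise (f := Prod.fst) (t := Finset.range (μ.colLen 0))]
  · rw [YoungDiagram.rowLens, ← List.sum_toFinset _ List.nodup_range, List.toFinset_range]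
    refine Finset.sum_congr rfl fun i _ => ?_
    rw [YoungDiagram.rowLen_eq_card]
    rfl
  · rintro ⟨i, j⟩ h
    have h' : (i, j) ∈ μ := (YoungDiagram.mem_cells _).1 h
    exact Finset.mem_coe.2 (Finset.mem_range.2 (YoungDiagram.mem_iff_lt_colLen.1
      (μ.up_left_mem le_rfl (Nat.zero_le _) h')))

/-- The Young diagram of a partition of `d`. -/
def diagramOfPartition {d : ℕ} (P : d.Partition) : YoungDiagram :=
  YoungDiagram.ofRowLens (P.parts.sort (· ≥ ·)) (Multiset.pairwise_sort _ _).sortedGE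

theorem rowLens_diagramOfPartition {d : ℕ} (P : d.Partition) :
    (diagramOfPartition P).rowLens = P.parts.sort (· ≥ ·) :=
  YoungDiagram.rowLens_ofRowLens_eq_self fun _ hx => P.parts_pos ((Multiset.mem_sort _).1 hx)

theorem card_diagramOfPartition {d : ℕ} (P : d.Partition) :
    (diagramOfPartition P).cells.card = d := by
  rw [card_cells_eq_sum_rowLens, rowLens_diagramOfPartition, ← Multiset.sum_coe,
    Multiset.sort_eq, P.parts_sum]

theorem diagramOfPartition_injective {d : ℕ} :
    Function.Injective (diagramOfPartition : d.Partition → YoungDiagram) := by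
  intro P Q h
  have h1 := congrArg (fun μ : YoungDiagram => (μ.rowLens : Multiset ℕ)) h
  simp only [rowLens_diagramOfPartition, Multiset.sort_eq] at h1
  exact Nat.Partition.ext h1

end Partitions

section Spanning

open MonoidAlgebra

variable (k : Type*) [Field k] (α : Type*) [Fintype α] [DecidableEq α]

/-- The class functions, that is, the centre of the group algebra. -/
def classFunctions : Submodule k (MonoidAlgebra k (Equiv.Perm α)) where
  carrier := {y | ∀ σ, single σ 1 * y = y * single σ 1}
  zero_mem' _ := by rw [mul_zero, zero_mul]
  add_mem' ha hb σ := by rw [mul_add, add_mul, ha σ, hb σ]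
  smul_mem' a y hy σ := by rw [mul_smul_comm, smul_mul_assoc, hy σ]

variable {k α}

theorem mul_comm_of_mem_classFunctions {y : MonoidAlgebra k (Equiv.Perm α)}
    (hy : y ∈ classFunctions k α) (x : MonoidAlgebra k (Equiv.Perm α)) : x * y = y * x := by
  induction x using MonoidAlgebra.induction_linear with
  | zero => rw [mul_zero, zero_mul]
  | add a b ha hb => rw [add_mul, mul_add, ha, hb]
  | single σ a =>
    have : single σ a = a • (single σ 1 : MonoidAlgebra k (Equiv.Perm α)) := by
      rw [smul_single, smul_eq_mul, mul_one]
    rw [this, smul_mul_assoc, mul_smul_comm, hy σ]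

variable (k α) in
/-- The values of a class function on permutations of given cycle types. -/
def classValues : classFunctions k α →ₗ[k] ((Fintype.card α).Partition → k) where
  toFun y P := if h : ∃ σ : Equiv.Perm α, σ.partition = P then y.1.coeff h.choose else 0
  map_add' x y := by
    ext P
    simp only [Pi.add_apply]
    split_ifs
    · rfl
    · rw [add_zero]
  map_smul' a x := by
    ext P
    simp only [Pi.smul_apply, RingHom.id_apply]
    split_ifs
    · rfl
    · rw [smul_zero]

theorem classValues_injective : Function.Injective (classValues k α) := by
  rw [← LinearMap.ker_eq_bot, LinearMap.ker_eq_bot']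
  rintro ⟨y, hy⟩ h0
  ext1
  refine MonoidAlgebra.ext (Finsupp.ext fun σ => ?_)
  have h1 := congrFun h0 σ.partition
  have hex : ∃ τ : Equiv.Perm α, τ.partition = σ.partition := ⟨σ, rfl⟩
  change (if h : ∃ τ : Equiv.Perm α, τ.partition = σ.partition then y.coeff h.choose else 0) = 0
    at h1
  rw [dif_pos hex] at h1
  obtain ⟨π, hπ⟩ := isConj_iff.1 (Equiv.Perm.partition_eq_of_isConj.2 hex.choose_spec)
  have h2 : (single π 1 * y).coeff (π * hex.choose) = (y * single π 1).coeff (π * hex.choose) := by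
    rw [hy π]
  rw [coeff_single_mul_apply, coeff_mul_single_apply, one_mul, mul_one, inv_mul_cancel_left, hπ,
    h1] at h2
  exact h2.symm

/-- The sum of the conjugates of an element of the group algebra. -/
def conjSum (c : MonoidAlgebra k (Equiv.Perm α)) : MonoidAlgebra k (Equiv.Perm α) :=
  ∑ σ : Equiv.Perm α, single σ 1 * c * single σ⁻¹ 1

theorem conjSum_mem (c : MonoidAlgebra k (Equiv.Perm α)) : conjSum c ∈ classFunctions k α := by
  intro τ
  rw [conjSum, Finset.mul_sum, Finset.sum_mul]
  conv_rhs => rw [← Equiv.sum_comp (Equiv.mulLeft τ)]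
  refine Finset.sum_congr rfl fun σ _ => ?_
  rw [Equiv.coe_mulLeft, mul_assoc _ (single (τ * σ)⁻¹ 1), single_mul_single, mul_inv_rev,
    inv_mul_cancel_right, one_mul, ← mul_assoc, ← mul_assoc, single_mul_single, one_mul]

theorem coeff_conjSum_one (c : MonoidAlgebra k (Equiv.Perm α)) :
    (conjSum c).coeff 1 = Fintype.card (Equiv.Perm α) * c.coeff 1 := by
  rw [conjSum, coeff_sum, Finsupp.finsetSum_apply, Finset.sum_congr rfl fun σ _ => ?_,
    Finset.sum_const, Finset.card_univ, nsmul_eq_mul]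
  rw [coeff_mul_single_apply, coeff_single_mul_apply, mul_one, one_mul, one_mul, inv_inv,
    inv_mul_cancel]

variable (k) in
/-- The elements `x c y` where `c` is a Young symmetrizer. -/
def youngIdealGenerators (α : Type*) [Fintype α] [DecidableEq α] :
    Set (MonoidAlgebra k (Equiv.Perm α)) :=
  {z | ∃ μ r c x y, IsTableau μ r c ∧ z = x * youngElt k r c * y}

/-- The Young symmetrizers generate the unit ideal of the group algebra: the sums of their
conjugates are as many independent class functions as there are conjugacy classes. -/
theorem one_mem_span_youngElt [CharZero k] :
    (1 : MonoidAlgebra k (Equiv.Perm α)) ∈ Submodule.span k (youngIdealGenerators k α) := by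
  have hex : ∀ P : (Fintype.card α).Partition, ∃ r c : α → ℕ,
      IsTableau (diagramOfPartition P) r c := fun P => by
    have hc : Fintype.card α = Fintype.card (diagramOfPartition P).cells := by
      rw [Fintype.card_coe, card_diagramOfPartition]
    exact ⟨_, _, (isTableau_cells _).comp (Fintype.equivOfCardEq hc)⟩
  choose r c ht using hex
  let z : (Fintype.card α).Partition → classFunctions k α := fun P =>
    ⟨conjSum (youngElt k (r P) (c P)), conjSum_mem _⟩
  have hzz : ∀ P Q, P ≠ Q → (z P).1 * (z Q).1 = 0 := by
    intro P Q hPQ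
    simp only [z, conjSum]
    rw [Finset.sum_mul_sum]
    refine Finset.sum_eq_zero fun σ _ => Finset.sum_eq_zero fun τ _ => ?_
    have := youngElt_mul_mul_of_ne (k := k) (ht P) (ht Q)
      (fun h => hPQ (diagramOfPartition_injective h)) (single σ⁻¹ 1 * single τ 1)
    calc _ = single σ 1 * (youngElt k (r P) (c P) * (single σ⁻¹ 1 * single τ 1) *
          youngElt k (r Q) (c Q)) * single τ⁻¹ 1 := by simp only [mul_assoc]
      _ = 0 := by rw [this, mul_zero, zero_mul]
  have hz0 : ∀ P, (z P).1 * (z P).1 ≠ 0 := by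
    intro P h0
    have h1 := eq_zero_of_forall_mul_mul_self (y := (z P).1) fun x => by
      rw [mul_assoc, mul_comm_of_mem_classFunctions (z P).2, ← mul_assoc, h0, zero_mul]
    have h2 : ((z P).1).coeff 1 = 0 := by rw [h1]; rfl
    simp only [z] at h2
    rw [coeff_conjSum_one, coeff_youngElt_one (ht P).inj, mul_one] at h2
    exact Nat.cast_ne_zero.2 Fintype.card_ne_zero h2
  have hli : LinearIndependent k z := by
    rw [Fintype.linearIndependent_iff]
    intro g hg P
    have h1 : (∑ Q, g Q • (z Q).1) * (z P).1 = 0 := by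
      have := congrArg Subtype.val hg
      rw [Submodule.coe_sum] at this
      simp only [Submodule.coe_smul, ZeroMemClass.coe_zero] at this
      rw [this, zero_mul]
    rw [Finset.sum_mul, Finset.sum_eq_single P, smul_mul_assoc] at h1
    · exact (smul_eq_zero.1 h1).resolve_right (hz0 P)
    · intro Q _ hQ
      rw [smul_mul_assoc, hzz Q P hQ, smul_zero]
    · exact fun h => absurd (Finset.mem_univ P) h
  have hfin : Module.Finite k (classFunctions k α) :=
    Module.Finite.of_injective _ classValues_injective
  have hle : Module.finrank k (classFunctions k α) ≤ Fintype.card (Fintype.card α).Partition := by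
    have := LinearMap.finrank_le_finrank_of_injective (classValues_injective (k := k) (α := α))
    rwa [Module.finrank_fintype_fun_eq_card] at this
  have hspan := hli.span_eq_top_of_card_eq_finrank' (le_antisymm hli.fintype_card_le_finrank hle)
  have h1 : (⟨1, fun σ => by rw [mul_one, one_mul]⟩ : classFunctions k α) ∈
      Submodule.span k (Set.range z) := hspan ▸ Submodule.mem_top
  have h2 := Submodule.mem_map_of_mem (f := (classFunctions k α).subtype) h1
  rw [Submodule.map_span] at h2
  refine Submodule.span_le.2 ?_ h2
  rintro _ ⟨_, ⟨P, rfl⟩, rfl⟩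
  exact Submodule.sum_mem _ fun σ _ => Submodule.subset_span ⟨_, _, _, _, _, ht P, rfl⟩

end Spanning

/-! ### Shears and dilations in the infinite general linear group -/

section Elements

variable {k : Type*} [Field k]

/-- An endomorphism `D` of `V` with finitely many non-zero entries and `D² = 0`; these are the
`D` for which all `1 + s D` belong to `GL`. -/
structure IsShear (D : Std k →ₗ[k] Std k) : Prop where
  sq : ∀ v, D (D v) = 0
  fin : ∃ n : ℕ, (∀ i, n ≤ i → D (Finsupp.single i 1) = 0) ∧ ∀ v j, n ≤ j → D v j = 0

/-- The element `1 + s D` of `GL`. -/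
def shear (D : Std k →ₗ[k] Std k) (hD : IsShear D) (s : k) : GLInf k :=
  ⟨LinearEquiv.ofLinearMap (LinearMap.id + s • D) (LinearMap.id - s • D)
      (LinearMap.ext fun v => by
        change (v - s • D v) + s • D (v - s • D v) = v
        rw [map_sub, map_smul, hD.sq, smul_zero, sub_zero, sub_add_cancel])
      (LinearMap.ext fun v => by
        change (v + s • D v) - s • D (v + s • D v) = v
        rw [map_add, map_smul, hD.sq, smul_zero, add_zero, add_sub_cancel_right]), by
    obtain ⟨n, h1, h2⟩ := hD.fin
    refine ⟨n, fun i hi => ?_, fun v j hj => ?_⟩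
    · change Finsupp.single i 1 + s • D (Finsupp.single i 1) = _
      rw [h1 i hi, smul_zero, add_zero]
    · change (v + s • D v) j = v j
      rw [Finsupp.add_apply, Finsupp.smul_apply, h2 v j hj, smul_zero, add_zero]⟩

theorem stdRep_shear (D : Std k →ₗ[k] Std k) (hD : IsShear D) (s : k) (v : Std k) :
    stdRep k (shear D hD s) v = v + s • D v := rfl

theorem shear_zero (D : Std k →ₗ[k] Std k) (hD : IsShear D) : shear D hD 0 = 1 := by
  ext1; ext1 v
  change v + (0 : k) • D v = v
  rw [zero_smul, add_zero]

/-- A map that kills `e_i` for `i ≥ n` and takes values in the span of the `e_j` with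
`n ≤ j < m`. -/
theorem isShear_of_bounds {D : Std k →ₗ[k] Std k} {n m : ℕ}
    (h1 : ∀ i, n ≤ i → D (Finsupp.single i 1) = 0) (h2 : ∀ v j, j < n → D v j = 0)
    (h3 : ∀ v j, m ≤ j → D v j = 0) : IsShear D := by
  refine ⟨fun v => ?_, max n m, fun i hi => h1 i (le_trans (le_max_left _ _) hi),
    fun v j hj => h3 v j (le_trans (le_max_right _ _) hj)⟩
  conv_lhs => rw [← (D v).sum_single, Finsupp.sum, map_sum]
  refine Finset.sum_eq_zero fun j hj => ?_
  rw [← mul_one ((D v) j), ← smul_eq_mul, ← Finsupp.smul_single, map_smul]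
  by_cases hjn : j < n
  · rw [h2 v j hjn, zero_smul]
  · rw [h1 j (not_lt.1 hjn), smul_zero]

/-- The matrix unit that sends `e_m` to `e_l`. -/
def matrixUnit (l m : ℕ) : Std k →ₗ[k] Std k :=
  (Finsupp.lsingle l).comp (Finsupp.lapply m)

theorem matrixUnit_single (l m i : ℕ) : matrixUnit (k := k) l m (Finsupp.single i 1) =
    if i = m then Finsupp.single l 1 else 0 := by
  change Finsupp.single l (Finsupp.single i (1 : k) m) = _
  rw [Finsupp.single_apply]
  split_ifs
  · rfl
  · rw [Finsupp.single_zero]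

theorem isShear_matrixUnit {l m : ℕ} (h : l ≠ m) : IsShear (matrixUnit (k := k) l m) := by
  refine ⟨fun v => ?_, max l m + 1, fun i hi => ?_, fun v j hj => ?_⟩
  · change Finsupp.single l ((Finsupp.single l (v m)) m) = 0
    rw [Finsupp.single_eq_of_ne h.symm, Finsupp.single_zero]
  · rw [matrixUnit_single, if_neg (by omega)]
  · change Finsupp.single l (v m) j = 0
    rw [Finsupp.single_eq_of_ne (by omega)]

theorem matrixUnit_comp_self (l : ℕ) (v : Std k) :
    matrixUnit l l (matrixUnit l l v) = matrixUnit l l v := by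
  change Finsupp.single l ((Finsupp.single l (v l)) l) = _
  rw [Finsupp.single_eq_same]
  rfl

theorem dilation_comp (l : ℕ) {s t : k} (h : s * t = 1) (v : Std k) :
    (v + (t - 1) • matrixUnit l l v) + (s - 1) • matrixUnit l l (v + (t - 1) • matrixUnit l l v) =
      v := by
  rw [map_add, map_smul, matrixUnit_comp_self, smul_add, smul_smul, add_assoc, ← add_smul,
    ← add_smul, show t - 1 + (s - 1 + (s - 1) * (t - 1)) = s * t - 1 by ring, h, sub_self,
    zero_smul, add_zero]

/-- The diagonal matrix that multiplies `e_l` by `t`. -/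
def dilation (l : ℕ) (t : k) (ht : t ≠ 0) : GLInf k :=
  ⟨LinearEquiv.ofLinearMap (LinearMap.id + (t - 1) • matrixUnit l l)
      (LinearMap.id + (t⁻¹ - 1) • matrixUnit l l)
      (LinearMap.ext fun v => by
        have := dilation_comp l (mul_inv_cancel₀ ht) v
        exact this)
      (LinearMap.ext fun v => by
        have := dilation_comp l (inv_mul_cancel₀ ht) v
        exact this), by
    refine ⟨l + 1, fun i hi => ?_, fun v j hj => ?_⟩
    · change Finsupp.single i (1 : k) + (t - 1) • matrixUnit l l (Finsupp.single i 1) = _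
      rw [matrixUnit_single, if_neg (by omega), smul_zero, add_zero]
    · change v j + (t - 1) • Finsupp.single l (v l) j = v j
      rw [Finsupp.single_eq_of_ne (by omega), smul_zero, add_zero]⟩

theorem stdRep_dilation (l : ℕ) (t : k) (ht : t ≠ 0) (i : ℕ) :
    stdRep k (dilation l t ht) (Finsupp.single i 1) =
      (if i = l then t else 1) • Finsupp.single i 1 := by
  change Finsupp.single i (1 : k) + (t - 1) • matrixUnit l l (Finsupp.single i 1) = _
  rw [matrixUnit_single]
  split_ifs with h
  · subst h
    rw [sub_smul, one_smul, add_sub_cancel]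
  · rw [smul_zero, add_zero, one_smul]

end Elements

/-! ### Tensor powers of the standard representation -/

section Tensors

variable {k : Type*} [Field k] {α : Type*}

variable (k) in
/-- The basis tensor `⊗ e_{p i}` of a tensor power of `V`. -/
def basisTensor (p : α → ℕ) : ⨂[k] _ : α, Std k :=
  PiTensorProduct.tprod k fun i => Finsupp.single (p i) 1

theorem tensorRep_tprod (g : GLInf k) (v : α → Std k) :
    tensorRep k α g (PiTensorProduct.tprod k v) = PiTensorProduct.tprod k fun i => stdRep k g (v i) :=
  PiTensorProduct.map_tprod _ _

variable [Fintype α] [DecidableEq α]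

open Classical in
variable (k α) in
/-- The basis of a tensor power of `V` that consists of the basis tensors. -/
def tensorBasis : Module.Basis (α → ℕ) k (⨂[k] _ : α, Std k) :=
  .ofRepr PiTensorProduct.ofFinsuppEquiv'

theorem tensorBasis_repr_tprod (v : α → Std k) (p : α → ℕ) :
    (tensorBasis k α).repr (PiTensorProduct.tprod k v) p = ∏ i, v i (p i) := by
  classical
  exact PiTensorProduct.ofFinsuppEquiv'_apply_apply v p

theorem tensorBasis_apply (p : α → ℕ) : tensorBasis k α p = basisTensor k p := by
  rw [Module.Basis.apply_eq_iff]
  ext q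
  rw [basisTensor, tensorBasis_repr_tprod, Finsupp.single_apply]
  split_ifs with h
  · subst h
    exact Finset.prod_eq_one fun i _ => Finsupp.single_eq_same
  · obtain ⟨i, hi⟩ := Function.ne_iff.1 h
    exact Finset.prod_eq_zero (Finset.mem_univ i) (Finsupp.single_eq_of_ne hi.symm)

theorem span_basisTensor : Submodule.span k (Set.range (basisTensor k : (α → ℕ) → _)) = ⊤ := by
  rw [← (tensorBasis k α).span_eq]
  congr 1
  exact congrArg Set.range (funext fun p => (tensorBasis_apply p).symm)

theorem tensor_ext {M : Type*} [AddCommMonoid M] [Module k M]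
    {f g : (⨂[k] _ : α, Std k) →ₗ[k] M} (h : ∀ p, f (basisTensor k p) = g (basisTensor k p)) :
    f = g :=
  (tensorBasis k α).ext fun p => by rw [tensorBasis_apply, h]

theorem exists_bound (p : α → ℕ) : ∃ N, ∀ i, p i < N :=
  ⟨Finset.univ.sup p + 1, fun i => Nat.lt_succ_of_le (Finset.le_sup (Finset.mem_univ i))⟩

/-- A letter that occurs only once in a basis tensor can be replaced by any other letter inside
the subrepresentation generated by it. -/
theorem basisTensor_update_mem (Q : Subrepresentation (tensorRep k α)) {p : α → ℕ} {i : α}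
    (hi : ∀ j, p j = p i → j = i) (hp : basisTensor k p ∈ Q.toSubmodule) (l : ℕ) :
    basisTensor k (Function.update p i l) ∈ Q.toSubmodule := by
  by_cases hl : l = p i
  · rwa [hl, Function.update_eq_self]
  have h1 := Q.apply_mem_toSubmodule (shear _ (isShear_matrixUnit (k := k) hl) 1) hp
  have h2 : tensorRep k α (shear _ (isShear_matrixUnit (k := k) hl) 1) (basisTensor k p) =
      basisTensor k p + basisTensor k (Function.update p i l) := by
    rw [basisTensor, tensorRep_tprod]
    have : (fun j => stdRep k (shear _ (isShear_matrixUnit (k := k) hl) 1)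
        (Finsupp.single (p j) 1)) = Function.update (fun j => Finsupp.single (p j) 1) i
          (Finsupp.single (p i) 1 + Finsupp.single l 1) := by
      ext1 j
      rw [stdRep_shear, matrixUnit_single, one_smul]
      by_cases hj : j = i
      · subst hj
        rw [if_pos rfl, Function.update_self]
      · rw [if_neg fun h => hj (hi j h), add_zero, Function.update_of_ne hj]
    rw [this, MultilinearMap.map_update_add, Function.update_eq_self, basisTensor]
    congr 2
    ext1 j
    by_cases hj : j = i
    · subst hj
      rw [Function.update_self, Function.update_self]
    · rw [Function.update_of_ne hj, Function.update_of_ne hj]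
  rw [h2] at h1
  have h3 := Q.toSubmodule.add_mem h1 (Q.toSubmodule.smul_mem (-1) hp)
  rwa [add_comm (basisTensor k p), add_assoc, ← one_smul k (basisTensor k p), smul_smul,
    ← add_smul, mul_one, add_neg_cancel, zero_smul, add_zero] at h3

/-- A multilinear basis tensor generates the tensor power. -/
theorem eq_top_of_basisTensor_mem (Q : Subrepresentation (tensorRep k α)) {ν : α → ℕ}
    (hν : Function.Injective ν) (h : basisTensor k ν ∈ Q.toSubmodule) : Q.toSubmodule = ⊤ := by
  rw [eq_top_iff, ← span_basisTensor, Submodule.span_le]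
  rintro _ ⟨p, rfl⟩
  obtain ⟨N₁, hN₁⟩ := exists_bound ν
  obtain ⟨N₂, hN₂⟩ := exists_bound p
  let ω : α → ℕ := fun i => max N₁ N₂ + Fintype.equivFin α i
  have hω : Function.Injective ω := fun i j hij =>
    (Fintype.equivFin α).injective (Fin.ext (Nat.add_left_cancel hij))
  have hω1 : ∀ i j, ω i ≠ ν j := fun i j => by
    have := hN₁ j
    have : N₁ ≤ max N₁ N₂ := le_max_left _ _
    simp only [ω]
    omega
  have hω2 : ∀ i j, ω i ≠ p j := fun i j => by
    have := hN₂ j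
    have : N₂ ≤ max N₁ N₂ := le_max_right _ _
    simp only [ω]
    omega
  -- The letters are first replaced by fresh ones, and these by the letters of `p`.
  have step1 : ∀ S : Finset α, basisTensor k (S.piecewise ω ν) ∈ Q.toSubmodule := by
    intro S
    induction S using Finset.induction_on with
    | empty => rwa [Finset.piecewise_empty]
    | insert i S hi ih =>
      rw [Finset.piecewise_insert]
      refine basisTensor_update_mem Q (fun j hj => ?_) ih _
      rw [Finset.piecewise_eq_of_notMem _ _ _ hi] at hj
      by_cases hjS : j ∈ S
      · rw [Finset.piecewise_eq_of_mem _ _ _ hjS] at hj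
        exact absurd hj (hω1 _ _)
      · rw [Finset.piecewise_eq_of_notMem _ _ _ hjS] at hj
        exact hν hj
  have step2 : ∀ S : Finset α, basisTensor k (S.piecewise p ω) ∈ Q.toSubmodule := by
    intro S
    induction S using Finset.induction_on with
    | empty =>
      have := step1 Finset.univ
      rw [Finset.piecewise_univ] at this
      rwa [Finset.piecewise_empty]
    | insert i S hi ih =>
      rw [Finset.piecewise_insert]
      refine basisTensor_update_mem Q (fun j hj => ?_) ih _
      rw [Finset.piecewise_eq_of_notMem _ _ _ hi] at hj
      by_cases hjS : j ∈ S
      · rw [Finset.piecewise_eq_of_mem _ _ _ hjS] at hj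
        exact absurd hj.symm (hω2 _ _)
      · rw [Finset.piecewise_eq_of_notMem _ _ _ hjS] at hj
        exact hω hj
  have := step2 Finset.univ
  rwa [Finset.piecewise_univ] at this

/-- Every non-zero tensor has a translate with a non-zero multilinear coefficient. -/
theorem exists_multilinear_coefficient {q : ⨂[k] _ : α, Std k} (hq : q ≠ 0) :
    ∃ (ν : α → ℕ) (g : GLInf k), Function.Injective ν ∧
      (tensorBasis k α).repr (tensorRep k α g q) ν ≠ 0 := by
  obtain ⟨p₀, hp₀⟩ : ∃ p, (tensorBasis k α).repr q p ≠ 0 := by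
    by_contra! h
    exact hq ((tensorBasis k α).repr.map_eq_zero_iff.1 (Finsupp.ext h))
  choose b hb using fun p : α → ℕ => exists_bound p
  let N : ℕ := ((tensorBasis k α).repr q).support.sup b
  have hN : ∀ p ∈ ((tensorBasis k α).repr q).support, ∀ i, p i < N := fun p hp i =>
    (hb p i).trans_le (Finset.le_sup hp)
  let e := Fintype.equivFin α
  let ν : α → ℕ := fun i => N + e i
  have hν : Function.Injective ν := fun i j hij => e.injective (Fin.ext (Nat.add_left_cancel hij))
  -- The row with index `ν i` of `1 + D` is the unit vector with index `p₀ i` up to column `N`.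
  let D : Std k →ₗ[k] Std k := ∑ i, matrixUnit (ν i) (p₀ i)
  have hp₀N : ∀ i, p₀ i < N := hN p₀ (Finsupp.mem_support_iff.2 hp₀)
  have hDs : ∀ m, D (Finsupp.single m 1) =
      ∑ i, if m = p₀ i then Finsupp.single (ν i) (1 : k) else 0 := fun m => by
    simp only [D, LinearMap.sum_apply, matrixUnit_single]
  have hDv : ∀ v j, D v j = ∑ i, Finsupp.single (ν i) (v (p₀ i)) j := fun v j => by
    simp only [D, LinearMap.sum_apply, Finsupp.finsetSum_apply]
    rfl
  have hD : IsShear D := by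
    refine isShear_of_bounds (n := N) (m := N + Fintype.card α) (fun m hm => ?_) (fun v j hj => ?_)
      (fun v j hj => ?_)
    · rw [hDs]
      exact Finset.sum_eq_zero fun i _ => if_neg (by have := hp₀N i; omega)
    · rw [hDv]
      exact Finset.sum_eq_zero fun i _ => Finsupp.single_eq_of_ne (by simp only [ν]; omega)
    · rw [hDv]
      exact Finset.sum_eq_zero fun i _ => Finsupp.single_eq_of_ne (by
        have := (e i).2
        simp only [ν]
        omega)
  refine ⟨ν, shear D hD 1, hν, ?_⟩
  have key : (tensorBasis k α).repr (tensorRep k α (shear D hD 1) q) ν =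
      (tensorBasis k α).repr q p₀ := by
    conv_lhs => rw [← (tensorBasis k α).linearCombination_repr q]
    rw [Finsupp.linearCombination_apply, Finsupp.sum, map_sum, map_sum, Finsupp.finsetSum_apply,
      Finset.sum_eq_single p₀]
    · rw [map_smul, map_smul, Finsupp.smul_apply, tensorBasis_apply, basisTensor, tensorRep_tprod,
        tensorBasis_repr_tprod, Finset.prod_eq_one, smul_eq_mul, mul_one]
      intro i _
      rw [stdRep_shear, one_smul, Finsupp.add_apply, hDv, Finset.sum_eq_single i,
        Finsupp.single_eq_same, Finsupp.single_eq_same, Finsupp.single_eq_of_ne, zero_add]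
      · have := hp₀N i
        simp only [ν]
        omega
      · intro j _ hj
        exact Finsupp.single_eq_of_ne fun h => hj (hν h.symm)
      · exact fun h => absurd (Finset.mem_univ _) h
    · intro p hp hpp
      obtain ⟨i, hi⟩ := Function.ne_iff.1 hpp
      rw [map_smul, map_smul, Finsupp.smul_apply, tensorBasis_apply, basisTensor, tensorRep_tprod,
        tensorBasis_repr_tprod, Finset.prod_eq_zero (Finset.mem_univ i), smul_zero]
      rw [stdRep_shear, one_smul, Finsupp.add_apply, hDv, Finset.sum_eq_single i,
        Finsupp.single_eq_same, Finsupp.single_eq_of_ne, Finsupp.single_eq_of_ne hi.symm, zero_add]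
      · have := hN p hp i
        simp only [ν]
        omega
      · intro j _ hj
        exact Finsupp.single_eq_of_ne fun h => hj (hν h.symm)
      · exact fun h => absurd (Finset.mem_univ _) h
    · intro h
      rw [Finsupp.notMem_support_iff.1 h, zero_smul, map_zero, map_zero, Finsupp.zero_apply]
  rw [key]
  exact hp₀

/-- The functions `χ` on the set of basis tensors such that the diagonal endomorphism with
eigenvalues `χ` is induced by an element of the group algebra of `GL`. -/
def diagonalCharacters : Subalgebra k ((α → ℕ) → k) where
  carrier := {χ | ∃ h : MonoidAlgebra k (GLInf k), ∀ p,
    (tensorRep k α).asAlgebraHom h (basisTensor k p) = χ p • basisTensor k p}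
  mul_mem' := by
    rintro χ ψ ⟨h, hh⟩ ⟨h', hh'⟩
    refine ⟨h * h', fun p => ?_⟩
    rw [map_mul, Module.End.mul_apply, hh', map_smul, hh, smul_smul, Pi.mul_apply, mul_comm]
  add_mem' := by
    rintro χ ψ ⟨h, hh⟩ ⟨h', hh'⟩
    refine ⟨h + h', fun p => ?_⟩
    rw [map_add, LinearMap.add_apply, hh, hh', Pi.add_apply, add_smul]
  algebraMap_mem' s := by
    refine ⟨algebraMap k _ s, fun p => ?_⟩
    rw [AlgHom.commutes, Module.algebraMap_end_apply]
    rfl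

theorem pow_count_mem_diagonalCharacters [CharZero k] (l : ℕ) :
    (fun p : α → ℕ => (2 : k) ^ (Finset.univ.filter fun i => p i = l).card) ∈
      diagonalCharacters := by
  refine ⟨MonoidAlgebra.single (dilation l (2 : k) two_ne_zero) 1, fun p => ?_⟩
  rw [Representation.asAlgebraHom_single, one_smul, basisTensor, tensorRep_tprod]
  simp only [stdRep_dilation]
  rw [MultilinearMap.map_smul_univ, Finset.prod_ite, Finset.prod_const, Finset.prod_const_one,
    mul_one]

open Classical in
/-- The projection onto the span of the multilinear basis tensors in given letters is induced by
an element of the group algebra of `GL`. -/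
theorem exists_multilinear_projection [CharZero k] {ν : α → ℕ} (hν : Function.Injective ν) :
    ∃ h : MonoidAlgebra k (GLInf k), ∀ p,
      (tensorRep k α).asAlgebraHom h (basisTensor k p) =
        if ∃ σ : Equiv.Perm α, p = ν ∘ σ then basisTensor k p else 0 := by
  let m : ℕ → (α → ℕ) → ℕ := fun l p => (Finset.univ.filter fun i => p i = l).card
  let E : Finset ℕ := (Finset.range (Fintype.card α + 1)).erase 1
  -- A factor vanishes at `p` as soon as some letter `ν i` occurs in `p` with multiplicity `≠ 1`.
  let χ : (α → ℕ) → k := ∏ i, ∏ e ∈ E,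
    ((fun p : α → ℕ => (2 : k) ^ m (ν i) p) - algebraMap k _ ((2 : k) ^ e))
  have hχ : χ ∈ diagonalCharacters (k := k) (α := α) :=
    Subalgebra.prod_mem _ fun i _ => Subalgebra.prod_mem _ fun e _ =>
      Subalgebra.sub_mem _ (pow_count_mem_diagonalCharacters _) (Subalgebra.algebraMap_mem _ _)
  have hχp : ∀ p, χ p = ∏ i, ∏ e ∈ E, ((2 : k) ^ m (ν i) p - 2 ^ e) := fun p => by
    simp only [χ, Finset.prod_apply]
    rfl
  have hpow : ∀ a b : ℕ, (2 : k) ^ a - 2 ^ b = 0 → a = b := fun a b hab => by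
    have : ((2 ^ a : ℕ) : k) = ((2 ^ b : ℕ) : k) := by
      push_cast
      exact sub_eq_zero.1 hab
    exact Nat.pow_right_injective le_rfl (Nat.cast_injective this)
  set κ : k := ∏ _i : α, ∏ e ∈ E, ((2 : k) ^ 1 - 2 ^ e) with hκ
  have hκ0 : κ ≠ 0 := Finset.prod_ne_zero_iff.2 fun i _ => Finset.prod_ne_zero_iff.2
    fun e he h => (Finset.mem_erase.1 he).1 (hpow _ _ h).symm
  have h1 : ∀ σ : Equiv.Perm α, χ (ν ∘ σ) = κ := fun σ => by
    rw [hχp, hκ]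
    refine Finset.prod_congr rfl fun i _ => ?_
    have : m (ν i) (ν ∘ σ) = 1 := by
      simp only [m, Finset.card_eq_one]
      refine ⟨σ⁻¹ i, ?_⟩
      ext j
      simp only [Function.comp_apply, Finset.mem_filter, Finset.mem_univ, true_and,
        Finset.mem_singleton, hν.eq_iff]
      exact Equiv.Perm.eq_inv_iff_eq.symm
    rw [this]
  have h2 : ∀ p, χ p ≠ 0 → ∃ σ : Equiv.Perm α, p = ν ∘ σ := fun p hp => by
    rw [hχp] at hp
    have hm : ∀ i, m (ν i) p = 1 := fun i => by
      by_contra hne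
      refine Finset.prod_ne_zero_iff.1 (Finset.prod_ne_zero_iff.1 hp i (Finset.mem_univ _))
        (m (ν i) p) (Finset.mem_erase.2 ⟨hne, Finset.mem_range.2 (Nat.lt_succ_of_le ?_)⟩)
        (sub_self _)
      exact Finset.card_le_univ _
    have hex : ∀ i, ∃ j, p j = ν i := fun i => by
      have : 0 < m (ν i) p := by rw [hm]; exact one_pos
      obtain ⟨j, hj⟩ := Finset.card_pos.1 this
      exact ⟨j, (Finset.mem_filter.1 hj).2⟩
    choose s hs using hex
    have hsinj : Function.Injective s := fun i j hij => hν (by rw [← hs, ← hs, hij])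
    refine ⟨(Equiv.ofBijective s (Finite.injective_iff_bijective.1 hsinj)).symm, ?_⟩
    ext j
    rw [Function.comp_apply, ← hs]
    congr 1
    exact ((Equiv.ofBijective s (Finite.injective_iff_bijective.1 hsinj)).apply_symm_apply j).symm
  obtain ⟨h, hh⟩ := hχ
  refine ⟨κ⁻¹ • h, fun p => ?_⟩
  rw [map_smul, LinearMap.smul_apply, hh, smul_smul]
  split_ifs with hp
  · obtain ⟨σ, rfl⟩ := hp
    rw [h1, inv_mul_cancel₀ hκ0, one_smul]
  · have : χ p = 0 := by
      by_contra hne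
      exact hp (h2 p hne)
    rw [this, mul_zero, zero_smul]

end Tensors

/-! ### Schur functors are absolutely simple -/

section GroupAlgebraAction

variable {k G V W : Type*} [Field k] [Group G] [AddCommMonoid V] [Module k V] [AddCommMonoid W]
  [Module k W] {ρ : Representation k G V} {σ : Representation k G W}

theorem map_asAlgebraHom (f : V →ₗ[k] W) (hf : ∀ g v, f (ρ g v) = σ g (f v))
    (h : MonoidAlgebra k G) (v : V) : f (ρ.asAlgebraHom h v) = σ.asAlgebraHom h (f v) := by
  induction h using MonoidAlgebra.induction_linear with
  | zero => simp
  | add a b ha hb => simp [ha, hb]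
  | single g a => simp [hf]

theorem asAlgebraHom_mem (Q : Subrepresentation ρ) (h : MonoidAlgebra k G) {v : V}
    (hv : v ∈ Q.toSubmodule) : ρ.asAlgebraHom h v ∈ Q.toSubmodule := by
  induction h using MonoidAlgebra.induction_linear with
  | zero => simp
  | add a b ha hb =>
    rw [map_add, LinearMap.add_apply]
    exact Q.toSubmodule.add_mem ha hb
  | single g a =>
    rw [Representation.asAlgebraHom_single, LinearMap.smul_apply]
    exact Q.toSubmodule.smul_mem _ (Q.apply_mem_toSubmodule g hv)

end GroupAlgebraAction

section Generation

variable {k V : Type*} [Field k] [AddCommMonoid V] [Module k V]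
  {ρ : Representation k (GLInf k) V}

theorem self_mem_generatedBy (x : V) : x ∈ (generatedBy ρ x).toSubmodule :=
  Submodule.subset_span ⟨1, by simp⟩

theorem mem_generatedBy_iff {x y : V} :
    y ∈ (generatedBy ρ x).toSubmodule ↔ ∃ h, ρ.asAlgebraHom h x = y := by
  constructor
  · intro hy
    induction hy using Submodule.span_induction with
    | mem y hy =>
      obtain ⟨g, rfl⟩ := hy
      exact ⟨MonoidAlgebra.single g 1, by simp⟩
    | zero => exact ⟨0, by simp⟩
    | add y z _ _ hy hz =>
      obtain ⟨a, rfl⟩ := hy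
      obtain ⟨b, rfl⟩ := hz
      exact ⟨a + b, by simp⟩
    | smul s y _ hy =>
      obtain ⟨a, rfl⟩ := hy
      exact ⟨s • a, by simp⟩
  · rintro ⟨h, rfl⟩
    exact asAlgebraHom_mem _ h (self_mem_generatedBy x)

end Generation

section PlaceAction

open MonoidAlgebra

variable {k : Type*} [Field k] {α : Type*}

variable (k α) in
/-- The action of the permutations of the tensor factors on a tensor power of `V`. -/
def placeRep : Representation k (Equiv.Perm α) (⨂[k] _ : α, Std k) where
  toFun σ := (PiTensorProduct.reindex k (fun _ : α => Std k) σ).toLinearMap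
  map_one' := PiTensorProduct.ext (MultilinearMap.ext fun v => by
    change PiTensorProduct.reindex k (fun _ : α => Std k) 1 (PiTensorProduct.tprod k v) = _
    rw [PiTensorProduct.reindex_tprod]
    rfl)
  map_mul' σ τ := PiTensorProduct.ext (MultilinearMap.ext fun v => by
    change PiTensorProduct.reindex k (fun _ : α => Std k) (σ * τ) (PiTensorProduct.tprod k v) =
      PiTensorProduct.reindex k (fun _ : α => Std k) σ
        (PiTensorProduct.reindex k (fun _ : α => Std k) τ (PiTensorProduct.tprod k v))
    rw [PiTensorProduct.reindex_tprod, PiTensorProduct.reindex_tprod]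
    exact (PiTensorProduct.reindex_tprod (R := k) (s := fun _ => Std k) σ
      fun i => v (τ.symm i)).symm)

/-- The action of the group algebra of the permutations of the tensor factors. -/
def place (x : MonoidAlgebra k (Equiv.Perm α)) : (⨂[k] _ : α, Std k) →ₗ[k] ⨂[k] _ : α, Std k :=
  (placeRep k α).asAlgebraHom x

theorem place_mul (x y : MonoidAlgebra k (Equiv.Perm α)) (t : ⨂[k] _ : α, Std k) :
    place (x * y) t = place x (place y t) := by
  rw [place, map_mul, Module.End.mul_apply, place, place]

theorem place_smul (s : k) (x : MonoidAlgebra k (Equiv.Perm α)) (t : ⨂[k] _ : α, Std k) :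
    place (s • x) t = s • place x t := by
  rw [place, map_smul, LinearMap.smul_apply, place]

theorem place_single_basisTensor (σ : Equiv.Perm α) (p : α → ℕ) :
    place (single σ (1 : k)) (basisTensor k p) = basisTensor k (p ∘ (σ⁻¹ : Equiv.Perm α)) := by
  rw [place, Representation.asAlgebraHom_single, one_smul]
  exact PiTensorProduct.reindex_tprod σ _

theorem map_place (D : Std k →ₗ[k] Std k) (x : MonoidAlgebra k (Equiv.Perm α))
    (t : ⨂[k] _ : α, Std k) :
    PiTensorProduct.map (fun _ => D) (place x t) = place x (PiTensorProduct.map (fun _ => D) t) :=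
  map_asAlgebraHom (ρ := placeRep k α) (σ := placeRep k α) (PiTensorProduct.map fun _ => D)
    (fun σ t => PiTensorProduct.map_reindex (fun _ : α => D) σ t) x t

theorem tensorRep_place (g : GLInf k) (x : MonoidAlgebra k (Equiv.Perm α))
    (t : ⨂[k] _ : α, Std k) : tensorRep k α g (place x t) = place x (tensorRep k α g t) :=
  map_place _ x t

theorem asAlgebraHom_place (h : MonoidAlgebra k (GLInf k)) (x : MonoidAlgebra k (Equiv.Perm α))
    (t : ⨂[k] _ : α, Std k) :
    (tensorRep k α).asAlgebraHom h (place x t) = place x ((tensorRep k α).asAlgebraHom h t) :=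
  (map_asAlgebraHom (place x) (fun g t => (tensorRep_place g x t).symm) h t).symm

theorem youngSymmetrizer_eq_place (μ : YoungDiagram) :
    youngSymmetrizer k μ =
      place (youngElt k (fun x : μ.cells => x.1.1) (fun x : μ.cells => x.1.2)) := by
  simp only [youngSymmetrizer, youngElt, place, map_sum, Representation.asAlgebraHom_single]
  refine Finset.sum_congr rfl fun p _ => Finset.sum_congr rfl fun q _ => ?_
  rw [map_mul]
  rfl

variable [Fintype α] [DecidableEq α]

/-- The multilinear part of a tensor, with respect to given letters, as an element of the group
algebra: the coefficient of `σ` is that of the basis tensor `σ • ⊗ e_{ν i}`. -/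
def multilinearPart (ν : α → ℕ) : (⨂[k] _ : α, Std k) →ₗ[k] MonoidAlgebra k (Equiv.Perm α) :=
  ∑ σ : Equiv.Perm α, ((tensorBasis k α).coord (ν ∘ (σ⁻¹ : Equiv.Perm α))).smulRight (single σ 1)

theorem multilinearPart_apply (ν : α → ℕ) (t : ⨂[k] _ : α, Std k) :
    multilinearPart ν t = ∑ σ : Equiv.Perm α,
      (tensorBasis k α).repr t (ν ∘ (σ⁻¹ : Equiv.Perm α)) • single σ 1 := by
  rw [multilinearPart, LinearMap.sum_apply]
  rfl

theorem coeff_multilinearPart (ν : α → ℕ) (t : ⨂[k] _ : α, Std k) (τ : Equiv.Perm α) :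
    (multilinearPart ν t).coeff τ = (tensorBasis k α).repr t (ν ∘ (τ⁻¹ : Equiv.Perm α)) := by
  rw [multilinearPart_apply, coeff_sum, Finsupp.finsetSum_apply, Finset.sum_eq_single τ]
  · rw [coeff_smul_apply, coeff_single, Finsupp.single_eq_same, smul_eq_mul, mul_one]
  · intro σ _ hσ
    rw [coeff_smul_apply, coeff_single, Finsupp.single_eq_of_ne hσ.symm, smul_zero]
  · exact fun h => absurd (Finset.mem_univ _) h

theorem repr_basisTensor (p : α → ℕ) :
    (tensorBasis k α).repr (basisTensor k p) = Finsupp.single p 1 := by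
  rw [← tensorBasis_apply, Module.Basis.repr_self]

variable {ν : α → ℕ}

theorem comp_perm_injective (hν : Function.Injective ν) {σ τ : Equiv.Perm α}
    (h : ν ∘ σ = ν ∘ τ) : σ = τ :=
  Equiv.ext fun i => hν (congrFun h i)

theorem multilinearPart_place (hν : Function.Injective ν) (x : MonoidAlgebra k (Equiv.Perm α)) :
    multilinearPart ν (place x (basisTensor k ν)) = x := by
  induction x using MonoidAlgebra.induction_linear with
  | zero =>
    rw [place, map_zero, LinearMap.zero_apply, map_zero]
  | add x y hx hy =>
    have : place (x + y) (basisTensor k ν) = place x (basisTensor k ν) + place y (basisTensor k ν) := by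
      rw [place, map_add]; rfl
    rw [this, map_add, hx, hy]
  | single σ a =>
    have : single σ a = a • (single σ 1 : MonoidAlgebra k (Equiv.Perm α)) := by
      rw [smul_single, smul_eq_mul, mul_one]
    rw [this, place_smul, map_smul, place_single_basisTensor, multilinearPart_apply,
      Finset.sum_eq_single σ]
    · rw [repr_basisTensor, Finsupp.single_eq_same, one_smul]
    · intro τ _ hτ
      rw [repr_basisTensor, Finsupp.single_eq_of_ne, zero_smul]
      exact fun h => hτ (inv_injective (comp_perm_injective hν h))
    · exact fun h => absurd (Finset.mem_univ _) h

/-- The projection to the multilinear part is induced by an element of the group algebra of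
`GL`. -/
theorem exists_asAlgebraHom_eq_multilinearPart [CharZero k] (hν : Function.Injective ν) :
    ∃ h : MonoidAlgebra k (GLInf k), ∀ t : ⨂[k] _ : α, Std k,
      (tensorRep k α).asAlgebraHom h t = place (multilinearPart ν t) (basisTensor k ν) := by
  classical
  obtain ⟨h, hh⟩ := exists_multilinear_projection (k := k) hν
  refine ⟨h, fun t => ?_⟩
  let F : (⨂[k] _ : α, Std k) →ₗ[k] ⨂[k] _ : α, Std k :=
    ((placeRep k α).asAlgebraHom.toLinearMap.flip (basisTensor k ν)).comp (multilinearPart ν)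
  have hF : ∀ t, F t = place (multilinearPart ν t) (basisTensor k ν) := fun _ => rfl
  rw [← hF]
  refine LinearMap.congr_fun (tensor_ext fun p => ?_) t
  rw [hh, hF]
  split_ifs with hp
  · obtain ⟨τ, rfl⟩ := hp
    have : basisTensor k (ν ∘ τ) = place (single τ⁻¹ 1) (basisTensor k ν) := by
      rw [place_single_basisTensor, inv_inv]
    rw [this, multilinearPart_place hν]
  · have : multilinearPart ν (basisTensor k p) = 0 := by
      rw [multilinearPart_apply]
      refine Finset.sum_eq_zero fun σ _ => ?_
      rw [repr_basisTensor, Finsupp.single_eq_of_ne, zero_smul]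
      exact fun h => hp ⟨σ⁻¹, h.symm⟩
    rw [this, place, map_zero, LinearMap.zero_apply]

/-- A multilinear basis tensor generates the tensor power. -/
theorem exists_asAlgebraHom_basisTensor (hν : Function.Injective ν) (t : ⨂[k] _ : α, Std k) :
    ∃ h, (tensorRep k α).asAlgebraHom h (basisTensor k ν) = t := by
  rw [← mem_generatedBy_iff, eq_top_of_basisTensor_mem _ hν (self_mem_generatedBy _)]
  exact Submodule.mem_top

end PlaceAction

section Schur

open MonoidAlgebra

variable {k : Type*} [Field k] [CharZero k] (μ : YoungDiagram)

theorem exists_injective_letters (α : Type*) [Fintype α] : ∃ ν : α → ℕ, Function.Injective ν :=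
  ⟨fun i => Fintype.equivFin α i, fun _ _ h => (Fintype.equivFin α).injective (Fin.ext h)⟩

variable (k) in
/-- The Young symmetrizer of the tautological filling of a Young diagram by its cells. -/
def cellYoungElt : MonoidAlgebra k (Equiv.Perm μ.cells) :=
  youngElt k (fun x : μ.cells => x.1.1) (fun x : μ.cells => x.1.2)

variable {μ}

theorem mem_schur_iff {t : ⨂[k] _ : μ.cells, Std k} :
    t ∈ (schur k μ).toSubmodule ↔ ∃ t', place (cellYoungElt k μ) t' = t := by
  change t ∈ LinearMap.range (youngSymmetrizer k μ) ↔ _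
  rw [youngSymmetrizer_eq_place]
  rfl

variable (k μ) in
theorem exists_cellYoungElt_mul_self : ∃ s : k, s ≠ 0 ∧
    cellYoungElt k μ * cellYoungElt k μ = s • cellYoungElt k μ :=
  youngElt_mul_self (isTableau_cells μ)

theorem place_of_mem_schur {s : k} (hs : cellYoungElt k μ * cellYoungElt k μ = s • cellYoungElt k μ)
    {t : ⨂[k] _ : μ.cells, Std k} (ht : t ∈ (schur k μ).toSubmodule) :
    place (cellYoungElt k μ) t = s • t := by
  obtain ⟨t', rfl⟩ := mem_schur_iff.1 ht
  rw [← place_mul, hs, place_smul]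

/-- Every non-zero element of a Schur functor generates it. -/
theorem schur_le_of_mem (Q : Subrepresentation (tensorRep k μ.cells))
    {q : ⨂[k] _ : μ.cells, Std k} (hq : q ∈ (schur k μ).toSubmodule) (hq0 : q ≠ 0)
    (hqQ : q ∈ Q.toSubmodule) : (schur k μ).toSubmodule ≤ Q.toSubmodule := by
  obtain ⟨s, hs0, hs⟩ := exists_cellYoungElt_mul_self k μ
  set c := cellYoungElt k μ with hc
  obtain ⟨ν, g, hν, hcoeff⟩ := exists_multilinear_coefficient hq0
  obtain ⟨h, hh⟩ := exists_asAlgebraHom_eq_multilinearPart (k := k) hν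
  set x := multilinearPart ν (tensorRep k μ.cells g q) with hx
  have hx0 : x ≠ 0 := by
    intro h0
    refine hcoeff ?_
    have := coeff_multilinearPart ν (tensorRep k μ.cells g q) 1
    rw [← hx, h0] at this
    exact this.symm
  have hzQ : place x (basisTensor k ν) ∈ Q.toSubmodule := by
    rw [hx, ← hh]
    exact asAlgebraHom_mem Q h (Q.apply_mem_toSubmodule g hqQ)
  have hcx : c * x = s • x := by
    rw [← multilinearPart_place hν (c * x), place_mul]
    conv_lhs => rw [hx, ← hh, ← asAlgebraHom_place, ← tensorRep_place, place_of_mem_schur hs hq,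
      map_smul, map_smul, map_smul, hh, multilinearPart_place hν]
  obtain ⟨y, hy⟩ : ∃ y, x * y * x ≠ 0 := by
    by_contra! hall
    exact hx0 (eq_zero_of_forall_mul_mul_self hall)
  obtain ⟨s', hs'⟩ := youngElt_mul_mul (k := k) (isTableau_cells μ) (x * y)
  change c * (x * y) * c = s' • c at hs'
  have hs'0 : s' ≠ 0 := by
    rintro rfl
    rw [zero_smul] at hs'
    refine hy ?_
    have h1 : (s * s) • (x * y * x) = 0 := by
      calc (s * s) • (x * y * x) = (s • x) * y * (s • x) := by
            rw [smul_mul_assoc, smul_mul_assoc, mul_smul_comm, smul_smul]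
        _ = c * (x * y) * c * x := by rw [← hcx]; simp only [mul_assoc]
        _ = 0 := by rw [hs', zero_mul]
    exact (smul_eq_zero.1 h1).resolve_left (mul_ne_zero hs0 hs0)
  have hcQ : place c (basisTensor k ν) ∈ Q.toSubmodule := by
    obtain ⟨hy', hhy'⟩ := exists_asAlgebraHom_basisTensor hν (place (y * c) (basisTensor k ν))
    have h1 := asAlgebraHom_mem Q hy' hzQ
    have h2 : (s * s'⁻¹) • (x * (y * c)) = c := by
      have : s • (x * (y * c)) = s' • c := by
        rw [← hs', ← smul_mul_assoc, ← hcx]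
        simp only [mul_assoc]
      rw [mul_comm, mul_smul, this, smul_smul, inv_mul_cancel₀ hs'0, one_smul]
    rw [asAlgebraHom_place, hhy', ← place_mul] at h1
    rw [← h2, place_smul]
    exact Q.toSubmodule.smul_mem _ h1
  intro u hu
  obtain ⟨t, rfl⟩ := mem_schur_iff.1 hu
  obtain ⟨ht, hht⟩ := exists_asAlgebraHom_basisTensor hν t
  rw [← hht, ← asAlgebraHom_place]
  exact asAlgebraHom_mem Q ht hcQ

/-- The endomorphisms of a Schur functor are scalars. -/
theorem schur_end_eq_smul (θ : (schur k μ).toSubmodule →ₗ[k] (schur k μ).toSubmodule)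
    (hθ : ∀ g v, θ ((schur k μ).toRepresentation g v) = (schur k μ).toRepresentation g (θ v)) :
    ∃ a : k, ∀ v, θ v = a • v := by
  obtain ⟨s, hs0, hs⟩ := exists_cellYoungElt_mul_self k μ
  set c := cellYoungElt k μ with hc
  obtain ⟨ν, hν⟩ := exists_injective_letters μ.cells
  let θ' : (schur k μ).toSubmodule →ₗ[k] ⨂[k] _ : μ.cells, Std k :=
    (schur k μ).toSubmodule.subtype.comp θ
  have hsub : ∀ (h : MonoidAlgebra k (GLInf k)) (v : (schur k μ).toSubmodule),
      (((schur k μ).toRepresentation.asAlgebraHom h v : (schur k μ).toSubmodule) :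
        ⨂[k] _ : μ.cells, Std k) = (tensorRep k μ.cells).asAlgebraHom h v := fun h v =>
    map_asAlgebraHom (ρ := (schur k μ).toRepresentation) (schur k μ).toSubmodule.subtype
      (fun _ _ => rfl) h v
  have hθ' : ∀ (h : MonoidAlgebra k (GLInf k)) (v : (schur k μ).toSubmodule),
      θ' ((schur k μ).toRepresentation.asAlgebraHom h v) =
        (tensorRep k μ.cells).asAlgebraHom h (θ' v) := fun h v =>
    map_asAlgebraHom (ρ := (schur k μ).toRepresentation) (σ := tensorRep k μ.cells) θ'
      (fun g v => congrArg Subtype.val (hθ g v)) h v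
  let u : (schur k μ).toSubmodule := ⟨place c (basisTensor k ν), mem_schur_iff.2 ⟨_, rfl⟩⟩
  have hgen : ∀ h t, (tensorRep k μ.cells).asAlgebraHom h (basisTensor k ν) = t →
      (((schur k μ).toRepresentation.asAlgebraHom h u : (schur k μ).toSubmodule) :
        ⨂[k] _ : μ.cells, Std k) = place c t := fun h t ht => by
    rw [hsub, ← ht]
    exact asAlgebraHom_place _ _ _
  obtain ⟨h, hh⟩ := exists_asAlgebraHom_eq_multilinearPart (k := k) hν
  set y := multilinearPart ν (θ' u) with hy
  have hu : (schur k μ).toRepresentation.asAlgebraHom h u = u := by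
    refine Subtype.ext (hgen h _ ?_)
    rw [hh]
    have h1 := multilinearPart_place (k := k) hν 1
    have h2 : place (1 : MonoidAlgebra k (Equiv.Perm μ.cells)) (basisTensor k ν) =
        basisTensor k ν := by
      rw [place, map_one, Module.End.one_apply]
    rw [h2] at h1
    rw [h1, h2]
  have hθu : θ' u = place y (basisTensor k ν) := by
    rw [hy, ← hh, ← hθ', hu]
  have hcy : c * y = s • y := by
    have h0 : place c (θ' u) = s • θ' u := place_of_mem_schur hs (θ u).2
    rw [← multilinearPart_place hν (c * y), place_mul, ← hθu, h0, map_smul]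
  obtain ⟨a, ha⟩ := youngElt_mul_mul (k := k) (isTableau_cells μ) y
  change c * y * c = a • c at ha
  obtain ⟨hc', hhc'⟩ := exists_asAlgebraHom_basisTensor hν (place c (basisTensor k ν))
  have h1 : (schur k μ).toRepresentation.asAlgebraHom hc' u = s • u := by
    refine Subtype.ext ?_
    rw [hgen hc' _ hhc', ← place_mul, hs, place_smul]
    rfl
  have h2 : s • θ' u = place (y * c) (basisTensor k ν) := by
    rw [← map_smul, ← h1, hθ', hθu, asAlgebraHom_place, hhc', place_mul]
  have h3 : θ' u = (s⁻¹ * s⁻¹ * a) • (u : ⨂[k] _ : μ.cells, Std k) := by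
    have h4 : s • (y * c) = a • c := by rw [← ha, hcy, smul_mul_assoc]
    have h5 : (s * s) • θ' u = a • place c (basisTensor k ν) := by
      rw [mul_smul, h2, ← place_smul, h4, place_smul]
    rw [mul_smul, ← mul_inv, inv_smul_eq_iff₀ (mul_ne_zero hs0 hs0) |>.2]
    exact h5.symm
  refine ⟨s⁻¹ * s⁻¹ * a, fun v => ?_⟩
  obtain ⟨t, ht⟩ := mem_schur_iff.1 v.2
  obtain ⟨ht', hht'⟩ := exists_asAlgebraHom_basisTensor hν t
  have hv : v = (schur k μ).toRepresentation.asAlgebraHom ht' u :=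
    Subtype.ext (by rw [hgen ht' t hht', ht])
  refine Subtype.ext ?_
  change θ' v = _ • (v : ⨂[k] _ : μ.cells, Std k)
  rw [hv, hθ', h3, map_smul, hsub]

theorem exists_mem_schur_ne_zero : ∃ q ∈ (schur k μ).toSubmodule, q ≠ 0 := by
  obtain ⟨ν, hν⟩ := exists_injective_letters μ.cells
  refine ⟨place (cellYoungElt k μ) (basisTensor k ν), mem_schur_iff.2 ⟨_, rfl⟩, fun h => ?_⟩
  have h1 := multilinearPart_place hν (cellYoungElt k μ)
  rw [h, map_zero] at h1
  have h2 := coeff_youngElt_one (k := k) (isTableau_cells μ).inj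
  change (cellYoungElt k μ).coeff 1 = 1 at h2
  rw [← h1] at h2
  exact zero_ne_one h2

end Schur

/-! ### Complete reducibility -/

section AsModule

variable {k G : Type*} [Field k] [Group G]

instance (priority := low) asModule.instAddCommGroupOfField {V : Type*} [AddCommMonoid V] [Module k V]
    (ρ : Representation k G V) : AddCommGroup ρ.asModule :=
  Module.addCommMonoidToAddCommGroup k

variable {V W : Type*} [AddCommMonoid V] [Module k V] [AddCommMonoid W] [Module k W]
  {ρ : Representation k G V} {σ : Representation k G W}

/-- An equivariant map as a linear map over the group algebra. -/
def asModuleHom (f : V →ₗ[k] W) (hf : ∀ g v, f (ρ g v) = σ g (f v)) :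
    ρ.asModule →ₗ[MonoidAlgebra k G] σ.asModule where
  toFun := f
  map_add' := f.map_add
  map_smul' h v := by
    have := map_asAlgebraHom f hf h (ρ.asModuleEquiv v)
    exact this

/-- A linear map over the group algebra as a linear map over the base field. -/
def ofModuleHom (f : ρ.asModule →ₗ[MonoidAlgebra k G] σ.asModule) : V →ₗ[k] W :=
  (f.restrictScalars k : ρ.asModule →ₗ[k] σ.asModule)

theorem ofModuleHom_equivariant (f : ρ.asModule →ₗ[MonoidAlgebra k G] σ.asModule) (g : G) (v : V) :
    ofModuleHom f (ρ g v) = σ g (ofModuleHom f v) := by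
  have h1 : (MonoidAlgebra.single g (1 : k) • (ρ.asModuleEquiv.symm v) : ρ.asModule) = ρ g v := by
    rw [Representation.single_smul, one_smul]
    rfl
  have h2 : (MonoidAlgebra.single g (1 : k) • (f v) : σ.asModule) = σ g (f v) := by
    rw [Representation.single_smul, one_smul]
    rfl
  exact ((congrArg f h1).symm.trans (f.map_smul _ _)).trans h2

end AsModule

section SchurSimple

variable {k : Type*} [Field k] [CharZero k] {μ : YoungDiagram}

instance schur_isSimpleModule :
    IsSimpleModule (MonoidAlgebra k (GLInf k)) (schur k μ).toRepresentation.asModule := by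
  rw [isSimpleModule_iff_toSpanSingleton_surjective]
  constructor
  · obtain ⟨q, hq, hq0⟩ := exists_mem_schur_ne_zero (k := k) (μ := μ)
    exact ⟨⟨(⟨q, hq⟩ : (schur k μ).toSubmodule), (0 : (schur k μ).toSubmodule),
      fun h => hq0 (congrArg Subtype.val h)⟩⟩
  · intro (x : (schur k μ).toSubmodule) hx (y : (schur k μ).toSubmodule)
    have hx0 : x.1 ≠ 0 := fun h => hx (Subtype.ext h)
    have hy := schur_le_of_mem (generatedBy (tensorRep k μ.cells) x.1) x.2 hx0
      (self_mem_generatedBy x.1) y.2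
    obtain ⟨h, hh⟩ := mem_generatedBy_iff.1 hy
    refine ⟨h, Subtype.ext ?_⟩
    rw [← hh]
    exact map_asAlgebraHom (ρ := (schur k μ).toRepresentation) (σ := tensorRep k μ.cells)
      (schur k μ).toSubmodule.subtype (fun _ _ => rfl) h x

/-- The group algebra acts densely on a Schur functor, since the only equivariant endomorphisms
are the scalars. -/
theorem schur_density (f : (schur k μ).toSubmodule →ₗ[k] (schur k μ).toSubmodule)
    (s : Finset (schur k μ).toSubmodule) :
    ∃ h : MonoidAlgebra k (GLInf k), ∀ m ∈ s,
      f m = (schur k μ).toRepresentation.asAlgebraHom h m := by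
  let S := (schur k μ).toRepresentation.asModule
  let f' : Module.End (Module.End (MonoidAlgebra k (GLInf k)) S) S :=
    { toFun := f
      map_add' := f.map_add
      map_smul' := fun θ v => by
        obtain ⟨a, ha⟩ := schur_end_eq_smul (ofModuleHom θ) (ofModuleHom_equivariant θ)
        change f (ofModuleHom θ v) = ofModuleHom θ (f v)
        exact (congrArg f (ha v)).trans ((f.map_smul a v).trans (ha (f v)).symm) }
  exact jacobson_density f' s

end SchurSimple

section SchurGenerated

variable {k : Type*} [Field k]

/-- A representation is Schur generated if it is the sum of finitely many homomorphic images of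
Schur functors. -/
def IsSchurGenerated {W : Type*} [AddCommMonoid W] [Module k W]
    (σ : Representation k (GLInf k) W) : Prop :=
  ∃ S : Set (Submodule k W), S.Finite ∧
    (∀ P ∈ S, ∃ (μ : YoungDiagram) (φ : (schur k μ).toSubmodule →ₗ[k] W),
      (∀ g v, φ ((schur k μ).toRepresentation g v) = σ g (φ v)) ∧ LinearMap.range φ = P) ∧
    sSup S = ⊤

theorem IsSchurGenerated.of_iSup {W : Type*} [AddCommMonoid W] [Module k W]
    {σ : Representation k (GLInf k) W} {ι : Type*} [Finite ι] {U : ι → Type*}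
    [∀ i, AddCommMonoid (U i)] [∀ i, Module k (U i)] {τ : ∀ i, Representation k (GLInf k) (U i)}
    (hτ : ∀ i, IsSchurGenerated (τ i)) (f : ∀ i, U i →ₗ[k] W)
    (hf : ∀ i g v, f i (τ i g v) = σ g (f i v)) (h : ⨆ i, LinearMap.range (f i) = ⊤) :
    IsSchurGenerated σ := by
  choose S hS1 hS2 hS3 using hτ
  refine ⟨⋃ i, (Submodule.map (f i)) '' S i, Set.finite_iUnion fun i => (hS1 i).image _, ?_, ?_⟩
  · intro P hP
    obtain ⟨i, Q, hQ, rfl⟩ := Set.mem_iUnion.1 hP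
    obtain ⟨μ, φ, hφ, rfl⟩ := hS2 i Q hQ
    exact ⟨μ, f i ∘ₗ φ, fun g v => by rw [LinearMap.comp_apply, hφ, hf]; rfl,
      LinearMap.range_comp _ _⟩
  · rw [eq_top_iff, ← h]
    refine iSup_le fun i => ?_
    rw [LinearMap.range_eq_map, ← hS3 i, sSup_eq_iSup, Submodule.map_iSup]
    refine iSup_le fun Q => ?_
    rw [Submodule.map_iSup]
    exact iSup_le fun hQ => le_sSup (Set.mem_iUnion.2 ⟨i, Q, hQ, rfl⟩)

variable [CharZero k]

section

variable {W : Type*} [AddCommMonoid W] [Module k W] {σ : Representation k (GLInf k) W}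

theorem IsSchurGenerated.exists_iSup_range (h : IsSchurGenerated σ) :
    ∃ (r : ℕ) (lam : Fin r → YoungDiagram)
      (φ : ∀ i, (schur k (lam i)).toRepresentation.asModule →ₗ[MonoidAlgebra k (GLInf k)]
        σ.asModule), ⨆ i, LinearMap.range (φ i) = ⊤ := by
  obtain ⟨S, hS1, hS2, hS3⟩ := h
  choose! μ φ hφ hφr using hS2
  have := hS1.to_subtype
  obtain ⟨r, ⟨e⟩⟩ := Finite.exists_equiv_fin S
  refine ⟨r, fun i => μ (e.symm i), fun i => asModuleHom (φ (e.symm i))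
    (hφ _ (e.symm i).2), ?_⟩
  let T : Submodule (MonoidAlgebra k (GLInf k)) σ.asModule := ⨆ i, LinearMap.range
    (asModuleHom (φ (e.symm i)) (hφ _ (e.symm i).2))
  have key : ∀ w : W, w ∈ sSup S → σ.asModuleEquiv.symm w ∈ T := fun w hw => by
    rw [sSup_eq_iSup'] at hw
    induction hw using Submodule.iSup_induction' with
    | mem P x hx =>
      obtain ⟨i, rfl⟩ := e.symm.surjective P
      rw [← hφr _ (e.symm i).2] at hx
      obtain ⟨v, rfl⟩ := hx
      exact Submodule.mem_iSup_of_mem i ⟨v, rfl⟩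
    | zero => exact T.zero_mem
    | add x y _ _ hx hy => exact T.add_mem hx hy
  exact eq_top_iff.2 fun w _ => key w (hS3 ▸ Submodule.mem_top)

theorem IsSchurGenerated.isSemisimpleModule (h : IsSchurGenerated σ) :
    IsSemisimpleModule (MonoidAlgebra k (GLInf k)) σ.asModule := by
  obtain ⟨r, lam, φ, hφ⟩ := h.exists_iSup_range
  exact isSemisimpleModule_of_isSemisimpleModule_submodule'
    (fun i => IsSemisimpleModule.range (φ i)) hφ

theorem IsSchurGenerated.isNoetherian (h : IsSchurGenerated σ) :
    IsNoetherian (MonoidAlgebra k (GLInf k)) σ.asModule := by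
  obtain ⟨r, lam, φ, hφ⟩ := h.exists_iSup_range
  have : ∀ i, IsNoetherian (MonoidAlgebra k (GLInf k)) (LinearMap.range (φ i)) := fun i =>
    isNoetherian_of_surjective (φ i).rangeRestrict (LinearMap.range_rangeRestrict _)
  rw [← isNoetherian_top_iff, ← hφ]
  exact isNoetherian_iSup

/-- A representation that embeds into a Schur generated one is a finite direct sum of Schur
functors. -/
theorem IsSchurGenerated.exists_equiv_tupleSpace (h : IsSchurGenerated σ) {Q : Type*}
    [AddCommMonoid Q] [Module k Q] {τ : Representation k (GLInf k) Q} (j : Q →ₗ[k] W)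
    (hj : ∀ g v, j (τ g v) = σ g (j v)) (hinj : Function.Injective j) :
    ∃ (r : ℕ) (lam : Fin r → YoungDiagram) (e : TupleSpace k lam ≃ₗ[k] Q),
      ∀ g v, e (tupleRep k lam g v) = τ g (e v) := by
  have := h.isSemisimpleModule
  have := h.isNoetherian
  let J := asModuleHom j hj
  have hJ : Function.Injective J := hinj
  have : IsSemisimpleModule (MonoidAlgebra k (GLInf k)) τ.asModule :=
    IsSemisimpleModule.of_injective J hJ
  have : IsNoetherian (MonoidAlgebra k (GLInf k)) τ.asModule := isNoetherian_of_injective J hJ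
  obtain ⟨r, S, E, hS⟩ :=
    IsSemisimpleModule.exists_linearEquiv_fin_dfinsupp (MonoidAlgebra k (GLInf k)) τ.asModule
  obtain ⟨r', lam', φ, hφ⟩ := h.exists_iSup_range
  have key : ∀ i, ∃ μ : YoungDiagram, Nonempty
      ((schur k μ).toRepresentation.asModule ≃ₗ[MonoidAlgebra k (GLInf k)] S i) := fun i => by
    have hSi := hS i
    obtain ⟨p, hp⟩ := IsSemisimpleModule.extension_property (J ∘ₗ (S i).subtype)
      (hJ.comp Subtype.val_injective) LinearMap.id
    obtain ⟨l, hl⟩ : ∃ l, p ∘ₗ φ l ≠ 0 := by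
      by_contra! h0
      have hp0 : p = 0 := by
        rw [← LinearMap.ker_eq_top, eq_top_iff, ← hφ]
        refine iSup_le fun l => ?_
        rintro _ ⟨v, rfl⟩
        exact LinearMap.congr_fun (h0 l) v
      rw [hp0, LinearMap.zero_comp] at hp
      have := IsSimpleModule.nontrivial (MonoidAlgebra k (GLInf k)) (S i)
      obtain ⟨x, hx⟩ := exists_ne (0 : S i)
      exact hx (LinearMap.congr_fun hp x).symm
    exact ⟨lam' l, ⟨LinearEquiv.ofBijective _ (LinearMap.bijective_of_ne_zero hl)⟩⟩
  choose lam e using key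
  have e := fun i => (e i).some
  let F : (Π₀ i, (schur k (lam i)).toRepresentation.asModule) ≃ₗ[MonoidAlgebra k (GLInf k)]
      τ.asModule := (DFinsupp.mapRange.linearEquiv e).trans E.symm
  let F' : TupleSpace k lam ≃ₗ[k] Q :=
    (F.restrictScalars k : (Π₀ i, (schur k (lam i)).toRepresentation.asModule) ≃ₗ[k] τ.asModule)
  refine ⟨r, lam, F', fun g v => ?_⟩
  let v' : Π₀ i, (schur k (lam i)).toRepresentation.asModule := v
  have h1 : MonoidAlgebra.single g (1 : k) • v' = tupleRep k lam g v := by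
    refine DFinsupp.ext fun i => ?_
    refine (Representation.single_smul _ _ _ (v' i)).trans ?_
    rw [one_smul]
    rfl
  have h2 : (MonoidAlgebra.single g (1 : k) • (F v') : τ.asModule) = τ g (F v') := by
    rw [Representation.single_smul, one_smul]
    rfl
  exact ((congrArg F h1).symm.trans (F.map_smul _ _)).trans h2

end

end SchurGenerated

/-! ### Tensor powers and their shifts are Schur generated -/

section TensorSchur

variable {k : Type*} [Field k] {α β : Type*} [Fintype α] [DecidableEq α] [Fintype β] [DecidableEq β]

theorem tensorRep_reindex (e : β ≃ α) (g : GLInf k) (t : ⨂[k] _ : β, Std k) :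
    tensorRep k α g (PiTensorProduct.reindex k (fun _ : β => Std k) e t) =
      PiTensorProduct.reindex k (fun _ : β => Std k) e (tensorRep k β g t) :=
  PiTensorProduct.map_reindex (fun _ : β => stdRep k g) e t

theorem place_single_reindex (e : β ≃ α) (σ : Equiv.Perm β) (a : k) (t : ⨂[k] _ : β, Std k) :
    place (MonoidAlgebra.single (e.permCongr σ) a)
        (PiTensorProduct.reindex k (fun _ : β => Std k) e t) =
      PiTensorProduct.reindex k (fun _ : β => Std k) e (place (MonoidAlgebra.single σ a) t) := by
  rw [place, place, Representation.asAlgebraHom_single, Representation.asAlgebraHom_single,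
    LinearMap.smul_apply, LinearMap.smul_apply, map_smul]
  congr 1
  have h : (PiTensorProduct.reindex k (fun _ : α => Std k) (e.permCongr σ)).toLinearMap ∘ₗ
      (PiTensorProduct.reindex k (fun _ : β => Std k) e).toLinearMap =
      (PiTensorProduct.reindex k (fun _ : β => Std k) e).toLinearMap ∘ₗ
      (PiTensorProduct.reindex k (fun _ : β => Std k) σ).toLinearMap := by
    refine PiTensorProduct.ext (MultilinearMap.ext fun v => ?_)
    simp only [LinearMap.compMultilinearMap_apply, LinearMap.comp_apply, LinearEquiv.coe_coe,
      PiTensorProduct.reindex_tprod]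
    congr 1
    ext1 i
    simp [Equiv.permCongr_def]
  exact LinearMap.congr_fun h t

theorem sum_labelStab_permCongr (e : β ≃ α) (r : α → ℕ) {A : Type*} [AddCommMonoid A]
    (f : Equiv.Perm α → A) :
    ∑ p ∈ labelStab r, f p = ∑ p ∈ labelStab (r ∘ e), f (e.permCongr p) := by
  symm
  refine Finset.sum_equiv e.permCongr (fun p => ?_) fun _ _ => rfl
  rw [mem_labelStab, mem_labelStab]
  constructor
  · intro h x
    have := h (e.symm x)
    simpa [Equiv.permCongr_apply] using this
  · intro h x
    have := h (e x)
    simpa [Equiv.permCongr_apply] using this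

theorem place_youngElt_reindex (e : β ≃ α) (r c : α → ℕ) (t : ⨂[k] _ : β, Std k) :
    place (youngElt k r c) (PiTensorProduct.reindex k (fun _ : β => Std k) e t) =
      PiTensorProduct.reindex k (fun _ : β => Std k) e (place (youngElt k (r ∘ e) (c ∘ e)) t) := by
  have hsgn : ∀ q : Equiv.Perm β, sgn k (e.permCongr q) = sgn k q := fun q => by
    rw [sgn, Equiv.Perm.sign_permCongr, sgn]
  have hmul : ∀ p q : Equiv.Perm β, e.permCongr p * e.permCongr q = e.permCongr (p * q) :=
    fun p q => (map_mul e.permCongrHom p q).symm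
  have h : ∀ (y : MonoidAlgebra k (Equiv.Perm β)) (t : ⨂[k] _ : β, Std k),
      place y t = (placeRep k β).asAlgebraHom y t := fun _ _ => rfl
  have h' : ∀ (y : MonoidAlgebra k (Equiv.Perm α)) (t : ⨂[k] _ : α, Std k),
      place y t = (placeRep k α).asAlgebraHom y t := fun _ _ => rfl
  rw [youngElt, sum_labelStab_permCongr e]
  simp_rw [sum_labelStab_permCongr e c, hsgn, hmul]
  rw [youngElt, h, h']
  simp only [map_sum, LinearMap.sum_apply]
  refine Finset.sum_congr rfl fun p _ => Finset.sum_congr rfl fun q _ => ?_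
  exact place_single_reindex e (p * q) (sgn k q) t

variable [CharZero k]

variable (k α) in
/-- A tensor power of degree `d` is the sum of finitely many homomorphic images of Schur functors
of degree `d`. -/
theorem exists_schur_cover : ∃ S : Set (Submodule k (⨂[k] _ : α, Std k)), S.Finite ∧
    (∀ P ∈ S, ∃ (μ : YoungDiagram) (φ : (schur k μ).toSubmodule →ₗ[k] ⨂[k] _ : α, Std k),
      μ.cells.card = Fintype.card α ∧
      (∀ g v, φ ((schur k μ).toRepresentation g v) = tensorRep k α g (φ v)) ∧
      LinearMap.range φ = P) ∧ sSup S = ⊤ := by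
  obtain ⟨t, ht, h1⟩ :=
    Submodule.mem_span_finite_of_mem_span (one_mem_span_youngElt (k := k) (α := α))
  have key : ∀ z : MonoidAlgebra k (Equiv.Perm α), z ∈ youngIdealGenerators k α →
      ∃ (μ : YoungDiagram) (φ : (schur k μ).toSubmodule →ₗ[k] ⨂[k] _ : α, Std k),
      μ.cells.card = Fintype.card α ∧
      (∀ g v, φ ((schur k μ).toRepresentation g v) = tensorRep k α g (φ v)) ∧
        LinearMap.range (place z) ≤ LinearMap.range φ := by
    rintro _ ⟨μ, r, c, x, y, hT, rfl⟩
    have hbij : Function.Bijective fun a : α =>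
        (⟨(r a, c a), (YoungDiagram.mem_cells _).2 ((hT.mem_iff _ _).2 ⟨a, rfl, rfl⟩)⟩ : μ.cells) := by
      refine ⟨fun a b hab => ?_, fun b => ?_⟩
      · have := congrArg Subtype.val hab
        exact hT.inj a b (congrArg Prod.fst this) (congrArg Prod.snd this)
      · obtain ⟨⟨i, j⟩, hb⟩ := b
        obtain ⟨a, rfl, rfl⟩ := (hT.mem_iff _ _).1 ((YoungDiagram.mem_cells _).1 hb)
        exact ⟨a, rfl⟩
    let e : μ.cells ≃ α := (Equiv.ofBijective _ hbij).symm
    have he : ∀ b : μ.cells, (r (e b), c (e b)) = b.1 := fun b =>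
      congrArg Subtype.val ((Equiv.ofBijective _ hbij).apply_symm_apply b)
    have hr : r ∘ e = fun b => b.1.1 := funext fun b => congrArg Prod.fst (he b)
    have hc : c ∘ e = fun b => b.1.2 := funext fun b => congrArg Prod.snd (he b)
    refine ⟨μ, place x ∘ₗ (PiTensorProduct.reindex k (fun _ : μ.cells => Std k) e).toLinearMap ∘ₗ
      (schur k μ).toSubmodule.subtype, ?_, fun g v => ?_, ?_⟩
    · rw [← Fintype.card_congr e, Fintype.card_coe]
    · simp only [LinearMap.comp_apply, LinearEquiv.coe_coe]
      rw [tensorRep_place, tensorRep_reindex]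
      rfl
    · rintro _ ⟨t, rfl⟩
      refine ⟨⟨place (cellYoungElt k μ) ((PiTensorProduct.reindex k (fun _ : μ.cells => Std k)
        e).symm (place y t)), mem_schur_iff.2 ⟨_, rfl⟩⟩, ?_⟩
      simp only [LinearMap.comp_apply, LinearEquiv.coe_coe, Submodule.subtype_apply]
      rw [cellYoungElt, ← hr, ← hc, ← place_youngElt_reindex, LinearEquiv.apply_symm_apply,
        place_mul, place_mul]
  choose! μ φ hμ hφ hle using key
  refine ⟨(fun z => LinearMap.range (φ z)) '' t, t.finite_toSet.image _, ?_, ?_⟩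
  · rintro _ ⟨z, hz, rfl⟩
    exact ⟨μ z, φ z, hμ z (ht hz), hφ z (ht hz), rfl⟩
  · rw [eq_top_iff]
    intro v _
    have hv : place (1 : MonoidAlgebra k (Equiv.Perm α)) v = v := by
      rw [place, map_one, Module.End.one_apply]
    rw [← hv]
    have hle' : Submodule.span k (t : Set (MonoidAlgebra k (Equiv.Perm α))) ≤
        (sSup ((fun z => LinearMap.range (φ z)) '' t)).comap
          ((placeRep k α).asAlgebraHom.toLinearMap.flip v) := by
      rw [Submodule.span_le]
      intro z hz
      have h : LinearMap.range (φ z) ≤ sSup ((fun z => LinearMap.range (φ z)) '' t) :=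
        le_sSup ⟨z, hz, rfl⟩
      exact h (hle z (ht hz) ⟨v, rfl⟩)
    exact hle' h1

variable (k α) in
theorem isSchurGenerated_tensorRep : IsSchurGenerated (tensorRep k α) := by
  obtain ⟨S, hS1, hS2, hS3⟩ := exists_schur_cover k α
  refine ⟨S, hS1, fun P hP => ?_, hS3⟩
  obtain ⟨μ, φ, -, h⟩ := hS2 P hP
  exact ⟨μ, φ, h⟩

end TensorSchur

section Insertion

variable {k : Type*} [Field k] {α : Type*} [Fintype α] [DecidableEq α] {n : ℕ}

theorem stdRep_shiftEmb_shiftIn (g : GLInf k) (v : Std k) :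
    stdRep k (shiftEmb n g) (shiftIn n v) = shiftIn n (stdRep k g v) := by
  change blockEquiv n g.1 (shiftIn n v) = shiftIn n (g.1 v)
  rw [blockEquiv_apply, shiftOut_shiftIn, map_sub, add_sub_cancel]

theorem shiftOut_single_of_lt {i : ℕ} (h : i < n) : shiftOut n (Finsupp.single i (1 : k)) = 0 := by
  ext j
  rw [shiftOut_apply, Finsupp.single_eq_of_ne (by omega), Finsupp.zero_apply]

theorem stdRep_shiftEmb_single (g : GLInf k) {i : ℕ} (h : i < n) :
    stdRep k (shiftEmb n g) (Finsupp.single i 1) = Finsupp.single i 1 := by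
  change blockEquiv n g.1 _ = _
  rw [blockEquiv_apply, shiftOut_single_of_lt h, map_zero, sub_zero, map_zero, add_zero]

/-- The letter `e_i` with `i < n` prescribed by a partial filling, at the places where it is
defined. -/
def prescribedLetter (κ : α → Option (Fin n)) (j : α) : Std k :=
  (κ j).elim 0 fun i => Finsupp.single (i : ℕ) 1

/-- The map of tensor powers that inserts the letters `e_i`, `i < n`, prescribed by a partial
filling, and shifts the remaining letters by `n`. -/
def insertion (κ : α → Option (Fin n)) :
    (⨂[k] _ : {j // κ j = none}, Std k) →ₗ[k] ⨂[k] _ : α, Std k :=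
  PiTensorProduct.lift (((PiTensorProduct.tprod k).domDomRestrict (fun j => κ j = none)
    fun j => prescribedLetter κ j.1).compLinearMap fun _ => shiftIn n)

theorem insertion_tprod (κ : α → Option (Fin n)) (v : {j // κ j = none} → Std k) :
    insertion κ (PiTensorProduct.tprod k v) = PiTensorProduct.tprod k fun j =>
      if h : κ j = none then shiftIn n (v ⟨j, h⟩) else prescribedLetter κ j := by
  rw [insertion, PiTensorProduct.lift.tprod]
  rfl

theorem insertion_equivariant (κ : α → Option (Fin n)) (g : GLInf k)
    (t : ⨂[k] _ : {j // κ j = none}, Std k) :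
    insertion κ (tensorRep k _ g t) = shift n (tensorRep k α) g (insertion κ t) := by
  have h : insertion κ ∘ₗ tensorRep k _ g = shift n (tensorRep k α) g ∘ₗ insertion κ := by
    refine PiTensorProduct.ext (MultilinearMap.ext fun v => ?_)
    simp only [LinearMap.compMultilinearMap_apply, LinearMap.comp_apply]
    rw [tensorRep_tprod, insertion_tprod, insertion_tprod]
    change _ = tensorRep k α (shiftEmb n g) _
    rw [tensorRep_tprod]
    congr 1
    ext1 j
    by_cases hj : κ j = none
    · rw [dif_pos hj, dif_pos hj, stdRep_shiftEmb_shiftIn]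
    · rw [dif_neg hj, dif_neg hj]
      obtain ⟨i, hi⟩ := Option.ne_none_iff_exists'.1 hj
      rw [prescribedLetter, hi, Option.elim_some, stdRep_shiftEmb_single g i.2]
  exact LinearMap.congr_fun h t

variable (n) in
/-- The places of a basis tensor that carry one of the letters `e_i` with `i < n`. -/
def smallLetters (p : α → ℕ) (j : α) : Option (Fin n) :=
  if h : p j < n then some ⟨p j, h⟩ else none

theorem smallLetters_eq_none {p : α → ℕ} {j : α} : smallLetters n p j = none ↔ n ≤ p j := by
  rw [smallLetters]
  split_ifs with h <;> simp [h]
  omega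

theorem insertion_smallLetters (p : α → ℕ) :
    insertion (smallLetters n p) (basisTensor k fun j => p j.1 - n) = basisTensor k p := by
  rw [basisTensor, insertion_tprod, basisTensor]
  congr 1
  ext1 j
  by_cases hj : smallLetters n p j = none
  · rw [dif_pos hj]
    have := smallLetters_eq_none.1 hj
    change Finsupp.mapDomain _ (Finsupp.single _ _) = _
    rw [Finsupp.mapDomain_single, Nat.add_sub_cancel' this]
  · rw [dif_neg hj, prescribedLetter, smallLetters, dif_pos]
    · rfl
    · by_contra h
      exact hj (smallLetters_eq_none.2 (not_lt.1 h))

theorem iSup_range_insertion :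
    ⨆ κ : α → Option (Fin n), LinearMap.range (insertion (k := k) κ) = ⊤ := by
  rw [eq_top_iff, ← span_basisTensor, Submodule.span_le]
  rintro _ ⟨p, rfl⟩
  rw [← insertion_smallLetters (n := n) p]
  exact Submodule.mem_iSup_of_mem (smallLetters n p) ⟨_, rfl⟩

variable (k α n) in
theorem isSchurGenerated_shift_tensorRep [CharZero k] :
    IsSchurGenerated (shift n (tensorRep k α) : Representation k (GLInf k) _) :=
  IsSchurGenerated.of_iSup (ι := α → Option (Fin n))
    (fun κ => isSchurGenerated_tensorRep k {j // κ j = none}) insertion insertion_equivariant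
    iSup_range_insertion

end Insertion

/-! ### Elements of polynomial representations -/

section Polynomial

variable {k : Type*} [Field k]

/-- The subspace spanned by the images of the tensor powers `V^{⊗ d}` under equivariant maps. -/
def tensorImages {M : Type*} [AddCommMonoid M] [Module k M]
    (ρ : Representation k (GLInf k) M) : Submodule k M :=
  Submodule.span k {y | ∃ (d : ℕ) (θ : (⨂[k] _ : Fin d, Std k) →ₗ[k] M),
    (∀ g t, θ (tensorRep k (Fin d) g t) = ρ g (θ t)) ∧ y ∈ LinearMap.range θ}

/-- Polynomial representations are homomorphic images of sums of tensor powers, since sums of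
tensor powers are completely reducible. -/
theorem IsPolynomial.mem_tensorImages {k : Type u} [Field k] [CharZero k] {M : Type v}
    [AddCommMonoid M] [Module k M] {ρ : Representation k (GLInf k) M} (hρ : IsPolynomial ρ) (m : M) :
    m ∈ tensorImages ρ := by
  classical
  obtain ⟨ι, d, W, φ, hφ⟩ := hρ
  let τ := Representation.directSum fun i => tensorRep k (Fin (d i))
  let lof : ∀ i, (⨂[k] _ : Fin (d i), Std k) →ₗ[k] ⨁ i, ⨂[k] _ : Fin (d i), Std k :=
    fun i => DirectSum.lof k ι (fun i => ⨂[k] _ : Fin (d i), Std k) i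
  have hlof : ∀ i g t, lof i (tensorRep k (Fin (d i)) g t) = τ g (lof i t) := fun i g t =>
    (DirectSum.lmap_lof (fun i => tensorRep k (Fin (d i)) g) i t).symm
  have hss : IsSemisimpleModule (MonoidAlgebra k (GLInf k)) τ.asModule := by
    have hi := fun i => (isSchurGenerated_tensorRep k (Fin (d i))).isSemisimpleModule
    let P : Submodule (MonoidAlgebra k (GLInf k)) τ.asModule :=
      ⨆ i, LinearMap.range (asModuleHom (lof i) (hlof i))
    refine isSemisimpleModule_of_isSemisimpleModule_submodule'
      (p := fun i => LinearMap.range (asModuleHom (lof i) (hlof i)))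
      (fun i => IsSemisimpleModule.range _) ?_
    have key : ∀ w : ⨁ i, ⨂[k] _ : Fin (d i), Std k, τ.asModuleEquiv.symm w ∈ P := fun w => by
      induction w using DirectSum.induction_on with
      | zero => exact P.zero_mem
      | of i t => exact Submodule.mem_iSup_of_mem i ⟨t, rfl⟩
      | add x y hx hy => exact P.add_mem hx hy
    exact eq_top_iff.2 fun w _ => key w
  let inc : W.toSubmodule →ₗ[k] ⨁ i, ⨂[k] _ : Fin (d i), Std k := W.toSubmodule.subtype
  let f := asModuleHom (ρ := W.toRepresentation) (σ := τ) inc fun _ _ => rfl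
  obtain ⟨h, hh⟩ := IsSemisimpleModule.extension_property f Subtype.val_injective
    (asModuleHom (ρ := W.toRepresentation) (σ := ρ) φ.toLinearMap fun g v =>
      LinearMap.congr_fun (φ.isIntertwining' g) v)
  obtain ⟨w, rfl⟩ := hφ m
  have h1 : φ w = ofModuleHom h w.1 := (LinearMap.congr_fun hh w).symm
  rw [h1]
  generalize w.1 = x
  induction x using DirectSum.induction_on with
  | zero => rw [map_zero]; exact Submodule.zero_mem _
  | of i t =>
    refine Submodule.subset_span ⟨d i, ofModuleHom h ∘ₗ lof i, fun g t => ?_, t, rfl⟩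
    rw [LinearMap.comp_apply, hlof, ofModuleHom_equivariant]
    rfl
  | add x y hx hy => rw [map_add]; exact Submodule.add_mem _ hx hy

theorem tensorImages_map_le {M M' : Type*} [AddCommMonoid M] [Module k M] [AddCommMonoid M']
    [Module k M'] {ρ : Representation k (GLInf k) M} {ρ' : Representation k (GLInf k) M'}
    (f : M →ₗ[k] M') (hf : ∀ g m, f (ρ g m) = ρ' g (f m)) :
    (tensorImages ρ).map f ≤ tensorImages ρ' := by
  rw [tensorImages, Submodule.map_span_le]
  rintro _ ⟨d, θ, hθ, t, rfl⟩
  refine Submodule.subset_span ⟨d, f ∘ₗ θ, fun g t => ?_, t, rfl⟩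
  rw [LinearMap.comp_apply, hθ, hf]
  rfl

theorem IsPolynomialElement.mem_tensorImages [CharZero k] {M : Type*} [AddCommMonoid M]
    [Module k M] {ρ : Representation k (GLInf k) M} {m : M} (hm : IsPolynomialElement ρ m) :
    m ∈ tensorImages ρ :=
  tensorImages_map_le (ρ := (generatedBy ρ m).toRepresentation)
    (generatedBy ρ m).toSubmodule.subtype (fun _ _ => rfl)
    ⟨⟨m, self_mem_generatedBy m⟩, IsPolynomial.mem_tensorImages hm _, rfl⟩

end Polynomial

/-! ### Iterated shifts -/

section IteratedShift

variable {k : Type*} [Field k]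

theorem shiftIn_add (n m : ℕ) (v : Std k) : shiftIn (n + m) v = shiftIn n (shiftIn m v) := by
  change Finsupp.mapDomain _ v = Finsupp.mapDomain _ (Finsupp.mapDomain _ v)
  rw [← Finsupp.mapDomain_comp]
  congr 1
  ext1 i
  exact add_assoc n m i

theorem shiftOut_add (n m : ℕ) (v : Std k) : shiftOut (n + m) v = shiftOut m (shiftOut n v) := by
  ext j
  rw [shiftOut_apply, shiftOut_apply, shiftOut_apply, add_assoc]

theorem shiftEmb_shiftEmb (n m : ℕ) (g : GLInf k) :
    shiftEmb n (shiftEmb m g) = shiftEmb (n + m) g := by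
  ext1; ext1 v
  change blockEquiv n (blockEquiv m g.1) v = blockEquiv (n + m) g.1 v
  rw [blockEquiv_apply, blockEquiv_apply, blockEquiv_apply, shiftIn_add, shiftOut_add,
    add_sub_cancel_left]

theorem shift_shift {H : Type*} [Monoid H] (n m : ℕ) (ρ : GLInf k →* H) :
    shift m (shift n ρ) = shift (n + m) ρ :=
  MonoidHom.ext fun g => congrArg ρ (shiftEmb_shiftEmb n m g)

theorem isShear_shift (n : ℕ) {D : Std k →ₗ[k] Std k} (hD : IsShear D) :
    IsShear (shiftIn n ∘ₗ D ∘ₗ shiftOut n) := by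
  obtain ⟨h, m, h1, h2⟩ := hD
  refine ⟨fun v => ?_, n + m, fun i hi => ?_, fun v j hj => ?_⟩
  · simp only [LinearMap.comp_apply]
    rw [shiftOut_shiftIn, h, map_zero]
  · obtain ⟨i, rfl⟩ := Nat.exists_eq_add_of_le (le_trans (Nat.le_add_right n m) hi)
    simp only [LinearMap.comp_apply]
    rw [shiftOut_single_add, h1 i (by omega), map_zero]
  · obtain ⟨j, rfl⟩ := Nat.exists_eq_add_of_le (le_trans (Nat.le_add_right n m) hj)
    simp only [LinearMap.comp_apply]
    rw [shiftIn_apply_add, h2 _ j (by omega)]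

theorem shiftEmb_shear (n : ℕ) {D : Std k →ₗ[k] Std k} (hD : IsShear D) (s : k) :
    shiftEmb n (shear D hD s) = shear _ (isShear_shift n hD) s := by
  ext1; ext1 v
  change blockEquiv n (shear D hD s).1 v = v + s • shiftIn n (D (shiftOut n v))
  rw [blockEquiv_apply]
  change v + shiftIn n (shiftOut n v + s • D (shiftOut n v) - shiftOut n v) = _
  rw [add_sub_cancel_left, map_smul]

end IteratedShift

/-! ### Elements that depend polynomially on shears -/

section PolynomialFunctions

variable {k : Type*} [Field k] {M : Type*} [AddCommGroup M] [Module k M]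

/-- A function on the ground field with values in a vector space is polynomial if it has the form
`s ↦ ∑ s^l c_l`. -/
def IsPolyFun (F : k → M) : Prop :=
  ∃ c : ℕ →₀ M, ∀ s, F s = c.sum fun l m => s ^ l • m

theorem isPolyFun_pow_smul (l : ℕ) (m : M) : IsPolyFun fun s : k => s ^ l • m :=
  ⟨Finsupp.single l m, fun s =>
    (Finsupp.sum_single_index (h := fun l (m : M) => s ^ l • m) (smul_zero _)).symm⟩

theorem isPolyFun_const (m : M) : IsPolyFun fun _ : k => m := by
  simpa using isPolyFun_pow_smul (k := k) 0 m

theorem IsPolyFun.add {F G : k → M} (hF : IsPolyFun F) (hG : IsPolyFun G) :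
    IsPolyFun fun s => F s + G s := by
  obtain ⟨c, hc⟩ := hF
  obtain ⟨c', hc'⟩ := hG
  refine ⟨c + c', fun s => ?_⟩
  change F s + G s = _
  rw [Finsupp.sum_add_index' (fun _ => smul_zero _) (fun _ _ _ => smul_add _ _ _), hc, hc']

theorem IsPolyFun.sum {ι : Type*} (t : Finset ι) {F : ι → k → M} (hF : ∀ i ∈ t, IsPolyFun (F i)) :
    IsPolyFun fun s => ∑ i ∈ t, F i s := by
  classical
  induction t using Finset.induction_on with
  | empty => simpa using isPolyFun_const (k := k) (0 : M)
  | insert i t hi ih =>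
    simp only [Finset.sum_insert hi]
    exact (hF i (Finset.mem_insert_self _ _)).add (ih fun j hj => hF j (Finset.mem_insert_of_mem hj))

theorem IsPolyFun.comp_linearMap {M' : Type*} [AddCommGroup M'] [Module k M'] {F : k → M}
    (hF : IsPolyFun F) (f : M →ₗ[k] M') : IsPolyFun fun s => f (F s) := by
  obtain ⟨c, hc⟩ := hF
  simp only [hc, Finsupp.sum, map_sum, map_smul]
  exact IsPolyFun.sum _ fun l _ => isPolyFun_pow_smul l _

theorem IsPolyFun.mul {A : Type*} [CommRing A] [Algebra k A] {F G : k → A} (hF : IsPolyFun F)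
    (hG : IsPolyFun G) : IsPolyFun fun s => F s * G s := by
  obtain ⟨c, hc⟩ := hF
  obtain ⟨c', hc'⟩ := hG
  simp only [hc, hc', Finsupp.sum, Finset.sum_mul_sum, smul_mul_smul_comm, ← pow_add]
  exact IsPolyFun.sum _ fun l _ => IsPolyFun.sum _ fun l' _ => isPolyFun_pow_smul (l + l') _

/-- A polynomial function with values in a subspace away from `0` has its value at `0` in the
subspace, since the ground field is infinite. -/
theorem IsPolyFun.apply_zero_mem [Infinite k] {F : k → M} (hF : IsPolyFun F) (L : Submodule k M)
    (h : ∀ s, s ≠ 0 → F s ∈ L) : F 0 ∈ L := by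
  rw [← Submodule.Quotient.mk_eq_zero, ← Module.forall_dual_apply_eq_zero_iff k]
  intro φ
  obtain ⟨c, hc⟩ := hF.comp_linearMap (φ ∘ₗ L.mkQ)
  let p : Polynomial k := c.sum fun l a => Polynomial.monomial l a
  have hp : ∀ s, p.eval s = (φ ∘ₗ L.mkQ) (F s) := fun s => by
    refine Eq.trans ?_ (hc s).symm
    simp only [p, Finsupp.sum, Polynomial.eval_finsetSum, Polynomial.eval_monomial, smul_eq_mul,
      mul_comm]
  have hp0 : p = 0 := by
    refine Polynomial.eq_zero_of_infinite_isRoot p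
      ((Set.finite_singleton (0 : k)).infinite_compl.mono fun s hs => ?_)
    change p.eval s = 0
    rw [hp, LinearMap.comp_apply, Submodule.mkQ_apply,
      (Submodule.Quotient.mk_eq_zero L).2 (h s hs), map_zero]
  have := hp 0
  rw [hp0, Polynomial.eval_zero] at this
  exact this.symm

end PolynomialFunctions

section Good

variable {k : Type*} [Field k]

/-- An element of a representation is good if it is fixed by some `G(n) ⊆ GL` and if its
translates by the shears `1 + s D` depend polynomially on `s`. -/
structure IsGood {M : Type*} [AddCommGroup M] [Module k M] (ρ : Representation k (GLInf k) M)
    (m : M) : Prop where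
  fixed : ∃ n, ∀ g, ρ (shiftEmb n g) m = m
  poly : ∀ (D : Std k →ₗ[k] Std k) (hD : IsShear D), IsPolyFun fun s => ρ (shear D hD s) m

section

variable {M : Type*} [AddCommGroup M] [Module k M] {ρ : Representation k (GLInf k) M} {m m' : M}

theorem fixed_of_le {n n' : ℕ} (h : ∀ g, ρ (shiftEmb n g) m = m) (hn : n ≤ n') (g : GLInf k) :
    ρ (shiftEmb n' g) m = m := by
  obtain ⟨j, rfl⟩ := Nat.exists_eq_add_of_le hn
  rw [← shiftEmb_shiftEmb, h]

theorem IsGood.add (h : IsGood ρ m) (h' : IsGood ρ m') : IsGood ρ (m + m') := by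
  refine ⟨?_, fun D hD => ?_⟩
  · obtain ⟨n, hn⟩ := h.fixed
    obtain ⟨n', hn'⟩ := h'.fixed
    exact ⟨max n n', fun g => by
      rw [map_add, fixed_of_le hn (le_max_left _ _), fixed_of_le hn' (le_max_right _ _)]⟩
  · simp only [map_add]
    exact (h.poly D hD).add (h'.poly D hD)

theorem IsGood.map {M' : Type*} [AddCommGroup M'] [Module k M'] {ρ' : Representation k (GLInf k) M'}
    (h : IsGood ρ m) (f : M →ₗ[k] M') (hf : ∀ g m, f (ρ g m) = ρ' g (f m)) : IsGood ρ' (f m) := by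
  refine ⟨?_, fun D hD => ?_⟩
  · obtain ⟨n, hn⟩ := h.fixed
    exact ⟨n, fun g => by rw [← hf, hn]⟩
  · simp only [← hf]
    exact (h.poly D hD).comp_linearMap f

theorem IsGood.smul (h : IsGood ρ m) (a : k) : IsGood ρ (a • m) :=
  h.map (a • LinearMap.id) fun g m => (map_smul (ρ g) a m).symm

theorem isGood_of_fixed (h : ∀ g, ρ g m = m) : IsGood ρ m :=
  ⟨⟨0, fun g => h _⟩, fun D hD => by simp only [h]; exact isPolyFun_const m⟩

theorem IsGood.shift (h : IsGood ρ m) (n : ℕ) : IsGood (shift n ρ) m := by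
  refine ⟨?_, fun D hD => ?_⟩
  · obtain ⟨N, hN⟩ := h.fixed
    refine ⟨N, fun g => ?_⟩
    change ρ (shiftEmb n (shiftEmb N g)) m = m
    rw [shiftEmb_shiftEmb, fixed_of_le hN (Nat.le_add_left N n)]
  · refine (congrArg IsPolyFun (funext fun s => ?_)).mp (h.poly _ (isShear_shift n hD))
    rw [← shiftEmb_shear]
    rfl

end

theorem IsGood.mul {A : Type*} [CommRing A] [Algebra k A] {ρ : GLInf k →* (A ≃ₐ[k] A)} {a b : A}
    (ha : IsGood (algRep ρ) a) (hb : IsGood (algRep ρ) b) : IsGood (algRep ρ) (a * b) := by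
  have hmul : ∀ g, algRep ρ g (a * b) = algRep ρ g a * algRep ρ g b := fun g => map_mul (ρ g) a b
  refine ⟨?_, fun D hD => ?_⟩
  · obtain ⟨n, hn⟩ := ha.fixed
    obtain ⟨n', hn'⟩ := hb.fixed
    exact ⟨max n n', fun g => by
      rw [hmul, fixed_of_le hn (le_max_left _ _), fixed_of_le hn' (le_max_right _ _)]⟩
  · simp only [hmul]
    exact (ha.poly D hD).mul (hb.poly D hD)

variable {α : Type*} [Fintype α] [DecidableEq α]

/-- Homomorphic images of tensor powers consist of good elements. -/
theorem isGood_of_mem_range {M : Type*} [AddCommGroup M] [Module k M]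
    {ρ : Representation k (GLInf k) M} (θ : (⨂[k] _ : α, Std k) →ₗ[k] M)
    (hθ : ∀ g t, θ (tensorRep k α g t) = ρ g (θ t)) (t : ⨂[k] _ : α, Std k) : IsGood ρ (θ t) := by
  have ht : t ∈ Submodule.span k (Set.range (basisTensor k : (α → ℕ) → _)) :=
    by rw [span_basisTensor]; exact Submodule.mem_top
  induction ht using Submodule.span_induction with
  | mem t ht =>
    obtain ⟨p, rfl⟩ := ht
    refine ⟨?_, fun D hD => ?_⟩
    · obtain ⟨n, hn⟩ := exists_bound p
      refine ⟨n, fun g => ?_⟩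
      rw [← hθ, basisTensor, tensorRep_tprod]
      simp only [stdRep_shiftEmb_single g (hn _)]
    · simp only [← hθ, basisTensor, tensorRep_tprod, stdRep_shear]
      have h : ∀ s : k, θ (PiTensorProduct.tprod k fun i =>
          Finsupp.single (p i) (1 : k) + s • D (Finsupp.single (p i) 1)) =
          ∑ T : Finset α, s ^ (Finset.univ.filter fun i => i ∉ T).card •
            θ (PiTensorProduct.tprod k (T.piecewise (fun i => Finsupp.single (p i) (1 : k))
              fun i => D (Finsupp.single (p i) 1))) := fun s => by
        have h1 := (PiTensorProduct.tprod k).map_add_univ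
          (fun i => Finsupp.single (p i) (1 : k)) (fun i => s • D (Finsupp.single (p i) 1))
        refine (congrArg θ h1).trans ?_
        rw [map_sum]
        refine Finset.sum_congr rfl fun T _ => ?_
        have h2 : T.piecewise (fun i => Finsupp.single (p i) (1 : k))
            (fun i => s • D (Finsupp.single (p i) 1)) = fun i => (if i ∈ T then (1 : k) else s) •
            T.piecewise (fun i => Finsupp.single (p i) (1 : k))
              (fun i => D (Finsupp.single (p i) 1)) i := by
          ext1 i
          by_cases hi : i ∈ T
          · simp [hi]
          · simp [hi]
        rw [h2, MultilinearMap.map_smul_univ, Finset.prod_ite, Finset.prod_const_one,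
          Finset.prod_const, one_mul, map_smul]
      simp only [h]
      exact IsPolyFun.sum _ fun T _ => isPolyFun_pow_smul _ _
  | zero => rw [map_zero]; exact isGood_of_fixed fun g => map_zero _
  | add t t' _ _ ht ht' => rw [map_add]; exact ht.add ht'
  | smul a t _ ht => rw [map_smul]; exact ht.smul a

theorem isGood_of_mem_tensorImages {M : Type*} [AddCommGroup M] [Module k M]
    {ρ : Representation k (GLInf k) M} {m : M} (hm : m ∈ tensorImages ρ) : IsGood ρ m := by
  induction hm using Submodule.span_induction with
  | mem y hy =>
    obtain ⟨d, θ, hθ, t, rfl⟩ := hy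
    exact isGood_of_mem_range (α := Fin d) θ hθ t
  | zero => exact isGood_of_fixed fun g => map_zero _
  | add t t' _ _ ht ht' => exact ht.add ht'
  | smul a t _ ht => exact ht.smul a

/-- An action on an algebra is tame if all elements are fractions of good elements, in the sense
that each element has a good multiple with a non-zero good factor. -/
def IsTame {A : Type*} [CommRing A] [Algebra k A] (ρ : GLInf k →* (A ≃ₐ[k] A)) : Prop :=
  ∀ a : A, ∃ b : A, b ≠ 0 ∧ IsGood (algRep ρ) b ∧ IsGood (algRep ρ) (b * a)

theorem IsTame.shift {A : Type*} [CommRing A] [Algebra k A] {ρ : GLInf k →* (A ≃ₐ[k] A)}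
    (h : IsTame ρ) (n : ℕ) : IsTame (PolyGL.shift n ρ) := fun a => by
  obtain ⟨b, hb, h1, h2⟩ := h a
  exact ⟨b, hb, h1.shift n, h2.shift n⟩

theorem IsTame.exists_mul {A : Type*} [CommRing A] [IsDomain A] [Algebra k A]
    {ρ : GLInf k →* (A ≃ₐ[k] A)} (h : IsTame ρ) (s : Finset A) :
    ∃ b : A, b ≠ 0 ∧ IsGood (algRep ρ) b ∧ ∀ a ∈ s, IsGood (algRep ρ) (b * a) := by
  classical
  induction s using Finset.induction_on with
  | empty =>
    obtain ⟨b, hb, h1, -⟩ := h 0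
    exact ⟨b, hb, h1, fun a ha => absurd ha (Finset.notMem_empty a)⟩
  | insert a s _ ih =>
    obtain ⟨b, hb, h1, h2⟩ := ih
    obtain ⟨b', hb', h1', h2'⟩ := h a
    refine ⟨b * b', mul_ne_zero hb hb', h1.mul h1', fun x hx => ?_⟩
    rcases Finset.mem_insert.1 hx with rfl | hx
    · rw [mul_assoc]
      exact h1.mul h2'
    · rw [mul_right_comm]
      exact (h2 x hx).mul h1'

theorem IsGLAlgebra.isTame [CharZero k] {A : Type*} [CommRing A] [Nontrivial A] [Algebra k A]
    {ρ : GLInf k →* (A ≃ₐ[k] A)} (h : IsGLAlgebra ρ) : IsTame ρ := fun a =>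
  ⟨1, one_ne_zero, isGood_of_fixed fun g => map_one (ρ g), by
    rw [one_mul]
    exact isGood_of_mem_tensorImages (IsPolynomial.mem_tensorImages h a)⟩

theorem IsGLField.isTame [CharZero k] {K : Type*} [Field K] [Algebra k K]
    {ρ : GLInf k →* (K ≃ₐ[k] K)} (h : IsGLField ρ) : IsTame ρ := fun x => by
  obtain ⟨a, b, ha, hb, hb0, rfl⟩ := h x
  refine ⟨b, hb0, isGood_of_mem_tensorImages hb.mem_tensorImages, ?_⟩
  rw [mul_div_cancel₀ _ hb0]
  exact isGood_of_mem_tensorImages ha.mem_tensorImages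

end Good

/-! ### Shearing tensors into the shifted subspace -/

section ShiftTensor

variable {k : Type*} [Field k]

/-- The map with `e_i ↦ e_{n+i}` for `i < n` and `e_i ↦ 0` for `i ≥ n`. -/
def upShift (n : ℕ) : Std k →ₗ[k] Std k :=
  shiftIn n ∘ₗ (LinearMap.id - shiftIn n ∘ₗ shiftOut n)

theorem upShift_apply (n : ℕ) (v : Std k) :
    upShift n v = shiftIn n (v - shiftIn n (shiftOut n v)) := rfl

theorem shiftIn_single (n i : ℕ) :
    shiftIn n (Finsupp.single i (1 : k)) = Finsupp.single (n + i) 1 :=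
  Finsupp.mapDomain_single

theorem upShift_single {n i : ℕ} (h : i < n) :
    upShift n (Finsupp.single i (1 : k)) = Finsupp.single (n + i) 1 := by
  rw [upShift_apply, shiftOut_single_of_lt h, map_zero, sub_zero, shiftIn_single]

theorem isShear_upShift (n : ℕ) : IsShear (upShift (k := k) n) := by
  refine isShear_of_bounds (n := n) (m := n + n) (fun i hi => ?_) (fun v j hj => ?_)
    fun v j hj => ?_
  · obtain ⟨i, rfl⟩ := Nat.exists_eq_add_of_le hi
    rw [upShift_apply, shiftOut_single_add, shiftIn_single, sub_self, map_zero]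
  · rw [upShift_apply]
    refine Finsupp.mapDomain_of_notMem_range _ _ fun h => ?_
    obtain ⟨i, rfl⟩ := h
    exact absurd hj (Nat.not_lt.2 (Nat.le_add_right n i))
  · obtain ⟨i, rfl⟩ := Nat.exists_eq_add_of_le hj
    rw [upShift_apply, add_assoc, shiftIn_apply_add, Finsupp.sub_apply, shiftIn_apply_add,
      shiftOut_apply, sub_self]

variable {α : Type*} [Fintype α] [DecidableEq α]

/-- The map on tensor powers induced by `e_i ↦ e_{n+i}`. -/
def shiftTensor (n : ℕ) : (⨂[k] _ : α, Std k) →ₗ[k] ⨂[k] _ : α, Std k :=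
  PiTensorProduct.map fun _ => shiftIn n

theorem shiftTensor_basisTensor (n : ℕ) (p : α → ℕ) :
    shiftTensor n (basisTensor k p) = basisTensor k fun i => n + p i := by
  rw [shiftTensor, basisTensor, PiTensorProduct.map_tprod]
  simp only [shiftIn_single]
  rfl

theorem shiftTensor_equivariant (n : ℕ) (g : GLInf k) (t : ⨂[k] _ : α, Std k) :
    shiftTensor n (tensorRep k α g t) = tensorRep k α (shiftEmb n g) (shiftTensor n t) := by
  have h : shiftTensor n ∘ₗ tensorRep k α g =
      tensorRep k α (shiftEmb n g) ∘ₗ (shiftTensor n : (⨂[k] _ : α, Std k) →ₗ[k] _) := by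
    refine PiTensorProduct.ext (MultilinearMap.ext fun v => ?_)
    simp only [LinearMap.compMultilinearMap_apply, LinearMap.comp_apply]
    rw [tensorRep_tprod, shiftTensor, PiTensorProduct.map_tprod, PiTensorProduct.map_tprod,
      tensorRep_tprod]
    simp only [stdRep_shiftEmb_shiftIn]
  exact LinearMap.congr_fun h t

variable (k α) in
/-- The span of the basis tensors that contain a letter `e_i` with `i < n`. -/
def lowTensors (n : ℕ) : Submodule k (⨂[k] _ : α, Std k) :=
  Submodule.span k {t | ∃ p : α → ℕ, (∃ j, p j < n) ∧ basisTensor k p = t}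

variable (k α) in
/-- The span of the basis tensors in the letters `e_i` with `i < n`. -/
def boundedTensors (n : ℕ) : Submodule k (⨂[k] _ : α, Std k) :=
  Submodule.span k {t | ∃ p : α → ℕ, (∀ j, p j < n) ∧ basisTensor k p = t}

theorem boundedTensors_mono {n m : ℕ} (h : n ≤ m) : boundedTensors k α n ≤ boundedTensors k α m :=
  Submodule.span_mono fun _ ⟨p, hp, ht⟩ => ⟨p, fun j => (hp j).trans_le h, ht⟩

theorem exists_mem_boundedTensors (t : ⨂[k] _ : α, Std k) : ∃ n, t ∈ boundedTensors k α n := by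
  have ht : t ∈ Submodule.span k (Set.range (basisTensor k : (α → ℕ) → _)) := by
    rw [span_basisTensor]; exact Submodule.mem_top
  induction ht using Submodule.span_induction with
  | mem t ht =>
    obtain ⟨p, rfl⟩ := ht
    obtain ⟨n, hn⟩ := exists_bound p
    exact ⟨n, Submodule.subset_span ⟨p, hn, rfl⟩⟩
  | zero => exact ⟨0, Submodule.zero_mem _⟩
  | add t t' _ _ ht ht' =>
    obtain ⟨n, hn⟩ := ht
    obtain ⟨n', hn'⟩ := ht'
    exact ⟨max n n', Submodule.add_mem _ (boundedTensors_mono (le_max_left _ _) hn)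
      (boundedTensors_mono (le_max_right _ _) hn')⟩
  | smul a t _ ht =>
    obtain ⟨n, hn⟩ := ht
    exact ⟨n, Submodule.smul_mem _ a hn⟩

theorem exists_add_shiftTensor (n : ℕ) (t : ⨂[k] _ : α, Std k) :
    ∃ l ∈ lowTensors k α n, ∃ t', t = l + shiftTensor n t' := by
  have ht : t ∈ Submodule.span k (Set.range (basisTensor k : (α → ℕ) → _)) := by
    rw [span_basisTensor]; exact Submodule.mem_top
  induction ht using Submodule.span_induction with
  | mem t ht =>
    obtain ⟨p, rfl⟩ := ht
    by_cases hp : ∃ j, p j < n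
    · exact ⟨_, Submodule.subset_span ⟨p, hp, rfl⟩, 0, by rw [map_zero, add_zero]⟩
    · refine ⟨0, Submodule.zero_mem _, basisTensor k fun i => p i - n, ?_⟩
      rw [zero_add, shiftTensor_basisTensor]
      congr 1
      ext1 i
      have : ¬p i < n := fun h => hp ⟨i, h⟩
      omega
  | zero => exact ⟨0, Submodule.zero_mem _, 0, by rw [map_zero, add_zero]⟩
  | add t t' _ _ ht ht' =>
    obtain ⟨l, hl, x, rfl⟩ := ht
    obtain ⟨l', hl', x', rfl⟩ := ht'
    exact ⟨l + l', Submodule.add_mem _ hl hl', x + x', by rw [map_add, add_add_add_comm]⟩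
  | smul a t _ ht =>
    obtain ⟨l, hl, x, rfl⟩ := ht
    exact ⟨a • l, Submodule.smul_mem _ a hl, a • x, by rw [map_smul, smul_add]⟩

/-- On tensors of degree `d` in the letters `e_i` with `i < n`, the shear by `s` along
`e_i ↦ e_{n+i}` is `s^d` times the shift, up to tensors that contain a letter `e_i` with
`i < n`. -/
theorem exists_shear_eq {n : ℕ} {t : ⨂[k] _ : α, Std k} (ht : t ∈ boundedTensors k α n) (s : k) :
    ∃ l ∈ lowTensors k α n, tensorRep k α (shear _ (isShear_upShift n) s) t =
      s ^ Fintype.card α • shiftTensor n t + l := by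
  induction ht using Submodule.span_induction with
  | mem t ht =>
    obtain ⟨p, hp, rfl⟩ := ht
    have h1 : tensorRep k α (shear _ (isShear_upShift n) s) (basisTensor k p) =
        ∑ T : Finset α, (∏ i, if i ∈ T then (1 : k) else s) •
          basisTensor k (T.piecewise p fun i => n + p i) := by
      rw [basisTensor, tensorRep_tprod]
      simp only [stdRep_shear, upShift_single (hp _)]
      refine ((PiTensorProduct.tprod k).map_add_univ (fun i => Finsupp.single (p i) (1 : k))
        (fun i => s • Finsupp.single (n + p i) 1)).trans (Finset.sum_congr rfl fun T _ => ?_)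
      rw [basisTensor, ← MultilinearMap.map_smul_univ]
      congr 1
      ext1 i
      by_cases hi : i ∈ T
      · simp [hi]
      · simp [hi]
    rw [h1, ← Finset.add_sum_erase _ _ (Finset.mem_univ ∅)]
    refine ⟨∑ T ∈ Finset.univ.erase (∅ : Finset α), (∏ i, if i ∈ T then (1 : k) else s) •
      basisTensor k (T.piecewise p fun i => n + p i), Submodule.sum_mem _ fun T hT =>
        Submodule.smul_mem _ _ (Submodule.subset_span ⟨_, ?_, rfl⟩), ?_⟩
    · obtain ⟨j, hj⟩ := Finset.nonempty_iff_ne_empty.2 (Finset.ne_of_mem_erase hT)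
      exact ⟨j, by rw [Finset.piecewise_eq_of_mem _ _ _ hj]; exact hp j⟩
    · congr 1
      rw [shiftTensor_basisTensor, Finset.piecewise_empty]
      simp
  | zero => exact ⟨0, Submodule.zero_mem _, by simp⟩
  | add t t' _ _ ht ht' =>
    obtain ⟨l, hl, h⟩ := ht
    obtain ⟨l', hl', h'⟩ := ht'
    exact ⟨l + l', Submodule.add_mem _ hl hl', by
      rw [map_add, h, h', map_add, smul_add, add_add_add_comm]⟩
  | smul a t _ ht =>
    obtain ⟨l, hl, h⟩ := ht
    exact ⟨a • l, Submodule.smul_mem _ a hl, by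
      rw [map_smul, h, map_smul, smul_add, smul_comm]⟩

end ShiftTensor

section SchurShift

variable {k : Type*} [Field k] [CharZero k] (μ : YoungDiagram)

/-- The Young symmetrizer as a map from the tensor power onto the Schur functor. -/
def schurProj : (⨂[k] _ : μ.cells, Std k) →ₗ[k] (schur k μ).toSubmodule :=
  (place (cellYoungElt k μ)).codRestrict _ fun t => mem_schur_iff.2 ⟨t, rfl⟩

theorem schurProj_surjective : Function.Surjective (schurProj (k := k) μ) := fun w => by
  obtain ⟨t, ht⟩ := mem_schur_iff.1 w.2
  exact ⟨t, Subtype.ext ht⟩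

theorem schurProj_equivariant (g : GLInf k) (t : ⨂[k] _ : μ.cells, Std k) :
    schurProj μ (tensorRep k μ.cells g t) = (schur k μ).toRepresentation g (schurProj μ t) :=
  Subtype.ext (tensorRep_place g _ t).symm

/-- The endomorphism of a Schur functor induced by `e_i ↦ e_{n+i}`. -/
def schurShift (n : ℕ) : (schur k μ).toSubmodule →ₗ[k] (schur k μ).toSubmodule :=
  (shiftTensor n).restrict fun t ht => by
    obtain ⟨t, rfl⟩ := mem_schur_iff.1 ht
    exact mem_schur_iff.2 ⟨shiftTensor n t, (map_place _ _ t).symm⟩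

theorem schurShift_schurProj (n : ℕ) (t : ⨂[k] _ : μ.cells, Std k) :
    schurShift μ n (schurProj μ t) = schurProj μ (shiftTensor n t) :=
  Subtype.ext (map_place _ _ t)

theorem schurShift_equivariant (n : ℕ) (g : GLInf k) (w : (schur k μ).toSubmodule) :
    schurShift μ n ((schur k μ).toRepresentation g w) =
      (schur k μ).toRepresentation (shiftEmb n g) (schurShift μ n w) :=
  Subtype.ext (shiftTensor_equivariant n g w.1)

variable {μ}

/-- A vector of a Schur functor of degree `d` in the letters `e_i`, `i < n`, is sheared to `s^d`
times its shift, up to symmetrized tensors that contain a letter `e_i` with `i < n`. -/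
theorem exists_schur_shear_eq {n : ℕ} {w : (schur k μ).toSubmodule}
    (hw : w.1 ∈ boundedTensors k μ.cells n) (s : k) :
    ∃ l ∈ lowTensors k μ.cells n,
      (schur k μ).toRepresentation (shear _ (isShear_upShift n) s) w =
        s ^ μ.cells.card • schurShift μ n w + schurProj μ l := by
  obtain ⟨a, ha0, ha⟩ := exists_cellYoungElt_mul_self k μ
  have hproj : schurProj μ w.1 = a • w := Subtype.ext (place_of_mem_schur ha w.2)
  obtain ⟨l, hl, h⟩ := exists_shear_eq hw s
  rw [Fintype.card_coe] at h
  refine ⟨a⁻¹ • l, Submodule.smul_mem _ _ hl, ?_⟩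
  have h1 : w = a⁻¹ • schurProj μ w.1 := by rw [hproj, smul_smul, inv_mul_cancel₀ ha0, one_smul]
  conv_lhs => rw [h1]
  rw [map_smul, ← schurProj_equivariant, h, map_add, map_smul, ← schurShift_schurProj, hproj,
    map_smul, map_smul, smul_add, smul_comm _ a, smul_smul, inv_mul_cancel₀ ha0, one_smul]

end SchurShift

/-! ### Submodules generated by tensor powers and Schur functors -/

section Generation

variable {k : Type*} [Field k] {A : Type*} [CommRing A] [Algebra k A] {M : Type*} [AddCommGroup M]
  [Module k M] [Module A M] [IsScalarTower k A M]

/-- The submodules spanned by finitely many equivariant images of tensor powers of degree less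
than `d`. -/
inductive IsTensorGen (ρM : Representation k (GLInf k) M) (d : ℕ) : Submodule A M → Prop
  | bot : IsTensorGen ρM d ⊥
  | sup {N : Submodule A M} {α : Type} [Fintype α] [DecidableEq α] (hα : Fintype.card α < d)
      (θ : (⨂[k] _ : α, Std k) →ₗ[k] M) (hθ : ∀ g t, θ (tensorRep k α g t) = ρM g (θ t))
      (hN : IsTensorGen ρM d N) : IsTensorGen ρM d (N ⊔ Submodule.span A (Set.range θ))

/-- The submodules spanned by a submodule generated in degrees less than `d` and by `l` equivariant
images of Schur functors of degree `d`. -/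
inductive IsSchurGen (ρM : Representation k (GLInf k) M) (d : ℕ) : ℕ → Submodule A M → Prop
  | low {N : Submodule A M} (hN : IsTensorGen ρM d N) : IsSchurGen ρM d 0 N
  | top {N : Submodule A M} {l : ℕ} {μ : YoungDiagram} (hμ : μ.cells.card = d)
      (φ : (schur k μ).toSubmodule →ₗ[k] M)
      (hφ : ∀ g w, φ ((schur k μ).toRepresentation g w) = ρM g (φ w))
      (hN : IsSchurGen ρM d l N) : IsSchurGen ρM d (l + 1) (N ⊔ Submodule.span A (Set.range φ))

variable {ρM : Representation k (GLInf k) M} {d l : ℕ} {N N' : Submodule A M}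

theorem IsTensorGen.sup_sup (h : IsTensorGen ρM d N) (h' : IsTensorGen ρM d N') :
    IsTensorGen ρM d (N ⊔ N') := by
  induction h' with
  | bot => rwa [sup_bot_eq]
  | sup hα θ hθ _ ih => rw [← sup_assoc]; exact ih.sup hα θ hθ

theorem isTensorGen_span {α : Type} [Fintype α] [DecidableEq α] (hα : Fintype.card α < d)
    (θ : (⨂[k] _ : α, Std k) →ₗ[k] M) (hθ : ∀ g t, θ (tensorRep k α g t) = ρM g (θ t)) :
    IsTensorGen ρM d (Submodule.span A (Set.range θ)) := by
  rw [← bot_sup_eq (Submodule.span A (Set.range θ))]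
  exact IsTensorGen.bot.sup hα θ hθ

theorem IsTensorGen.finset_sup {ι : Type*} (s : Finset ι) {F : ι → Submodule A M}
    (h : ∀ i ∈ s, IsTensorGen ρM d (F i)) : IsTensorGen ρM d (s.sup F) :=
  Finset.sup_induction IsTensorGen.bot (fun _ h _ h' => h.sup_sup h') h

theorem IsSchurGen.sup_tensorGen (h : IsSchurGen ρM d l N) (h' : IsTensorGen ρM d N') :
    IsSchurGen ρM d l (N ⊔ N') := by
  induction h with
  | low hN => exact .low (hN.sup_sup h')
  | top hμ φ hφ _ ih => rw [sup_right_comm]; exact ih.top hμ φ hφ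

theorem span_range_comp_le {U U' : Type*} [AddCommMonoid U] [Module k U] [AddCommMonoid U']
    [Module k U'] (φ : U →ₗ[k] M) (f : U' →ₗ[k] U) :
    Submodule.span A (Set.range (φ ∘ₗ f)) ≤ Submodule.span A (Set.range φ) :=
  Submodule.span_mono (by rintro _ ⟨u, rfl⟩; exact ⟨f u, rfl⟩)

theorem apply_mem_of_mem_span {U : Type*} [AddCommMonoid U] [Module k U] (L : Submodule A M)
    (f : U →ₗ[k] M) {T : Set U} (h : ∀ t ∈ T, f t ∈ L) {x : U} (hx : x ∈ Submodule.span k T) :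
    f x ∈ L :=
  (Submodule.span_le.2 h : Submodule.span k T ≤ (L.restrictScalars k).comap f) hx

/-- Submodules generated by tensor powers are generated by tensor powers of the same degrees after
a shift. -/
theorem IsTensorGen.shift (h : IsTensorGen ρM d N) (n : ℕ) :
    IsTensorGen (shift n ρM : Representation k (GLInf k) M) d N := by
  classical
  induction h with
  | bot => exact .bot
  | @sup N α _ _ hα θ hθ _ ih =>
    have h1 : Submodule.span A (Set.range θ) = (Finset.univ : Finset (α → Option (Fin n))).sup
        fun κ => Submodule.span A (Set.range (θ ∘ₗ insertion κ)) := by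
      refine le_antisymm ?_ (Finset.sup_le fun κ _ => span_range_comp_le θ _)
      rw [Submodule.span_le]
      rintro _ ⟨t, rfl⟩
      refine apply_mem_of_mem_span (T := Set.range (basisTensor k : (α → ℕ) → _)) _ θ ?_
        (by rw [span_basisTensor]; exact Submodule.mem_top)
      rintro _ ⟨p, rfl⟩
      rw [← insertion_smallLetters (n := n) p]
      exact Finset.le_sup (f := fun κ => Submodule.span A (Set.range (θ ∘ₗ insertion κ)))
        (Finset.mem_univ (smallLetters n p)) (Submodule.subset_span ⟨_, rfl⟩)
    rw [h1]
    refine ih.sup_sup (IsTensorGen.finset_sup _ fun κ _ => isTensorGen_span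
      ((Fintype.card_subtype_le _).trans_lt hα) _ fun g t => ?_)
    rw [LinearMap.comp_apply, insertion_equivariant]
    exact hθ _ _

section

variable [CharZero k] {μ : YoungDiagram}

/-- After a shift by `n`, the image of a Schur functor of degree `d` is spanned by the image of the
shifted Schur functor and by a submodule generated in degrees less than `d`, which contains the
images of the tensors that contain a letter `e_i` with `i < n`. -/
theorem exists_low (hμ : μ.cells.card = d) (φ : (schur k μ).toSubmodule →ₗ[k] M)
    (hφ : ∀ g w, φ ((schur k μ).toRepresentation g w) = ρM g (φ w)) (n : ℕ) :
    ∃ L : Submodule A M, IsTensorGen (shift n ρM : Representation k (GLInf k) M) d L ∧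
      (∀ t ∈ lowTensors k μ.cells n, φ (schurProj μ t) ∈ L) ∧
      L ⊔ Submodule.span A (Set.range (φ ∘ₗ schurShift μ n)) =
        Submodule.span A (Set.range φ) := by
  classical
  let s : Finset (μ.cells → Option (Fin n)) := Finset.univ.filter fun κ => ∃ j, κ j ≠ none
  let F : (μ.cells → Option (Fin n)) → Submodule A M := fun κ =>
    Submodule.span A (Set.range (φ ∘ₗ schurProj μ ∘ₗ insertion κ))
  have hlow : ∀ t ∈ lowTensors k μ.cells n, φ (schurProj μ t) ∈ s.sup F := fun t ht => by
    refine apply_mem_of_mem_span (s.sup F) (φ ∘ₗ schurProj μ) ?_ ht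
    rintro _ ⟨p, ⟨j, hj⟩, rfl⟩
    rw [← insertion_smallLetters (n := n) p]
    refine Finset.le_sup (f := F) (b := smallLetters n p) (Finset.mem_filter.2
      ⟨Finset.mem_univ _, j, fun h => ?_⟩) (Submodule.subset_span ⟨_, rfl⟩)
    exact absurd (smallLetters_eq_none.1 h) (not_le.2 hj)
  refine ⟨s.sup F, IsTensorGen.finset_sup _ fun κ hκ => ?_, hlow, ?_⟩
  · obtain ⟨j, hj⟩ := (Finset.mem_filter.1 hκ).2
    refine isTensorGen_span ?_ _ fun g t => ?_
    · rw [← hμ, ← Fintype.card_coe]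
      exact Fintype.card_subtype_lt hj
    · simp only [LinearMap.comp_apply]
      rw [insertion_equivariant]
      exact (congrArg φ (schurProj_equivariant μ _ _)).trans (hφ _ _)
  · refine le_antisymm (sup_le (Finset.sup_le fun κ _ => span_range_comp_le φ _)
      (span_range_comp_le φ _)) ?_
    rw [Submodule.span_le]
    rintro _ ⟨w, rfl⟩
    obtain ⟨t, rfl⟩ := schurProj_surjective μ w
    obtain ⟨l, hl, t', rfl⟩ := exists_add_shiftTensor n t
    rw [map_add, map_add, ← schurShift_schurProj]
    exact Submodule.add_mem_sup (hlow l hl) (Submodule.subset_span ⟨_, rfl⟩)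

theorem schurShift_comp_equivariant (φ : (schur k μ).toSubmodule →ₗ[k] M)
    (hφ : ∀ g w, φ ((schur k μ).toRepresentation g w) = ρM g (φ w)) (n : ℕ) (g : GLInf k)
    (w : (schur k μ).toSubmodule) :
    (φ ∘ₗ schurShift μ n) ((schur k μ).toRepresentation g w) =
      shift n ρM g ((φ ∘ₗ schurShift μ n) w) := by
  rw [LinearMap.comp_apply, schurShift_equivariant]
  exact hφ _ _

theorem IsSchurGen.shift (h : IsSchurGen ρM d l N) (n : ℕ) :
    IsSchurGen (shift n ρM : Representation k (GLInf k) M) d l N := by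
  induction h with
  | low hN => exact .low (hN.shift n)
  | top hμ φ hφ _ ih =>
    obtain ⟨L, hL, -, hsup⟩ := exists_low (A := A) hμ φ hφ n
    rw [← hsup, ← sup_assoc]
    exact (ih.sup_tensorGen hL).top hμ _ (schurShift_comp_equivariant φ hφ n)

theorem IsTensorGen.exists_schurGen (h : IsTensorGen ρM (d + 1) N) :
    ∃ l, IsSchurGen ρM d l N := by
  induction h with
  | bot => exact ⟨0, .low .bot⟩
  | @sup N α _ _ hα θ hθ _ ih =>
    obtain ⟨l, hl⟩ := ih
    rcases Nat.lt_succ_iff_lt_or_eq.1 hα with hα | hα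
    · exact ⟨l, hl.sup_tensorGen (isTensorGen_span hα θ hθ)⟩
    obtain ⟨S, hS1, hS2, hS3⟩ := exists_schur_cover k α
    have key : ∀ T : Set (Submodule k (⨂[k] _ : α, Std k)), T.Finite → T ⊆ S →
        ∃ l, IsSchurGen ρM d l (N ⊔ Submodule.span A (θ '' ⋃ P ∈ T, (P : Set _))) := by
      intro T hT
      induction T, hT using Set.Finite.induction_on with
      | empty => exact fun _ => ⟨l, by simpa using hl⟩
      | @insert P T _ _ ih =>
        intro hPT
        obtain ⟨l', hl'⟩ := ih ((Set.subset_insert _ _).trans hPT)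
        obtain ⟨μ, φ, hμ, hφ, rfl⟩ := hS2 P (hPT (Set.mem_insert _ _))
        refine ⟨l' + 1, ?_⟩
        have := hl'.top (hμ.trans hα) (θ ∘ₗ φ) fun g w => by
          rw [LinearMap.comp_apply, hφ, hθ]; rfl
        rw [sup_assoc, ← Submodule.span_union] at this
        rw [Set.biUnion_insert, Set.image_union, Set.union_comm]
        convert this using 4
        rw [LinearMap.coe_comp, Set.range_comp, LinearMap.coe_range]
    obtain ⟨l', hl'⟩ := key S hS1 subset_rfl
    refine ⟨l', ?_⟩
    convert hl' using 2
    refine le_antisymm (Submodule.span_le.2 ?_)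
      (Submodule.span_mono (Set.image_subset_range _ _))
    rintro _ ⟨t, rfl⟩
    have hle : sSup S ≤ ((Submodule.span A (θ '' ⋃ P ∈ S, (P : Set _))).restrictScalars k).comap θ :=
      sSup_le fun P hP t ht => Submodule.subset_span ⟨t, Set.mem_biUnion hP ht, rfl⟩
    exact hle (hS3 ▸ Submodule.mem_top)

end

variable {ρ : GLInf k →* (A ≃ₐ[k] A)}

theorem span_range_stable (hsl : IsSemilinear ρ ρM) {U : Type*} [AddCommMonoid U] [Module k U]
    {τ : Representation k (GLInf k) U} (φ : U →ₗ[k] M) (hφ : ∀ g u, φ (τ g u) = ρM g (φ u))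
    (g : GLInf k) {m : M} (hm : m ∈ Submodule.span A (Set.range φ)) :
    ρM g m ∈ Submodule.span A (Set.range φ) := by
  induction hm using Submodule.span_induction with
  | mem m hm =>
    obtain ⟨u, rfl⟩ := hm
    exact Submodule.subset_span ⟨τ g u, hφ g u⟩
  | zero => rw [map_zero]; exact Submodule.zero_mem _
  | add x y _ _ hx hy => rw [map_add]; exact Submodule.add_mem _ hx hy
  | smul a x _ hx => rw [hsl]; exact Submodule.smul_mem _ _ hx

theorem sup_stable (g : GLInf k) (h : ∀ m ∈ N, ρM g m ∈ N) (h' : ∀ m ∈ N', ρM g m ∈ N') {m : M}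
    (hm : m ∈ N ⊔ N') : ρM g m ∈ N ⊔ N' := by
  obtain ⟨x, hx, y, hy, rfl⟩ := Submodule.mem_sup.1 hm
  rw [map_add]
  exact Submodule.add_mem_sup (h x hx) (h' y hy)

theorem IsTensorGen.stable (h : IsTensorGen ρM d N) (hsl : IsSemilinear ρ ρM) (g : GLInf k) :
    ∀ m ∈ N, ρM g m ∈ N := by
  induction h with
  | bot => rintro _ rfl; rw [map_zero]; exact Submodule.zero_mem _
  | sup hα θ hθ _ ih => exact fun m hm => sup_stable g ih (fun _ => span_range_stable hsl θ hθ g) hm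

theorem IsSchurGen.stable (h : IsSchurGen ρM d l N) (hsl : IsSemilinear ρ ρM) (g : GLInf k) :
    ∀ m ∈ N, ρM g m ∈ N := by
  induction h with
  | low hN => exact hN.stable hsl g
  | top hμ φ hφ _ ih => exact fun m hm => sup_stable g ih (fun _ => span_range_stable hsl φ hφ g) hm

end Generation

/-! ### Schur generation of direct sums -/

section SchurGeneratedSums

variable {k : Type*} [Field k] [CharZero k]

theorem IsSchurGenerated.of_surjective {W W' : Type*} [AddCommMonoid W] [Module k W]
    [AddCommMonoid W'] [Module k W'] {σ : Representation k (GLInf k) W}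
    {σ' : Representation k (GLInf k) W'} (h : IsSchurGenerated σ) (f : W →ₗ[k] W')
    (hf : ∀ g w, f (σ g w) = σ' g (f w)) (hs : Function.Surjective f) : IsSchurGenerated σ' :=
  .of_iSup (ι := Unit) (fun _ => h) (fun _ => f) (fun _ => hf) (by
    rw [iSup_const]; exact LinearMap.range_eq_top.2 hs)

theorem isSchurGenerated_schur (μ : YoungDiagram) :
    IsSchurGenerated (schur k μ).toRepresentation :=
  ⟨{⊤}, Set.finite_singleton _, fun P hP => ⟨μ, LinearMap.id, fun _ _ => rfl, by
    rw [Set.mem_singleton_iff.1 hP, LinearMap.range_id]⟩, sSup_singleton⟩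

theorem isSchurGenerated_shift_schur (μ : YoungDiagram) (n : ℕ) :
    IsSchurGenerated (shift n (schur k μ).toRepresentation :
      Representation k (GLInf k) (schur k μ).toSubmodule) :=
  (isSchurGenerated_shift_tensorRep k μ.cells n).of_surjective (schurProj μ)
    (fun _ _ => schurProj_equivariant μ _ _) (schurProj_surjective μ)

theorem isSchurGenerated_tupleRep {r : ℕ} (lam : Fin r → YoungDiagram) :
    IsSchurGenerated (tupleRep k lam) := by
  refine .of_iSup (fun i => isSchurGenerated_schur (lam i))
    (fun i => DirectSum.lof k (Fin r) (fun i => (schur k (lam i)).toSubmodule) i)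
    (fun i g w => (DirectSum.lmap_lof (fun i => (schur k (lam i)).toRepresentation g) i w).symm) ?_
  rw [eq_top_iff]
  intro x _
  induction x using DirectSum.induction_on with
  | zero => exact Submodule.zero_mem _
  | of i w => exact Submodule.mem_iSup_of_mem i ⟨w, rfl⟩
  | add x y hx hy => exact Submodule.add_mem _ (hx trivial) (hy trivial)

theorem IsSchurGenerated.prod {W W' : Type*} [AddCommMonoid W] [Module k W]
    [AddCommMonoid W'] [Module k W'] {σ : Representation k (GLInf k) W}
    {σ' : Representation k (GLInf k) W'} (h : IsSchurGenerated σ) (h' : IsSchurGenerated σ') :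
    IsSchurGenerated (σ.prod σ') := by
  obtain ⟨S, hS1, hS2, hS3⟩ := h
  obtain ⟨S', hS1', hS2', hS3'⟩ := h'
  refine ⟨Submodule.map (LinearMap.inl k W W') '' S ∪ Submodule.map (LinearMap.inr k W W') '' S',
    (hS1.image _).union (hS1'.image _), ?_, ?_⟩
  · rintro _ (⟨P, hP, rfl⟩ | ⟨P, hP, rfl⟩)
    · obtain ⟨μ, φ, hφ, rfl⟩ := hS2 P hP
      refine ⟨μ, LinearMap.inl k W W' ∘ₗ φ, fun g v => ?_, LinearMap.range_comp _ _⟩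
      rw [LinearMap.comp_apply, hφ]
      exact Prod.ext rfl (map_zero (σ' g)).symm
    · obtain ⟨μ, φ, hφ, rfl⟩ := hS2' P hP
      refine ⟨μ, LinearMap.inr k W W' ∘ₗ φ, fun g v => ?_, LinearMap.range_comp _ _⟩
      rw [LinearMap.comp_apply, hφ]
      exact Prod.ext (map_zero (σ g)).symm rfl
  · rw [eq_top_iff]
    rintro ⟨x, y⟩ -
    have h1 : sSup S ≤ (sSup (Submodule.map (LinearMap.inl k W W') '' S ∪
        Submodule.map (LinearMap.inr k W W') '' S')).comap (LinearMap.inl k W W') :=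
      sSup_le fun P hP => Submodule.map_le_iff_le_comap.1
        (le_sSup (Or.inl (Set.mem_image_of_mem _ hP)))
    have h2 : sSup S' ≤ (sSup (Submodule.map (LinearMap.inl k W W') '' S ∪
        Submodule.map (LinearMap.inr k W W') '' S')).comap (LinearMap.inr k W W') :=
      sSup_le fun P hP => Submodule.map_le_iff_le_comap.1
        (le_sSup (Or.inr (Set.mem_image_of_mem _ hP)))
    have hx : x ∈ sSup S := hS3 ▸ Submodule.mem_top
    have hy : y ∈ sSup S' := hS3' ▸ Submodule.mem_top
    have hxy : (x, y) = LinearMap.inl k W W' x + LinearMap.inr k W W' y := by simp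
    rw [hxy]
    exact Submodule.add_mem _ (h1 hx) (h2 hy)

end SchurGeneratedSums

/-! ### Generic freeness -/

section GenericallyFree

variable {k : Type*} [Field k] {A : Type*} [CommRing A] [Algebra k A]
  {M : Type*} [AddCommGroup M] [Module k M] [Module A M] [IsScalarTower k A M]

/-- A submodule is generically free if, after a shift and up to powers of a non-zero invariant
element `f`, it is the free module on a finite direct sum of Schur functors. -/
def IsGenericallyFree (ρ : GLInf k →* (A ≃ₐ[k] A)) (ρM : Representation k (GLInf k) M)
    (N : Submodule A M) : Prop :=
  ∃ (n r : ℕ) (lam : Fin r → YoungDiagram) (f : A) (ψ : TupleSpace k lam →ₗ[k] M), f ≠ 0 ∧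
    (∀ g, shift n ρ g f = f) ∧ (∀ g u, ψ (tupleRep k lam g u) = shift n ρM g (ψ u)) ∧
    Function.Injective (ψ.liftBaseChange A) ∧ (∀ u, ψ u ∈ N) ∧
    ∀ m ∈ N, ∃ j : ℕ, f ^ j • m ∈ LinearMap.range (ψ.liftBaseChange A)

variable {ρ : GLInf k →* (A ≃ₐ[k] A)} {ρM : Representation k (GLInf k) M} {N N' L : Submodule A M}

theorem isGenericallyFree_bot [Nontrivial A] : IsGenericallyFree ρ ρM (⊥ : Submodule A M) := by
  have hsub : ∀ x : A ⊗[k] TupleSpace k (fun i : Fin 0 => i.elim0), x = 0 := fun x => by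
    induction x using TensorProduct.induction_on with
    | zero => rfl
    | tmul a u =>
      have : u = 0 := DFinsupp.ext fun i => i.elim0
      rw [this, TensorProduct.tmul_zero]
    | add x y hx hy => rw [hx, hy, add_zero]
  refine ⟨0, 0, fun i => i.elim0, 1, 0, one_ne_zero, fun g => map_one _, fun g u => ?_,
    fun x y _ => (hsub x).trans (hsub y).symm, fun u => Submodule.zero_mem _, ?_⟩
  · rw [LinearMap.zero_apply, LinearMap.zero_apply, map_zero]
  · rintro _ rfl
    exact ⟨0, by rw [smul_zero]; exact Submodule.zero_mem _⟩

theorem IsGenericallyFree.of_smul_mem [IsDomain A] {n : ℕ} {f : A}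
    (h : IsGenericallyFree (shift n ρ) (shift n ρM) L) (hf0 : f ≠ 0)
    (hf : ∀ g, shift n ρ g f = f) (hL : L ≤ N) (hfN : ∀ m ∈ N, f • m ∈ L) :
    IsGenericallyFree ρ ρM N := by
  obtain ⟨m, r, lam, f', ψ, hf0', hf', hψ, hinj, hψL, hpow⟩ := h
  rw [shift_shift] at hf'
  rw [shift_shift] at hψ
  refine ⟨n + m, r, lam, f * f', ψ, mul_ne_zero hf0 hf0', fun g => ?_, hψ, hinj,
    fun u => hL (hψL u), fun x hx => ?_⟩
  · rw [map_mul, hf', ← shift_shift]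
    congr 1
    exact hf (shiftEmb m g)
  · obtain ⟨j, hj⟩ := hpow _ (hfN x hx)
    refine ⟨j + 1, ?_⟩
    have : (f * f') ^ (j + 1) • x = (f ^ j * f') • f' ^ j • f • x := by
      rw [smul_smul, smul_smul]
      congr 1
      ring
    rw [this]
    exact Submodule.smul_mem _ _ hj

variable [CharZero k]

theorem liftBaseChange_comp_eq {U U₁ U₂ : Type*} [AddCommMonoid U] [Module k U] [AddCommMonoid U₁]
    [Module k U₁] [AddCommMonoid U₂] [Module k U₂] (ψ : U₁ →ₗ[k] M) (φ : U₂ →ₗ[k] M)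
    (e : U →ₗ[k] U₁ × U₂) (x : A ⊗[k] U) :
    (ψ.coprod φ ∘ₗ e).liftBaseChange A x =
      ψ.liftBaseChange A ((LinearMap.fst k U₁ U₂ ∘ₗ e).baseChange A x) +
      φ.liftBaseChange A ((LinearMap.snd k U₁ U₂ ∘ₗ e).baseChange A x) := by
  induction x using TensorProduct.induction_on with
  | zero => simp
  | tmul a u => simp [LinearMap.liftBaseChange_tmul]
  | add x y hx hy => rw [map_add, hx, hy]; simp only [map_add]; abel

theorem liftBaseChange_coprod_injective {U U₁ U₂ : Type*} [AddCommMonoid U] [Module k U]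
    [AddCommMonoid U₁] [Module k U₁] [AddCommMonoid U₂] [Module k U₂] (ψ : U₁ →ₗ[k] M)
    (φ : U₂ →ₗ[k] M) (e : U ≃ₗ[k] U₁ × U₂) (hψ : ∀ y, ψ.liftBaseChange A y ∈ N)
    (hinj : Function.Injective (ψ.liftBaseChange A)) (hfree : ∀ x, φ.liftBaseChange A x ∈ N → x = 0) :
    Function.Injective ((ψ.coprod φ ∘ₗ e.toLinearMap).liftBaseChange A) := by
  rw [← LinearMap.ker_eq_bot, LinearMap.ker_eq_bot']
  intro x hx
  rw [liftBaseChange_comp_eq] at hx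
  set y := (LinearMap.fst k _ _ ∘ₗ e.toLinearMap).baseChange A x with hy
  set z := (LinearMap.snd k _ _ ∘ₗ e.toLinearMap).baseChange A x with hz
  have hz0 : z = 0 := hfree z (by
    rw [← neg_eq_of_add_eq_zero_right hx]
    exact N.neg_mem (hψ y))
  have hy0 : y = 0 := hinj (by rw [map_zero, ← hx, hz0, map_zero, add_zero])
  have hxyz : x = (e.symm.toLinearMap ∘ₗ LinearMap.inl k _ _).baseChange A y +
      (e.symm.toLinearMap ∘ₗ LinearMap.inr k _ _).baseChange A z := by
    rw [hy, hz]
    clear hx hy hz hz0 hy0 y z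
    induction x using TensorProduct.induction_on with
    | zero => simp
    | tmul a u =>
      simp only [LinearMap.baseChange_tmul, LinearMap.comp_apply, LinearEquiv.coe_coe]
      rw [← TensorProduct.tmul_add, ← map_add]
      simp
    | add x y hx hy =>
      conv_lhs => rw [hx, hy]
      simp only [map_add]
      exact add_add_add_comm _ _ _ _
  rw [hxyz, hy0, hz0, map_zero, map_zero, add_zero]

/-- A generically free submodule stays so if a free module on a Schur functor is added to it. -/
theorem IsGenericallyFree.sup_free (h : IsGenericallyFree ρ ρM N) {μ : YoungDiagram}
    (φ : (schur k μ).toSubmodule →ₗ[k] M)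
    (hφ : ∀ g w, φ ((schur k μ).toRepresentation g w) = ρM g (φ w))
    (hfree : ∀ x, φ.liftBaseChange A x ∈ N → x = 0) :
    IsGenericallyFree ρ ρM (N ⊔ Submodule.span A (Set.range φ)) := by
  obtain ⟨n, r, lam, f, ψ, hf0, hf, hψ, hinj, hψN, hpow⟩ := h
  obtain ⟨r', lam', e, he⟩ := ((isSchurGenerated_tupleRep lam).prod
    (isSchurGenerated_shift_schur μ n)).exists_equiv_tupleSpace
      (τ := (tupleRep k lam).prod (shift n (schur k μ).toRepresentation)) LinearMap.id
      (fun _ _ => rfl) Function.injective_id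
  have hψN' : ∀ y, ψ.liftBaseChange A y ∈ N := fun y => by
    induction y using TensorProduct.induction_on with
    | zero => rw [map_zero]; exact N.zero_mem
    | tmul a u => rw [LinearMap.liftBaseChange_tmul]; exact N.smul_mem a (hψN u)
    | add y z hy hz => rw [map_add]; exact N.add_mem hy hz
  have hle1 : LinearMap.range (ψ.liftBaseChange A) ≤
      LinearMap.range ((ψ.coprod φ ∘ₗ e.toLinearMap).liftBaseChange A) := by
    rw [LinearMap.range_liftBaseChange, LinearMap.range_liftBaseChange]
    refine Submodule.span_mono ?_
    rintro _ ⟨u, rfl⟩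
    exact ⟨e.symm (u, 0), by simp⟩
  have hle2 : Submodule.span A (Set.range φ) ≤
      LinearMap.range ((ψ.coprod φ ∘ₗ e.toLinearMap).liftBaseChange A) := by
    rw [LinearMap.range_liftBaseChange]
    refine Submodule.span_mono ?_
    rintro _ ⟨w, rfl⟩
    exact ⟨e.symm (0, w), by simp⟩
  refine ⟨n, r', lam', f, ψ.coprod φ ∘ₗ e.toLinearMap, hf0, hf, fun g u => ?_, ?_, fun u => ?_, ?_⟩
  · simp only [LinearMap.comp_apply, LinearEquiv.coe_coe]
    rw [he, LinearMap.coprod_apply, LinearMap.coprod_apply, map_add, ← hψ]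
    exact congrArg _ (hφ _ _)
  · exact liftBaseChange_coprod_injective ψ φ e hψN' hinj hfree
  · simp only [LinearMap.comp_apply, LinearEquiv.coe_coe, LinearMap.coprod_apply]
    exact Submodule.add_mem_sup (hψN _) (Submodule.subset_span ⟨_, rfl⟩)
  · intro m hm
    obtain ⟨x, hx, y, hy, rfl⟩ := Submodule.mem_sup.1 hm
    obtain ⟨j, hj⟩ := hpow x hx
    refine ⟨j, ?_⟩
    rw [smul_add]
    exact Submodule.add_mem _ (hle1 hj) (Submodule.smul_mem _ _ (hle2 hy))

theorem nonempty_schur_basis (k : Type u) [Field k] (μ : YoungDiagram) :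
    ∃ ι : Type u, Nonempty (Module.Basis ι k (schur k μ).toSubmodule) := by
  let _ : AddCommGroup (schur k μ).toSubmodule := Module.addCommMonoidToAddCommGroup k
  exact ⟨_, ⟨Module.Basis.ofVectorSpace k (schur k μ).toSubmodule⟩⟩

/-- The heart of the argument. A linear relation modulo `N` between the elements of `φ(S_μ)`,
with coefficients in `A`, is turned by shears along `e_i ↦ e_{n+i}` and by density into a single
coefficient `f` that carries all of the shifted Schur functor into any submodule that contains `N`
and the images of the tensors with a letter `e_i`, `i < n`. -/
theorem exists_smul_mem [IsDomain A] (htame : IsTame ρ) (hsl : IsSemilinear ρ ρM)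
    (hN : ∀ g, ∀ m ∈ N, ρM g m ∈ N) {μ : YoungDiagram} (φ : (schur k μ).toSubmodule →ₗ[k] M)
    (hφ : ∀ g w, φ ((schur k μ).toRepresentation g w) = ρM g (φ w))
    {x : A ⊗[k] (schur k μ).toSubmodule} (hx : φ.liftBaseChange A x ∈ N) (hx0 : x ≠ 0) :
    ∃ (n : ℕ) (f : A), f ≠ 0 ∧ (∀ g, shift n ρ g f = f) ∧ ∀ L : Submodule A M,
      (∀ g, ∀ m ∈ L, shift n ρM g m ∈ L) → N ≤ L →
      (∀ t ∈ lowTensors k μ.cells n, φ (schurProj μ t) ∈ L) →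
      ∀ w, f • φ (schurShift μ n w) ∈ L := by
  classical
  obtain ⟨ι, ⟨b⟩⟩ := nonempty_schur_basis k μ
  set a := (b.baseChange A).repr x with ha
  obtain ⟨c, hc0, -, hc⟩ := htame.exists_mul (a.support.image a)
  have hrel : ∑ i ∈ a.support, (c * a i) • φ (b i) ∈ N := by
    have h1 : φ.liftBaseChange A x = ∑ i ∈ a.support, a i • φ (b i) := by
      conv_lhs => rw [← (b.baseChange A).linearCombination_repr x]
      rw [Finsupp.linearCombination_apply, Finsupp.sum, map_sum]
      refine Finset.sum_congr rfl fun i _ => ?_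
      rw [Module.Basis.baseChange_apply, map_smul, LinearMap.liftBaseChange_tmul, one_smul]
    have h2 := N.smul_mem c (h1 ▸ hx)
    rw [Finset.smul_sum] at h2
    simpa only [smul_smul] using h2
  have hgood : ∀ i ∈ a.support, IsGood (algRep ρ) (c * a i) := fun i hi =>
    hc _ (Finset.mem_image_of_mem _ hi)
  obtain ⟨i₀, hi₀⟩ : a.support.Nonempty := by
    rw [Finsupp.support_nonempty_iff, ha, Ne, LinearEquiv.map_eq_zero_iff]
    exact hx0
  have hbound : ∀ i ∈ a.support, ∃ n, (b i).1 ∈ boundedTensors k μ.cells n ∧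
      ∀ g, algRep ρ (shiftEmb n g) (c * a i) = c * a i := fun i hi => by
    obtain ⟨n, hn⟩ := exists_mem_boundedTensors (b i).1
    obtain ⟨n', hn'⟩ := (hgood i hi).fixed
    exact ⟨max n n', boundedTensors_mono (le_max_left _ _) hn, fixed_of_le hn' (le_max_right _ _)⟩
  -- One `n` is chosen that bounds the letters in all `b i` and whose group fixes all `c * a i`.
  choose! m hm1 hm2 using hbound
  let n := a.support.sup m
  have hn1 : ∀ i ∈ a.support, (b i).1 ∈ boundedTensors k μ.cells n := fun i hi =>
    boundedTensors_mono (Finset.le_sup hi) (hm1 i hi)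
  have hn2 : ∀ i ∈ a.support, ∀ g, ρ (shiftEmb n g) (c * a i) = c * a i := fun i hi g =>
    fixed_of_le (hm2 i hi) (Finset.le_sup hi) g
  refine ⟨n, c * a i₀, mul_ne_zero hc0 (Finsupp.mem_support_iff.1 hi₀), hn2 i₀ hi₀, ?_⟩
  intro L hLst hNL hlow w
  let u : k → GLInf k := shear _ (isShear_upShift n)
  -- The sheared relation, divided by the power of `s` that occurs in it.
  let F : k → M := fun s => ∑ i ∈ a.support, ρ (u s) (c * a i) • φ (schurShift μ n (b i))
  have hF : IsPolyFun F := IsPolyFun.sum _ fun i hi =>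
    ((hgood i hi).poly _ (isShear_upShift n)).comp_linearMap
      ((LinearMap.toSpanSingleton A M (φ (schurShift μ n (b i)))).restrictScalars k)
  have hFL : ∀ s, s ≠ 0 → F s ∈ L.restrictScalars k := fun s hs => by
    have h1 := hNL (hN (u s) _ hrel)
    rw [map_sum] at h1
    choose! t ht1 ht2 using fun i (hi : i ∈ a.support) => exists_schur_shear_eq (hn1 i hi) s
    have h2 : ∑ i ∈ a.support, ρM (u s) ((c * a i) • φ (b i)) = s ^ μ.cells.card • F s +
        ∑ i ∈ a.support, ρ (u s) (c * a i) • φ (schurProj μ (t i)) := by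
      rw [Finset.smul_sum, ← Finset.sum_add_distrib]
      refine Finset.sum_congr rfl fun i hi => ?_
      rw [hsl, ← hφ, ht2 i hi, map_add, map_smul, smul_add, smul_comm]
    rw [h2] at h1
    have h3 : s ^ μ.cells.card • F s ∈ L.restrictScalars k :=
      (L.add_mem_iff_left (L.sum_mem fun i hi => L.smul_mem _ (hlow _ (ht1 i hi)))).1 h1
    exact (Submodule.smul_mem_iff _ (pow_ne_zero _ hs)).1 h3
  have hF0 : ∑ i ∈ a.support, (c * a i) • φ (schurShift μ n (b i)) ∈ L := by
    have h1 := hF.apply_zero_mem (L.restrictScalars k) hFL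
    have h2 : u 0 = 1 := shear_zero _ _
    simp only [F, h2, map_one] at h1
    exact h1
  -- By density, some `h` in the group algebra sends `b i₀` to `w` and kills the other `b i`.
  obtain ⟨h, hh⟩ := schur_density (b.constr k fun i => if i = i₀ then w else 0) (a.support.image b)
  let Q : Subrepresentation (shift n ρM : Representation k (GLInf k) M) :=
    ⟨L.restrictScalars k, fun g m hm => hLst g m hm⟩
  have h1 := asAlgebraHom_mem Q h hF0
  rw [map_sum, Finset.sum_eq_single i₀] at h1
  · have h2 := map_asAlgebraHom (ρ := (schur k μ).toRepresentation)
      (σ := (shift n ρM : Representation k (GLInf k) M)) ((c * a i₀) • (φ ∘ₗ schurShift μ n))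
      (fun g v => by
        rw [LinearMap.smul_apply, schurShift_comp_equivariant φ hφ]
        refine Eq.trans ?_ (hsl (shiftEmb n g) _ _).symm
        rw [hn2 i₀ hi₀]
        rfl) h (b i₀)
    rw [← hh _ (Finset.mem_image_of_mem _ hi₀), Module.Basis.constr_basis, if_pos rfl] at h2
    have h3 : ((c * a i₀) • (φ ∘ₗ schurShift μ n)) w ∈ L := by
      rw [h2]
      exact h1
    exact h3
  · intro i hi hne
    have h2 := map_asAlgebraHom (ρ := (schur k μ).toRepresentation)
      (σ := (shift n ρM : Representation k (GLInf k) M)) ((c * a i) • (φ ∘ₗ schurShift μ n))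
      (fun g v => by
        rw [LinearMap.smul_apply, schurShift_comp_equivariant φ hφ]
        refine Eq.trans ?_ (hsl (shiftEmb n g) _ _).symm
        rw [hn2 i hi]
        rfl) h (b i)
    rw [← hh _ (Finset.mem_image_of_mem _ hi), Module.Basis.constr_basis, if_neg hne, map_zero] at h2
    exact h2.symm
  · exact fun h => absurd hi₀ h

theorem IsSchurGen.isGenericallyFree [IsDomain A] {d : ℕ}
    (ih : ∀ (ρ : GLInf k →* (A ≃ₐ[k] A)) (ρM : Representation k (GLInf k) M) (N : Submodule A M),
      IsTame ρ → IsSemilinear ρ ρM → IsTensorGen ρM d N → IsGenericallyFree ρ ρM N)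
    (l : ℕ) : ∀ (ρ : GLInf k →* (A ≃ₐ[k] A)) (ρM : Representation k (GLInf k) M)
      (N : Submodule A M), IsTame ρ → IsSemilinear ρ ρM → IsSchurGen ρM d l N →
        IsGenericallyFree ρ ρM N := by
  induction l with
  | zero =>
    intro ρ ρM N htame hsl h
    cases h with
    | low h => exact ih ρ ρM N htame hsl h
  | succ l ihl =>
    intro ρ ρM _ htame hsl h
    cases h with
    | @top N _ μ hμ φ hφ hN =>
      by_cases hfree : ∀ x, φ.liftBaseChange A x ∈ N → x = 0
      · exact (ihl ρ ρM N htame hsl hN).sup_free φ hφ hfree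
      · push Not at hfree
        obtain ⟨x, hx, hx0⟩ := hfree
        obtain ⟨n, f, hf0, hf, hfL⟩ := exists_smul_mem htame hsl (hN.stable hsl) φ hφ hx hx0
        obtain ⟨L, hL, hlow, hsup⟩ := exists_low (A := A) hμ φ hφ n
        have hgen : IsSchurGen (PolyGL.shift n ρM : Representation k (GLInf k) M) d l (N ⊔ L) :=
          (hN.shift n).sup_tensorGen hL
        have hmem := hfL (N ⊔ L) (hgen.stable (hsl.shift n)) le_sup_left
          fun t ht => Submodule.mem_sup_right (hlow t ht)
        refine (ihl _ _ _ (htame.shift n) (hsl.shift n) hgen).of_smul_mem hf0 hf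
          (sup_le_sup_left (le_sup_left.trans hsup.le) N) fun m hm => ?_
        rw [← hsup, ← sup_assoc] at hm
        obtain ⟨y, hy, z, hz, rfl⟩ := Submodule.mem_sup.1 hm
        rw [smul_add]
        refine Submodule.add_mem _ (Submodule.smul_mem _ f hy) ?_
        clear hm
        induction hz using Submodule.span_induction with
        | mem z hz =>
          obtain ⟨w, rfl⟩ := hz
          exact hmem w
        | zero => rw [smul_zero]; exact Submodule.zero_mem _
        | add z z' _ _ hz hz' =>
          rw [smul_add]
          exact Submodule.add_mem _ hz hz'
        | smul a z _ hz =>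
          rw [smul_comm]
          exact Submodule.smul_mem _ a hz

/-- Submodules generated by finitely many equivariant images of tensor powers are generically
free. -/
theorem IsTensorGen.isGenericallyFree [IsDomain A] (d : ℕ) :
    ∀ (ρ : GLInf k →* (A ≃ₐ[k] A)) (ρM : Representation k (GLInf k) M) (N : Submodule A M),
      IsTame ρ → IsSemilinear ρ ρM → IsTensorGen ρM d N → IsGenericallyFree ρ ρM N := by
  induction d with
  | zero =>
    intro ρ ρM N _ _ h
    cases h with
    | bot => exact isGenericallyFree_bot
    | sup hα => exact absurd hα (Nat.not_lt_zero _)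
  | succ d ih =>
    intro ρ ρM N htame hsl h
    obtain ⟨l, hl⟩ := h.exists_schurGen
    exact hl.isGenericallyFree ih l ρ ρM N htame hsl

end GenericallyFree

/-! ### Finitely generated modules -/

section FinitelyGenerated

variable {k : Type*} [Field k] {A : Type*} [CommRing A] [Algebra k A]
  {M : Type*} [AddCommGroup M] [Module k M] [Module A M] [IsScalarTower k A M]
  {ρ : GLInf k →* (A ≃ₐ[k] A)} {ρM : Representation k (GLInf k) M}

theorem IsTensorGen.mono {d d' : ℕ} {N : Submodule A M} (h : IsTensorGen ρM d N) (hd : d ≤ d') :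
    IsTensorGen ρM d' N := by
  induction h with
  | bot => exact .bot
  | sup hα θ hθ _ ih => exact ih.sup (hα.trans_le hd) θ hθ

theorem exists_isTensorGen_of_mem_tensorImages {m : M} (hm : m ∈ tensorImages ρM) :
    ∃ (d : ℕ) (L : Submodule A M), IsTensorGen ρM d L ∧ m ∈ L := by
  induction hm using Submodule.span_induction with
  | mem m hm =>
    obtain ⟨d, θ, hθ, t, rfl⟩ := hm
    exact ⟨d + 1, _, isTensorGen_span (by rw [Fintype.card_fin]; exact Nat.lt_succ_self d) θ hθ,
      Submodule.subset_span ⟨t, rfl⟩⟩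
  | zero => exact ⟨0, ⊥, .bot, Submodule.zero_mem _⟩
  | add x y _ _ hx hy =>
    obtain ⟨d, L, hL, hxL⟩ := hx
    obtain ⟨d', L', hL', hyL'⟩ := hy
    exact ⟨max d d', L ⊔ L', (hL.mono (le_max_left _ _)).sup_sup (hL'.mono (le_max_right _ _)),
      Submodule.add_mem_sup hxL hyL'⟩
  | smul a x _ hx =>
    obtain ⟨d, L, hL, hxL⟩ := hx
    exact ⟨d, L, hL, L.smul_of_tower_mem a hxL⟩

theorem IsFinitelyGenerated.exists_isTensorGen_top (h : IsFinitelyGenerated A ρM)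
    (hsl : IsSemilinear ρ ρM)
    (hM : ∀ m : M, ∃ (a : A) (x : M), x ∈ tensorImages ρM ∧ m = a • x) :
    ∃ d, IsTensorGen ρM d (⊤ : Submodule A M) := by
  classical
  obtain ⟨s, hs⟩ := h
  have key : ∀ s : Finset M, ∃ (d : ℕ) (L : Submodule A M), IsTensorGen ρM d L ∧ ∀ m ∈ s, m ∈ L := by
    intro s
    induction s using Finset.induction_on with
    | empty => exact ⟨0, ⊥, .bot, fun m hm => absurd hm (Finset.notMem_empty m)⟩
    | insert m s _ ih =>
      obtain ⟨d, L, hL, hsL⟩ := ih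
      obtain ⟨a, x, hx, rfl⟩ := hM m
      obtain ⟨d', L', hL', hxL'⟩ := exists_isTensorGen_of_mem_tensorImages (A := A) hx
      refine ⟨max d d', L ⊔ L',
        (hL.mono (le_max_left _ _)).sup_sup (hL'.mono (le_max_right _ _)), fun y hy => ?_⟩
      rcases Finset.mem_insert.1 hy with rfl | hy
      · exact Submodule.mem_sup_right (L'.smul_mem a hxL')
      · exact Submodule.mem_sup_left (hsL y hy)
  obtain ⟨d, L, hL, hsL⟩ := key s
  refine ⟨d, ?_⟩
  have htop : L = ⊤ := by
    rw [eq_top_iff, ← hs, Submodule.span_le]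
    rintro _ ⟨g, x, hx, rfl⟩
    exact hL.stable hsl g x (hsL x hx)
  rwa [htop] at hL

theorem liftBaseChange_equivariant (hsl : IsSemilinear ρ ρM) {r : ℕ} {lam : Fin r → YoungDiagram}
    (ψ : TupleSpace k lam →ₗ[k] M) (hψ : ∀ g u, ψ (tupleRep k lam g u) = ρM g (ψ u)) (g : GLInf k)
    (x : A ⊗[k] TupleSpace k lam) :
    ψ.liftBaseChange A (freeRep ρ lam g x) = ρM g (ψ.liftBaseChange A x) := by
  induction x using TensorProduct.induction_on with
  | zero => simp only [map_zero]
  | tmul a u =>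
    change ψ.liftBaseChange A (ρ g a ⊗ₜ tupleRep k lam g u) = _
    rw [LinearMap.liftBaseChange_tmul, LinearMap.liftBaseChange_tmul, hsl, hψ]
  | add x y hx hy => simp only [map_add, hx, hy]

end FinitelyGenerated

/-! ### Localization at an invariant element -/

section Localization

variable {k : Type*} [Field k] {A : Type*} [CommRing A] [Algebra k A]
  {M : Type*} [AddCommGroup M] [Module k M] [Module A M] [IsScalarTower k A M] {f : A}

theorem awayModuleAction_smul {G : Type*} [Group G] {ρ : G →* (A ≃ₐ[k] A)}
    {ρM : Representation k G M} (h : IsSemilinear ρ ρM) (hf : ∀ g, ρ g f = f) (g : G)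
    (a : Localization.Away f) (x : LocalizedModule (Submonoid.powers f) M) :
    awayModuleAction h f hf g (a • x) = awayAction ρ f hf g a • awayModuleAction h f hf g x := by
  obtain ⟨b, s, rfl⟩ := IsLocalization.exists_mk'_eq (Submonoid.powers f) a
  induction x using LocalizedModule.induction_on with | _ m t
  have hact : awayAction ρ f hf g (IsLocalization.mk' (Localization.Away f) b s) =
      IsLocalization.mk' (Localization.Away f) (ρ g b) s := by
    refine (IsLocalization.algEquivOfAlgEquiv_mk' _ _ _).trans ?_
    congr 1
    obtain ⟨_, i, rfl⟩ := s
    refine Subtype.ext ?_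
    change ρ g (f ^ i) = f ^ i
    rw [map_pow, hf]
  rw [hact, ← Localization.mk_eq_mk', LocalizedModule.mk_smul_mk, awayModuleAction_mk,
    awayModuleAction_mk, LocalizedModule.mk_smul_mk, h]

/-- If the extension of `ψ` to `A ⊗ U` is injective and its image contains a multiple of each
element by a power of `f`, then it becomes an isomorphism after inverting `f`. -/
theorem exists_localized_equiv {U : Type*} [AddCommMonoid U] [Module k U] (ψ : U →ₗ[k] M)
    (hinj : Function.Injective (ψ.liftBaseChange A))
    (hpow : ∀ m, ∃ j : ℕ, f ^ j • m ∈ LinearMap.range (ψ.liftBaseChange A)) :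
    ∃ e : Localization.Away f ⊗[k] U ≃ₗ[Localization.Away f]
        LocalizedModule (Submonoid.powers f) M,
      ∀ a u, e (a ⊗ₜ u) = a • LocalizedModule.mk (ψ u) 1 := by
  have halg : ∀ (a : A) (m : M), algebraMap A (Localization.Away f) a • LocalizedModule.mk m 1 =
      LocalizedModule.mk (S := Submonoid.powers f) (a • m) 1 := fun a m => by
    rw [← Localization.mk_one_eq_algebraMap, LocalizedModule.mk_smul_mk, one_mul]
  let ψ' : U →ₗ[k] LocalizedModule (Submonoid.powers f) M :=
    { toFun := fun u => LocalizedModule.mk (ψ u) 1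
      map_add' := fun u v => by
        rw [map_add, LocalizedModule.mk_add_mk, one_smul, one_smul, one_mul]
      map_smul' := fun c u => by
        rw [RingHom.id_apply, map_smul, LocalizedModule.smul'_mk] }
  let ι : A ⊗[k] U →ₗ[A] Localization.Away f ⊗[k] U :=
    TensorProduct.AlgebraTensorModule.map (Algebra.linearMap A (Localization.Away f)) LinearMap.id
  have hι : ∀ x, ψ'.liftBaseChange (Localization.Away f) (ι x) =
      LocalizedModule.mk (ψ.liftBaseChange A x) 1 := fun x => by
    induction x using TensorProduct.induction_on with
    | zero => rw [map_zero, map_zero, map_zero, LocalizedModule.zero_mk]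
    | tmul a u =>
      change algebraMap A (Localization.Away f) a •
        LocalizedModule.mk (S := Submonoid.powers f) (ψ u) 1 = _
      rw [halg, LinearMap.liftBaseChange_tmul]
    | add x y hx hy =>
      rw [map_add, map_add, map_add, hx, hy, LocalizedModule.mk_add_mk, one_smul, one_smul, one_mul]
  -- Denominators of elements of the localized free module can be cleared.
  have hden : ∀ x : Localization.Away f ⊗[k] U, ∃ (j : ℕ) (x' : A ⊗[k] U), f ^ j • x = ι x' := by
    intro x
    induction x using TensorProduct.induction_on with
    | zero => exact ⟨0, 0, by rw [map_zero, smul_zero]⟩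
    | tmul a u =>
      obtain ⟨⟨b, s⟩, hbs⟩ := IsLocalization.surj (Submonoid.powers f) a
      obtain ⟨_, j, rfl⟩ := s
      refine ⟨j, b ⊗ₜ u, ?_⟩
      rw [TensorProduct.smul_tmul', Algebra.smul_def, mul_comm]
      exact congrArg (fun c => c ⊗ₜ[k] u) hbs
    | add x y hx hy =>
      obtain ⟨j, x', hx'⟩ := hx
      obtain ⟨i, y', hy'⟩ := hy
      refine ⟨j + i, f ^ i • x' + f ^ j • y', ?_⟩
      rw [map_add, map_smul, map_smul, ← hx', ← hy', smul_add, smul_smul, smul_smul, ← pow_add,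
        ← pow_add, add_comm i j]
  have hunit : ∀ j : ℕ, IsUnit (algebraMap A (Localization.Away f) (f ^ j)) := fun j =>
    IsLocalization.map_units (Localization.Away f) (⟨f ^ j, j, rfl⟩ : Submonoid.powers f)
  have hE : Function.Injective (ψ'.liftBaseChange (Localization.Away f)) := by
    rw [← LinearMap.ker_eq_bot, LinearMap.ker_eq_bot']
    intro x hx
    obtain ⟨j, x', hx'⟩ := hden x
    have h1 : LocalizedModule.mk (ψ.liftBaseChange A x') 1 =
        (LocalizedModule.mk 0 1 : LocalizedModule (Submonoid.powers f) M) := by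
      rw [← hι, ← hx', ← algebraMap_smul (Localization.Away f) (f ^ j) x, map_smul, hx, smul_zero,
        LocalizedModule.zero_mk]
    obtain ⟨⟨_, i, rfl⟩, hi⟩ := LocalizedModule.mk_eq.1 h1
    have h2 : f ^ i • x' = 0 := by
      refine hinj ?_
      rw [map_smul, map_zero]
      simpa [Submonoid.smul_def] using hi
    have h3 : algebraMap A (Localization.Away f) (f ^ (i + j)) • x = 0 := by
      rw [algebraMap_smul, pow_add, mul_smul, hx', ← map_smul, h2, map_zero]
    exact (hunit (i + j)).smul_eq_zero.1 h3
  have hS : Function.Surjective (ψ'.liftBaseChange (Localization.Away f)) := by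
    intro y
    induction y using LocalizedModule.induction_on with | _ m t
    obtain ⟨j, x', hx'⟩ := hpow m
    obtain ⟨v, hv⟩ := hunit j
    refine ⟨(Localization.mk 1 t * (v⁻¹ : (Localization.Away f)ˣ)) • ι x', ?_⟩
    rw [map_smul, hι, hx', ← halg, ← hv, mul_smul, smul_smul _ _ (LocalizedModule.mk m 1),
      Units.inv_mul, one_smul, LocalizedModule.mk_smul_mk, one_smul, mul_one]
  exact ⟨LinearEquiv.ofBijective _ ⟨hE, hS⟩, fun a u => rfl⟩

end Localization

end PolyGL

end

theorem theorem3p3 (k : Type*) [Field k] [CharZero k] :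
    (∀ (R : Type*) [CommRing R] [IsDomain R] [Algebra k R]
      (ρ : PolyGL.GLInf k →* (R ≃ₐ[k] R)) (_ : PolyGL.IsGLAlgebra ρ)
      (M : Type*) [AddCommGroup M] [Module k M] [Module R M] [IsScalarTower k R M]
      (ρM : Representation k (PolyGL.GLInf k) M) (hM : PolyGL.IsGLAlgebraModule ρ ρM)
      (_ : PolyGL.IsFinitelyGenerated R ρM),
      ∃ (n r : ℕ) (lam : Fin r → YoungDiagram) (f : R)
        (hf : ∀ g, PolyGL.shift n ρ g f = f), f ≠ 0 ∧
        ∃ e : LocalizedModule (Submonoid.powers f) M ≃ₗ[Localization.Away f]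
            Localization.Away f ⊗[k] PolyGL.TupleSpace k lam,
          ∀ g x, e (PolyGL.awayModuleAction (hM.semilinear.shift n) f hf g x) =
            PolyGL.freeRep (PolyGL.awayAction (PolyGL.shift n ρ) f hf) lam g (e x)) ∧
    (∀ (K : Type*) [Field K] [Algebra k K]
      (ρ : PolyGL.GLInf k →* (K ≃ₐ[k] K)) (_ : PolyGL.IsGLField ρ)
      (M : Type*) [AddCommGroup M] [Module k M] [Module K M] [IsScalarTower k K M]
      (ρM : Representation k (PolyGL.GLInf k) M) (_ : PolyGL.IsGLFieldModule ρ ρM)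
      (_ : PolyGL.IsFinitelyGenerated K ρM),
      ∃ (n r : ℕ) (lam : Fin r → YoungDiagram) (e : M ≃ₗ[K] K ⊗[k] PolyGL.TupleSpace k lam),
        ∀ g x, e (PolyGL.shift n ρM g x) =
          PolyGL.freeRep (PolyGL.shift n ρ) lam g (e x)) := by
  constructor
  · intro R _ _ _ ρ hρ M _ _ _ _ ρM hM hfg
    obtain ⟨d, hd⟩ := hfg.exists_isTensorGen_top hM.semilinear fun m =>
      ⟨1, m, hM.polynomial.mem_tensorImages m, (one_smul R m).symm⟩
    obtain ⟨n, r, lam, f, ψ, hf0, hf, hψ, hinj, -, hpow⟩ :=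
      PolyGL.IsTensorGen.isGenericallyFree d ρ ρM ⊤ hρ.isTame hM.semilinear hd
    obtain ⟨e, he⟩ := PolyGL.exists_localized_equiv (f := f) ψ hinj fun m => hpow m trivial
    refine ⟨n, r, lam, f, hf, hf0, e.symm, fun g x => ?_⟩
    rw [LinearEquiv.symm_apply_eq]
    obtain ⟨y, rfl⟩ := e.surjective x
    rw [LinearEquiv.symm_apply_apply]
    induction y using TensorProduct.induction_on with
    | zero => simp only [map_zero]
    | tmul a u =>
      change _ = e (PolyGL.awayAction (PolyGL.shift n ρ) f hf g a ⊗ₜ PolyGL.tupleRep k lam g u)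
      rw [he, he, PolyGL.awayModuleAction_smul, PolyGL.awayModuleAction_mk, hψ]
    | add x y hx hy => simp only [map_add, hx, hy]
  · intro K _ _ ρ hρ M _ _ _ _ ρM hM hfg
    obtain ⟨d, hd⟩ := hfg.exists_isTensorGen_top hM.semilinear fun m => by
      obtain ⟨a, x, hx, hm⟩ := hM.exists_smul m
      exact ⟨a, x, hx.mem_tensorImages, hm⟩
    obtain ⟨n, r, lam, f, ψ, hf0, -, hψ, hinj, -, hpow⟩ :=
      PolyGL.IsTensorGen.isGenericallyFree d ρ ρM ⊤ hρ.isTame hM.semilinear hd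
    have hsurj : Function.Surjective (ψ.liftBaseChange K) := fun m => by
      obtain ⟨j, x, hx⟩ := hpow m trivial
      refine ⟨(f ^ j)⁻¹ • x, ?_⟩
      rw [map_smul, hx, inv_smul_smul₀ (pow_ne_zero j hf0)]
    let E := LinearEquiv.ofBijective (ψ.liftBaseChange K) ⟨hinj, hsurj⟩
    refine ⟨n, r, lam, E.symm, fun g x => ?_⟩
    rw [LinearEquiv.symm_apply_eq]
    obtain ⟨y, rfl⟩ := E.surjective x
    rw [LinearEquiv.symm_apply_apply]
    exact (PolyGL.liftBaseChange_equivariant (hM.semilinear.shift n) ψ hψ g y).symm
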